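/- **Measure-and-reprogram, multiple inputs.** Let $n$ be a positive integer, $\mathcal X$ a finite non-empty set whose elements are encoded (injectively) as bit strings of length $k$ (e.g. $k=\lceil\log_2|\mathcal X|\rceil$), and $\mathcal Y=\{0,1\}^m$. A $q$-query oracle quantum algorithm $\mathcal A$ consists of a unit vector $|\phi_0\rangle$ and operators $A_1,\dots,A_q$, each a unitary possibly preceded or followed by a projection, on a finite-dimensional space that contains query registers and output registers $\mathsf X_1,\dots,\mathsf X_n$ (each holding an element of $\mathcal X$) and $\mathsf Z$. For $H:\mathcal X\to\mathcal Y$ it computes $|\phi_q^H\rangle=A_q\mathcal O^H\cdots A_1\mathcal O^H|\phi_0\rangle$, where $\mathcal O^H|c\rangle|x\rangle|y\rangle=|c\rangle|x\rangle|y\oplus c\cdot H(x)\rangle$ for $c\in\{0,1\}$, and outputs $\mathbf x\in\mathcal X^n$, obtained by measuring $\mathsf X_1\dots\mathsf X_n$, together with the (possibly quantum) content $z$ of $\mathsf Z$. A (quantum) predicate $V$ is a family of projections $\Pi_{\mathbf x,\mathbf\Theta}$ on $\mathsf Z$, for $\mathbf x\in\mathcal X^n$ and $\mathbf\Theta\in\mathcal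 Y^n$; the event $V(\mathbf x,\mathbf\Theta,z)$ is the corresponding outcome. There exists a black-box $(n+1)$-stage quantum algorithm $\mathcal S$ (one uniform program for all $n,q,\mathcal X,\mathcal Y,\mathcal A$), which has access to $\mathcal A$ only by applying the operations $A_i$, as unit-cost black boxes, and by acting on the query registers and on $\mathsf X_1,\dots,\mathsf X_n$, which has no oracle, and which runs in time polynomial in $n$, $q$, $k$ and $m=\log_2|\mathcal Y|$, with the following syntax and property. In the first stage, $\mathcal S^{\mathcal A}$ outputs a permutation $\pi$ of $\{1,\dots,n\}$ and a point $x_{\pi(1)}\in\mathcal X$, and takes $\Theta_{\pi(1)}$ as input; in each stage $1<i\le n$ it outputs a point $x_{\pi(i)}\in\mathcal X$ and takes $\Theta_{\pi(i)}$ as input; in stage $n+1$ it outputs $z$. For every such $\mathcal A$, every $\mathbf x^\circ\in\mathcal X^n$ without duplicate entries and every predicate $V$, $$\Pr_{\mathbf\Theta}\bigl[\mathbf x=\mathbf x^\circ\wedge V(\mathbf x,\mathbf\Theta,z):(\pi,\pi(\mathbf x),z)\leftarrow\langle\mathcal S^{\mathcal A},\pi(\mathbf\Theta)\rangle\bigr]\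 \ge\ \frac1{(2q+1)^{2n}}\Pr_H\bigl[\mathbf x=\mathbf x^\circ\wedge V(\mathbf x,H(\mathbf x),z):(\mathbf x,z)\leftarrow\mathcal A^H\bigr],$$ where $\mathbf\Theta\in\mathcal Y^n$ and $H:\mathcal X\to\mathcal Y$ are uniformly random and $H(\mathbf x)=(H(x_1),\dots,H(x_n))$. -/

import Mathlib

namespace MeasureReprogram

/-- Bit strings of length `l`. -/
abbrev BitStr (l : ℕ) : Type := Fin l → Bool

/-- Orthogonal projections, as matrices. -/
def IsProj {ι : Type} [Fintype ι] (P : Matrix ι ι ℂ) : Prop :=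
  P.IsHermitian ∧ P * P = P

/-! ### Oracle quantum algorithms

The oracle is a function `H : X → {0,1}^m`. -/

/-- Computational basis of the memory of an oracle algorithm: the query registers (control bit,
query input, answer register), the output registers `X₁ … Xₙ`, the output register `Z`, and a
register `E` with everything else. -/
abbrev Mem (X Z E : Type) (m n : ℕ) : Type :=
  (Bool × X × BitStr m) × ((Fin n → X) × Z × E)

/-- One elementary operation of an oracle algorithm: a unitary, possibly preceded or followed by
a projection (the algorithm aborts unless the corresponding outcome is observed). -/
def IsStep {ι : Type} [Fintype ι] [DecidableEq ι] (A : Matrix ι ι ℂ) : Prop :=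
  ∃ U P : Matrix ι ι ℂ, U ∈ Matrix.unitaryGroup ι ℂ ∧ IsProj P ∧ (A = U * P ∨ A = P * U)

/-- A `q`-query oracle quantum algorithm: operations `A₁, …, A_q` and an initial unit vector. -/
structure OracleAlg (X Z E : Type) (m n q : ℕ) [Fintype X] [DecidableEq X] [Fintype Z]
    [DecidableEq Z] [Fintype E] [DecidableEq E] where
  step : Fin q → Matrix (Mem X Z E m n) (Mem X Z E m n) ℂ
  isStep : ∀ i, IsStep (step i)
  init : Mem X Z E m n → ℂ
  init_norm : ∑ μ, ‖init μ‖ ^ 2 = 1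

/-- A quantum predicate: a projection on the register `Z` for each choice of `𝐱` and `𝚯`. -/
structure QPredicate (X Z : Type) (m n : ℕ) [Fintype Z] where
  proj : (Fin n → X) → (Fin n → BitStr m) → Matrix Z Z ℂ
  isProj : ∀ x t, IsProj (proj x t)

/-- The controlled query on basis states, `(c, x, y) ↦ (c, x, y ⊕ c · H x)`. -/
def queryMap {X Z E : Type} {m n : ℕ} (H : X → BitStr m) (μ : Mem X Z E m n) : Mem X Z E m n :=
  ((μ.1.1, μ.1.2.1, fun j => xor (μ.1.2.2 j) (μ.1.1 && H μ.1.2.1 j)), μ.2)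

/-- The unitary `𝒪^H` (`queryMap H` is its own inverse). -/
def applyOracle {X Z E : Type} {m n : ℕ} (H : X → BitStr m) (φ : Mem X Z E m n → ℂ) :
    Mem X Z E m n → ℂ :=
  fun μ => φ (queryMap H μ)

/-- Squared norm of `P v`. -/
noncomputable def predWeight {Z : Type} [Fintype Z] (P : Matrix Z Z ℂ) (v : Z → ℂ) : ℝ :=
  ∑ z, ‖(P.mulVec v) z‖ ^ 2

section
variable {X Z E : Type} {m n q : ℕ} [Fintype X] [DecidableEq X] [Fintype Z]
  [DecidableEq Z] [Fintype E] [DecidableEq E]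

/-- The state `|φ_i^H⟩ = A_i 𝒪^H ⋯ A_1 𝒪^H |φ_0⟩`. -/
noncomputable def OracleAlg.state (A : OracleAlg X Z E m n q) (H : X → BitStr m) :
    ℕ → Mem X Z E m n → ℂ
  | 0 => A.init
  | i + 1 =>
    if h : i < q then (A.step ⟨i, h⟩).mulVec (applyOracle H (OracleAlg.state A H i))
    else OracleAlg.state A H i

/-- `Pr_H[𝐱 = 𝐱° ∧ V(𝐱, H(𝐱), z) : (𝐱, z) ← A^H]`, for a uniformly random `H : X → {0,1}^m`. -/
noncomputable def OracleAlg.successProb (A : OracleAlg X Z E m n q) (V : QPredicate X Z m n)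
    (xo : Fin n → X) : ℝ :=
  (∑ H : X → BitStr m, ∑ c : Bool, ∑ x : X, ∑ y : BitStr m, ∑ e : E,
      predWeight (V.proj xo fun i => H (xo i)) fun z => A.state H q ((c, x, y), (xo, z, e))) /
    (Fintype.card (X → BitStr m) : ℝ)

end

/-! ### A programming language for black-box quantum algorithms

A program works on a classical memory of natural numbers (two-dimensional: cell `i` of array `a`)
and on work qubits, and is connected to an oracle algorithm `A`: it can apply the operations
`A_i`, and can act on the qubits of the query registers and of the output registers of `A`.  It
has no other access to `A`, and no access to a random oracle. -/

/-- Arithmetic expressions; subtraction is truncated. -/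
inductive NExpr : Type
  | lit (v : ℕ)
  | read (a i : NExpr)
  | add (e f : NExpr)
  | sub (e f : NExpr)

/-- Classical memory. -/
abbrev Store : Type := ℕ → ℕ → ℕ

/-- Value of an expression. -/
def NExpr.eval (σ : Store) : NExpr → ℕ
  | .lit v => v
  | .read a i => σ (a.eval σ) (i.eval σ)
  | .add e f => e.eval σ + f.eval σ
  | .sub e f => e.eval σ - f.eval σ

/-- Write `v` to cell `i` of array `a`. -/
def Store.write (σ : Store) (a i v : ℕ) : Store :=
  Function.update σ a (Function.update (σ a) i v)

/-- Symbolic addresses of qubits: work qubits, the control qubit of the query, bit `j` of the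
query input, bit `j` of the answer register, bit `j` of the output register `X_i`. -/
inductive QAddr : Type
  | work (a i : NExpr)
  | ctrl
  | query (j : NExpr)
  | answer (j : NExpr)
  | out (i j : NExpr)

/-- Programs. -/
inductive Prog : Type
  /-- `mem[a][i] := e` -/
  | assign (a i e : NExpr)
  /-- `mem[a][i] :=` a uniformly random element of `{0, …, e}` -/
  | rand (a i e : NExpr)
  /-- Pauli `X` -/
  | not (t : QAddr)
  /-- controlled not -/
  | cnot (c t : QAddr)
  /-- Toffoli gate -/
  | ccnot (c d t : QAddr)
  /-- Hadamard gate -/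
  | had (t : QAddr)
  /-- the gate `diag(1, exp(iπ/4))` -/
  | phase (t : QAddr)
  /-- measure qubit `r` in the computational basis and store the outcome in `mem[a][i]` -/
  | meas (r : QAddr) (a i : NExpr)
  /-- apply the operation of `A` with (zero-based) index `e` to the memory of `A` -/
  | call (e : NExpr)
  | seq (P Q : Prog)
  /-- `if e ≤ f then P else Q` -/
  | ite (e f : NExpr) (P Q : Prog)
  /-- repeat `P`, as often as the value of `e` on entry -/
  | loop (e : NExpr) (P : Prog)

/-- Actual qubits, when there are `W × W` work qubits and `X` is encoded in `k` bits. -/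
inductive Qubit (W k m n : ℕ) : Type
  | work (a i : Fin W)
  | ctrl
  | query (j : Fin k)
  | answer (j : Fin m)
  | out (i : Fin n) (j : Fin k)
  deriving DecidableEq

/-- `v` as an element of `Fin b`, if possible. -/
def toFin? (b v : ℕ) : Option (Fin b) :=
  if h : v < b then some ⟨v, h⟩ else none

/-- The qubit at an address, if there is one. -/
def QAddr.resolve (W k m n : ℕ) (σ : Store) : QAddr → Option (Qubit W k m n)
  | .work a i => (toFin? W (a.eval σ)).bind fun a' => (toFin? W (i.eval σ)).map fun i' =>
      .work a' i'
  | .ctrl => some .ctrl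
  | .query j => (toFin? k (j.eval σ)).map .query
  | .answer j => (toFin? m (j.eval σ)).map .answer
  | .out i j => (toFin? n (i.eval σ)).bind fun i' => (toFin? k (j.eval σ)).map fun j' =>
      .out i' j'

/-- The registers that hold elements of `X` can be measured and used as controls; the other
qubits can be changed as well. -/
def Qubit.writable {W k m n : ℕ} : Qubit W k m n → Bool
  | .work _ _ => true
  | .ctrl => true
  | .answer _ => true
  | .query _ => false
  | .out _ _ => false

/-- Computational basis of the work qubits together with the memory of `A`. -/
abbrev Full (W : ℕ) (X Z E : Type) (m n : ℕ) : Type :=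
  (Fin W × Fin W → Bool) × Mem X Z E m n

/-- State vectors. -/
abbrev Vec (W : ℕ) (X Z E : Type) (m n : ℕ) : Type := Full W X Z E m n → ℂ

section
variable {W k m n q : ℕ} {X Z E : Type}

/-- The value of a qubit in a basis state; elements of `X` are read through their encoding. -/
def Qubit.get (enc : X ↪ BitStr k) (s : Full W X Z E m n) : Qubit W k m n → Bool
  | .work a i => s.1 (a, i)
  | .ctrl => s.2.1.1
  | .query j => enc s.2.1.2.1 j
  | .answer j => s.2.1.2.2 j
  | .out i j => enc (s.2.2.1 i) j

/-- Flip a writable qubit in a basis state. -/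
def Qubit.flip (s : Full W X Z E m n) : Qubit W k m n → Full W X Z E m n
  | .work a i => (Function.update s.1 (a, i) (!s.1 (a, i)), s.2)
  | .ctrl => (s.1, ((!s.2.1.1, s.2.1.2), s.2.2))
  | .answer j =>
      (s.1, ((s.2.1.1, s.2.1.2.1, Function.update s.2.1.2.2 j (!s.2.1.2.2 j)), s.2.2))
  | .query _ => s
  | .out _ _ => s

/-- Flip `t` if all the qubits in `cs` are 1 (no effect if `t` is not writable or is among the
controls). -/
def gateFlip (enc : X ↪ BitStr k) (cs : List (Qubit W k m n)) (t : Qubit W k m n)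
    (ψ : Vec W X Z E m n) : Vec W X Z E m n :=
  if t.writable = true ∧ t ∉ cs then
    fun s => ψ (if cs.all (fun c => c.get enc s) then t.flip s else s)
  else ψ

/-- Hadamard gate (no effect on a qubit that is not writable). -/
noncomputable def gateHad (enc : X ↪ BitStr k) (t : Qubit W k m n) (ψ : Vec W X Z E m n) :
    Vec W X Z E m n :=
  if t.writable = true then
    fun s => ((Real.sqrt 2 : ℝ) : ℂ)⁻¹ * (ψ (t.flip s) + if t.get enc s then -ψ s else ψ s)
  else ψ

/-- The gate `diag(1, exp(iπ/4))`. -/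
noncomputable def gatePhase (enc : X ↪ BitStr k) (t : Qubit W k m n) (ψ : Vec W X Z E m n) :
    Vec W X Z E m n :=
  fun s => if t.get enc s then Complex.exp (Complex.I * Real.pi / 4) * ψ s else ψ s

/-- Unnormalized state after measuring `r` with outcome `b`. -/
def measProj (enc : X ↪ BitStr k) (r : Qubit W k m n) (b : Bool) (ψ : Vec W X Z E m n) :
    Vec W X Z E m n :=
  fun s => if r.get enc s = b then ψ s else 0

/-- A classical-quantum branch of a computation: classical memory, unnormalized state vector
(whose squared norm includes the probability of the branch) and number of steps made so far. -/
structure Config (W : ℕ) (X Z E : Type) (m n : ℕ) where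
  mem : Store
  vec : Vec W X Z E m n
  time : ℕ

/-- Count one step. -/
def Config.tick (c : Config W X Z E m n) : Config W X Z E m n := { c with time := c.time + 1 }

/-- Count one step and change the state vector. -/
def Config.upd (c : Config W X Z E m n) (f : Vec W X Z E m n → Vec W X Z E m n) :
    Config W X Z E m n := { c with vec := f c.vec, time := c.time + 1 }

variable [Fintype X] [DecidableEq X] [Fintype Z] [DecidableEq Z] [Fintype E] [DecidableEq E]

/-- Apply the operation of `A` with index `i` to the memory of `A`. -/
noncomputable def applyCall (A : OracleAlg X Z E m n q) (i : ℕ) (ψ : Vec W X Z E m n) :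
    Vec W X Z E m n :=
  if h : i < q then fun s => (A.step ⟨i, h⟩).mulVec (fun μ => ψ (s.1, μ)) s.2 else ψ

/-- Semantics of programs: the list of all branches.  Every elementary operation, every test and
every iteration of a loop counts as one step.  Operations on addresses out of range have no
effect. -/
noncomputable def Prog.exec (enc : X ↪ BitStr k) (A : OracleAlg X Z E m n q) :
    Prog → Config W X Z E m n → List (Config W X Z E m n)
  | .assign a i e, c =>
      [{ c.tick with mem := c.mem.write (a.eval c.mem) (i.eval c.mem) (e.eval c.mem) }]
  | .rand a i e, c =>
      (List.range (e.eval c.mem + 1)).map fun v =>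
        { mem := c.mem.write (a.eval c.mem) (i.eval c.mem) v
          vec := fun s => ((Real.sqrt (e.eval c.mem + 1) : ℝ) : ℂ)⁻¹ * c.vec s
          time := c.time + 1 }
  | .not t, c =>
      match t.resolve W k m n c.mem with
      | some t' => [c.upd (gateFlip enc [] t')]
      | none => [c.tick]
  | .cnot d t, c =>
      match d.resolve W k m n c.mem, t.resolve W k m n c.mem with
      | some d', some t' => [c.upd (gateFlip enc [d'] t')]
      | _, _ => [c.tick]
  | .ccnot d d₂ t, c =>
      match d.resolve W k m n c.mem, d₂.resolve W k m n c.mem, t.resolve W k m n c.mem with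
      | some d', some d₂', some t' => [c.upd (gateFlip enc [d', d₂'] t')]
      | _, _, _ => [c.tick]
  | .had t, c =>
      match t.resolve W k m n c.mem with
      | some t' => [c.upd (gateHad enc t')]
      | none => [c.tick]
  | .phase t, c =>
      match t.resolve W k m n c.mem with
      | some t' => [c.upd (gatePhase enc t')]
      | none => [c.tick]
  | .meas r a i, c =>
      match r.resolve W k m n c.mem with
      | some r' =>
        [{ mem := c.mem.write (a.eval c.mem) (i.eval c.mem) 0
           vec := measProj enc r' false c.vec
           time := c.time + 1 },
         { mem := c.mem.write (a.eval c.mem) (i.eval c.mem) 1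
           vec := measProj enc r' true c.vec
           time := c.time + 1 }]
      | none => [c.tick]
  | .call e, c => [c.upd (applyCall A (e.eval c.mem))]
  | .seq P Q, c => (Prog.exec enc A P c).flatMap (Prog.exec enc A Q)
  | .ite e f P Q, c =>
      if e.eval c.mem ≤ f.eval c.mem then Prog.exec enc A P c.tick else Prog.exec enc A Q c.tick
  | .loop e P, c =>
      (fun L : List (Config W X Z E m n) => L.flatMap fun d => Prog.exec enc A P d.tick)^[
        e.eval c.mem] [c.tick]

end

/-! ### Multi-stage simulators

A program is used as an `(n+1)`-stage algorithm by running it once per stage, with the memory kept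
between the stages.  Array 0 holds `n, q, k, m` and the number `s = 0, …, n` of the stage.  The
permutation is read from array 1 at the end of the first stage, the output in `X` of each of the
first `n` stages from array 2, and the value received in return is written to array 3. -/

/-- State of the interaction: a branch, the announced permutation, and the outputs in `X` of the
stages so far, as bit strings. -/
structure Interaction (W k : ℕ) (X Z E : Type) (m n : ℕ) where
  cfg : Config W X Z E m n
  perm : Fin n → ℕ
  outs : Fin n → BitStr k

/-- The value `Θ_{π(s)}` (zero-based) that is received in return for the output of stage `s`. -/
def reply {m n : ℕ} (T : Fin n → BitStr m) (perm : Fin n → ℕ) (s : ℕ) : BitStr m :=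
  if h : s < n then
    if hp : perm ⟨s, h⟩ < n then T ⟨perm ⟨s, h⟩, hp⟩ else fun _ => false
  else fun _ => false

/-- Classical memory at the beginning of stage `s`. -/
def stageInput {m n : ℕ} (T : Fin n → BitStr m) (perm : Fin n → ℕ) (s : ℕ) (σ : Store) : Store :=
  fun a i =>
    if a = 0 ∧ i = 4 then s
    else if h : a = 3 ∧ i < m ∧ 0 < s then (if reply T perm (s - 1) ⟨i, h.2.1⟩ then 1 else 0)
    else σ a i

section
variable {k m n q : ℕ} {X Z E : Type} [Fintype X] [DecidableEq X] [Fintype Z] [DecidableEq Z]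
  [Fintype E] [DecidableEq E]

/-- Start: the parameters are in array 0, all work qubits are 0, and the memory of `A` is in its
initial state. -/
noncomputable def startInteraction (W : ℕ) (k : ℕ) (A : OracleAlg X Z E m n q) :
    Interaction W k X Z E m n where
  cfg :=
    { mem := fun a i =>
        if a = 0 then (if i = 0 then n else if i = 1 then q else if i = 2 then k
          else if i = 3 then m else 0)
        else 0
      vec := fun s => if s.1 = (fun _ => false) then A.init s.2 else 0
      time := 0 }
  perm := fun _ => 0
  outs := fun _ _ => false

/-- Stage `s` of the interaction. -/
noncomputable def runStage {W : ℕ} (S : Prog) (enc : X ↪ BitStr k) (A : OracleAlg X Z E m n q)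
    (T : Fin n → BitStr m) (s : ℕ) (r : Interaction W k X Z E m n) :
    List (Interaction W k X Z E m n) :=
  (S.exec enc A { r.cfg with mem := stageInput T r.perm s r.cfg.mem }).map fun d =>
    { cfg := d
      perm := if s = 0 then fun i => d.mem 1 i else r.perm
      outs := fun i => if (i : ℕ) = s then fun j => decide (d.mem 2 j ≠ 0) else r.outs i }

/-- All branches after the first `s` stages. -/
noncomputable def runStages (W : ℕ) (S : Prog) (enc : X ↪ BitStr k) (A : OracleAlg X Z E m n q)
    (T : Fin n → BitStr m) : ℕ → List (Interaction W k X Z E m n)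
  | 0 => [startInteraction W k A]
  | s + 1 => (runStages W S enc A T s).flatMap (runStage S enc A T s)

/-- The announced permutation is `π`. -/
def Interaction.Announces {W : ℕ} (r : Interaction W k X Z E m n) (π : Equiv.Perm (Fin n)) :
    Prop :=
  ∀ i, r.perm i = (π i : ℕ)

/-- The outputs of the first `n` stages are `x_{π(1)}, …, x_{π(n)}` with `π` the announced
permutation and `𝐱 = xo`. -/
def Interaction.Extracts {W : ℕ} (r : Interaction W k X Z E m n) (enc : X ↪ BitStr k)
    (xo : Fin n → X) : Prop :=
  ∃ π : Equiv.Perm (Fin n), r.Announces π ∧ ∀ i, r.outs i = enc (xo (π i))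

/-- Syntax of a multi-stage simulator: with certainty, the first stage outputs a permutation, and
each of the first `n` stages outputs an element of `X`. -/
def WellFormed (W : ℕ) (S : Prog) (enc : X ↪ BitStr k) (A : OracleAlg X Z E m n q) : Prop :=
  ∀ (T : Fin n → BitStr m) (s : ℕ), s ≤ n → ∀ r ∈ runStages W S enc A T (s + 1), r.cfg.vec ≠ 0 →
    (∃ π, r.Announces π) ∧ ∀ i : Fin n, (i : ℕ) ≤ s → ∃ x, r.outs i = enc x

/-- All `n+1` stages together make at most `t` steps, in every branch. -/
def RunsInTime (W : ℕ) (S : Prog) (enc : X ↪ BitStr k) (A : OracleAlg X Z E m n q) (t : ℕ) :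
    Prop :=
  ∀ (T : Fin n → BitStr m), ∀ r ∈ runStages W S enc A T (n + 1), r.cfg.time ≤ t

open scoped Classical in
/-- `Pr_𝚯[𝐱 = 𝐱° ∧ V(𝐱, 𝚯, z) : (π, π(𝐱), z) ← ⟨S^A, π(𝚯)⟩]`, for uniformly random `𝚯`; the
final output `z` is the content of the register `Z`. -/
noncomputable def simProb (W : ℕ) (S : Prog) (enc : X ↪ BitStr k) (A : OracleAlg X Z E m n q)
    (V : QPredicate X Z m n) (xo : Fin n → X) : ℝ :=
  (∑ T : Fin n → BitStr m, ((runStages W S enc A T (n + 1)).map fun r =>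
      if r.Extracts enc xo then
        ∑ w : Fin W × Fin W → Bool, ∑ c : Bool, ∑ x : X, ∑ y : BitStr m, ∑ x' : Fin n → X, ∑ e : E,
          predWeight (V.proj xo T) fun z => r.cfg.vec (w, ((c, x, y), (x', z, e)))
      else 0).sum) /
    (Fintype.card (Fin n → BitStr m) : ℝ)

end

end MeasureReprogram

set_option linter.unusedSectionVars false

namespace MeasureReprogram

/-! ### Reasoning about programs -/

section
variable {W k m n q : ℕ} {X Z E : Type} [Fintype X] [DecidableEq X] [Fintype Z] [DecidableEq Z]
  [Fintype E] [DecidableEq E] {enc : X ↪ BitStr k} {A : OracleAlg X Z E m n q}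

/-! Fix the points `xo` and the values `T`, and run `A` with an oracle `G` reprogrammed to `T j` at
`xo j` for every `j`. For a single `j` this run is an alternating sum of `2q + 1` runs: in run
number `a` the oracle is not reprogrammed at `xo j` at first, query `a / 2` is measured and found to
be `xo j`, and the reprogramming takes effect with that query (`a` even) or just after it (`a` odd).
For `a = 2q` nothing happens before the end, and the output register takes the place of the query.
This is `modeState_eq_sum`. It telescopes, because reprogramming at `xo j` does not affect the part
of the state that queries another point. By Cauchy–Schwarz the weight of the full run is at most `2q
+ 1` times the sum of the weights of these runs. Expanding all `n` inputs in turn gives the factor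
`(2q + 1)^n` in `outWeight_le_sum_modes`. The simulator draws the `n` numbers `a` uniformly (the
schedule), which costs another `(2q + 1)^n`. Together they make the exponent `2n`. The permutation
is the stable sort of the inputs by scheduled time, so each stage runs `A` up to the next
measurement, outputs the outcome, and stores the reply for the following stages. If two inputs are
scheduled at the same query, the stages need not follow the intended run. But then the intended run
would have to find one register equal to two different points, so its weight is 0
(`modeState_eq_zero`) and the lower bound is trivial there. `simRun_eq` and `outWeight_simulated`
make the comparison. The simulator has no oracle, so `G` is a hash function with a random seed. Bit
`j` of the hash of `x` is a random linear form in the coefficients of the powers `p_x ^ i`, `i <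
2q`, where `p_x` is the polynomial over the two-element field whose coefficients are the bits of
`x`. By the Vandermonde argument its values on at most `2q` points are uniform and independent
(`hashLin_surjective`), and no irreducible polynomial is needed. An amplitude after `q` queries is a
combination of functions of `q` oracle values, and a probability one of `2q` values
(`outWeight_mem_localFuns`). Hence averages over the seed and over all functions agree exactly
(`sum_hash_eq`). Finally, a random function reprogrammed at `xo` to random `T` is a random function
`H` with `T = H(xo)` (`sum_patch`). The rest is implementation. A query is a Toffoli circuit that
computes powers and comparisons, adds a mask to the answer register and uncomputes
(`det_queryProg`). Classical bookkeeping is verified with the predicates `Det` and `Branches`, and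
the time bound follows from the bounds on the loops (`Prog.time_le`). -/

/-- The branches of `P` from `c` are indexed by `ι`, and the branch with index `i` satisfies
`Q i`. -/
def Branches (enc : X ↪ BitStr k) (A : OracleAlg X Z E m n q) {ι : Type} [Fintype ι] (P : Prog)
    (c : Config W X Z E m n) (Q : ι → Store → Vec W X Z E m n → Prop) : Prop :=
  ∃ g : ι → Config W X Z E m n,
    (P.exec enc A c : Multiset (Config W X Z E m n)) = Finset.univ.val.map g ∧
      ∀ i, Q i (g i).mem (g i).vec

/-- `P` has exactly one branch from `c`, and this branch satisfies `Q`. -/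
def Det (enc : X ↪ BitStr k) (A : OracleAlg X Z E m n q) (P : Prog) (c : Config W X Z E m n)
    (Q : Store → Vec W X Z E m n → Prop) : Prop :=
  ∃ c', P.exec enc A c = [c'] ∧ Q c'.mem c'.vec

theorem Det.mono {P : Prog} {c : Config W X Z E m n} {Q R : Store → Vec W X Z E m n → Prop}
    (h : Det enc A P c Q) (hQR : ∀ σ ψ, Q σ ψ → R σ ψ) : Det enc A P c R := by
  obtain ⟨c', h1, h2⟩ := h
  exact ⟨c', h1, hQR _ _ h2⟩

theorem Branches.mono {ι : Type} [Fintype ι] {P : Prog} {c : Config W X Z E m n}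
    {Q R : ι → Store → Vec W X Z E m n → Prop}
    (h : Branches enc A P c Q) (hQR : ∀ i σ ψ, Q i σ ψ → R i σ ψ) : Branches enc A P c R := by
  obtain ⟨g, h1, h2⟩ := h
  exact ⟨g, h1, fun i => hQR _ _ _ (h2 i)⟩

theorem Det.seq {P R : Prog} {c : Config W X Z E m n} {Q : Store → Vec W X Z E m n → Prop}
    {S : Store → Vec W X Z E m n → Prop} (hP : Det enc A P c S)
    (hR : ∀ c' : Config W X Z E m n, S c'.mem c'.vec → Det enc A R c' Q) :
    Det enc A (.seq P R) c Q := by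
  obtain ⟨c', h1, h2⟩ := hP
  obtain ⟨c'', h3, h4⟩ := hR c' h2
  exact ⟨c'', by simp [Prog.exec, h1, h3], h4⟩

theorem Det.seq_branches {ι : Type} [Fintype ι] {P R : Prog} {c : Config W X Z E m n}
    {Q : ι → Store → Vec W X Z E m n → Prop}
    {S : Store → Vec W X Z E m n → Prop} (hP : Det enc A P c S)
    (hR : ∀ c' : Config W X Z E m n, S c'.mem c'.vec → Branches enc A R c' Q) :
    Branches enc A (.seq P R) c Q := by
  obtain ⟨c', h1, h2⟩ := hP
  obtain ⟨g, h3, h4⟩ := hR c' h2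
  exact ⟨g, by simpa [Prog.exec, h1] using h3, h4⟩

theorem Branches.seq {ι κ : Type} [Fintype ι] [Fintype κ] {P R : Prog} {c : Config W X Z E m n}
    {S : ι → Store → Vec W X Z E m n → Prop} {Q : ι × κ → Store → Vec W X Z E m n → Prop}
    (hP : Branches enc A P c S)
    (hR : ∀ i, ∀ c' : Config W X Z E m n, S i c'.mem c'.vec →
      Branches enc A R c' fun j => Q (i, j)) :
    Branches enc A (.seq P R) c Q := by
  obtain ⟨g, h1, h2⟩ := hP
  choose g' h3 h4 using fun i => hR i (g i) (h2 i)
  refine ⟨fun p => g' p.1 p.2, ?_, fun p => h4 p.1 p.2⟩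
  simp only [Prog.exec, ← Multiset.coe_bind, h1, Multiset.bind_map, h3]
  rw [← Finset.univ_product_univ, Finset.product_val]
  simp [SProd.sprod, Multiset.product, Multiset.map_bind]

theorem Branches.seq_det {ι : Type} [Fintype ι] {P R : Prog} {c : Config W X Z E m n}
    {S : ι → Store → Vec W X Z E m n → Prop} {Q : ι → Store → Vec W X Z E m n → Prop}
    (hP : Branches enc A P c S)
    (hR : ∀ i, ∀ c' : Config W X Z E m n, S i c'.mem c'.vec → Det enc A R c' (Q i)) :
    Branches enc A (.seq P R) c Q := by
  obtain ⟨g, h1, h2⟩ := hP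
  choose g' h3 h4 using fun i => hR i (g i) (h2 i)
  refine ⟨g', ?_, h4⟩
  simp only [Prog.exec, ← Multiset.coe_bind, h1, Multiset.bind_map, h3]
  simp

theorem det_assign {a i e : NExpr} {c : Config W X Z E m n}
    {Q : Store → Vec W X Z E m n → Prop}
    (h : Q (c.mem.write (a.eval c.mem) (i.eval c.mem) (e.eval c.mem)) c.vec) :
    Det enc A (.assign a i e) c Q :=
  ⟨_, rfl, h⟩

theorem det_ite {e f : NExpr} {P R : Prog} {c : Config W X Z E m n}
    {Q : Store → Vec W X Z E m n → Prop}
    (h1 : e.eval c.mem ≤ f.eval c.mem → Det enc A P c.tick Q)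
    (h2 : ¬ e.eval c.mem ≤ f.eval c.mem → Det enc A R c.tick Q) :
    Det enc A (.ite e f P R) c Q := by
  by_cases h : e.eval c.mem ≤ f.eval c.mem
  · simpa [Det, Prog.exec, h] using h1 h
  · simpa [Det, Prog.exec, h] using h2 h

theorem branches_ite {ι : Type} [Fintype ι] {e f : NExpr} {P R : Prog} {c : Config W X Z E m n}
    {Q : ι → Store → Vec W X Z E m n → Prop}
    (h1 : e.eval c.mem ≤ f.eval c.mem → Branches enc A P c.tick Q)
    (h2 : ¬ e.eval c.mem ≤ f.eval c.mem → Branches enc A R c.tick Q) :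
    Branches enc A (.ite e f P R) c Q := by
  by_cases h : e.eval c.mem ≤ f.eval c.mem
  · simpa [Branches, Prog.exec, h] using h1 h
  · simpa [Branches, Prog.exec, h] using h2 h

theorem det_loop {e : NExpr} {P : Prog} {c : Config W X Z E m n}
    (I : ℕ → Store → Vec W X Z E m n → Prop) (N : ℕ) (hN : e.eval c.mem = N)
    (h0 : I 0 c.mem c.vec)
    (hs : ∀ i < N, ∀ c' : Config W X Z E m n, I i c'.mem c'.vec → Det enc A P c' (I (i + 1))) :
    Det enc A (.loop e P) c (I N) := by
  have key : ∀ j ≤ N, ∃ c' : Config W X Z E m n,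
      (fun L : List (Config W X Z E m n) => L.flatMap fun d => Prog.exec enc A P d.tick)^[j]
        [c.tick] = [c'] ∧ I j c'.mem c'.vec := by
    intro j
    induction j with
    | zero => exact fun _ => ⟨_, rfl, h0⟩
    | succ j ih =>
      intro hj
      obtain ⟨c', h1, h2⟩ := ih (by omega)
      obtain ⟨c'', h3, h4⟩ := hs j (by omega) c'.tick h2
      refine ⟨c'', ?_, h4⟩
      rw [Function.iterate_succ_apply', h1]
      simpa using h3
  obtain ⟨c', h1, h2⟩ := key N le_rfl
  exact ⟨c', by simpa [Prog.exec, hN] using h1, h2⟩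

/-- The results of the iterations are collected in a tuple that `Fin.snoc` extends on the right. A
loop of `N` draws thus has one branch for each function on `Fin N`, and a loop of `k` measurements
one for each bit string. -/
theorem branches_loop {α : Type} [Fintype α] {e : NExpr} {P : Prog} {c : Config W X Z E m n}
    (I : (i : ℕ) → (Fin i → α) → Store → Vec W X Z E m n → Prop) (N : ℕ)
    (hN : e.eval c.mem = N) (h0 : ∀ f, I 0 f c.mem c.vec)
    (hs : ∀ i < N, ∀ f, ∀ c' : Config W X Z E m n, I i f c'.mem c'.vec →
      Branches enc A P c' fun a : α => I (i + 1) (Fin.snoc (α := fun _ => α) f a)) :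
    Branches enc A (.loop e P) c (I N) := by
  have key : ∀ j ≤ N, ∃ g : (Fin j → α) → Config W X Z E m n,
      ((fun L : List (Config W X Z E m n) => L.flatMap fun d => Prog.exec enc A P d.tick)^[j]
        [c.tick] : Multiset (Config W X Z E m n)) = Finset.univ.val.map g ∧
      ∀ f, I j f (g f).mem (g f).vec := by
    intro j
    induction j with
    | zero => exact fun _ => ⟨fun _ => c.tick, rfl, h0⟩
    | succ j ih =>
      intro hj
      obtain ⟨g, h1, h2⟩ := ih (by omega)
      choose g' h3 h4 using fun f => hs j (by omega) f (g f).tick (h2 f)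
      refine ⟨fun f => g' (Fin.init f) (f (Fin.last j)), ?_, fun f => ?_⟩
      · rw [Function.iterate_succ_apply', ← Multiset.coe_bind, h1, Multiset.bind_map]
        simp only [h3]
        -- The branches come as a nested enumeration, first over the earlier results and then over
        -- the new one; this equivalence turns it into an enumeration of the longer tuples.
        have e1 := congrArg Finset.val
          (Finset.map_univ_equiv ((Equiv.prodComm (Fin j → α) α).trans
            (Fin.snocEquiv (fun _ : Fin (j + 1) => α))))
        rw [← e1, ← Finset.univ_product_univ, Finset.map_val, Finset.product_val,
          Multiset.map_map, SProd.sprod, Multiset.instSProd]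
        simp only [Multiset.product, Multiset.map_bind, Multiset.map_map, Function.comp_def]
        refine Multiset.bind_congr fun f _ => Multiset.map_congr rfl fun a _ => ?_
        simp [Fin.snocEquiv]
      · have := h4 (Fin.init f) (f (Fin.last j))
        simpa only [Fin.snoc_init_self] using this
  obtain ⟨g, h1, h2⟩ := key N le_rfl
  exact ⟨g, by simpa [Prog.exec, hN] using h1, h2⟩

/-! ### Counting loops -/

theorem Store.write_apply (σ : Store) (a i v b j : ℕ) :
    σ.write a i v b j = if b = a ∧ j = i then v else σ b j := by
  unfold Store.write
  by_cases h : b = a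
  · subst h
    by_cases h' : j = i
    · subst h'; simp
    · simp [h']
  · simp [h]

/-- Cell 0 of array `p`. -/
def cell (p : ℕ) : NExpr := .read (.lit p) (.lit 0)

@[simp] theorem eval_cell (σ : Store) (p : ℕ) : (cell p).eval σ = σ p 0 := rfl

/-- Run `P` with cell 0 of array `p` counting from 0 up to (excluding) the value of `e`. -/
def countUp (p : ℕ) (e : NExpr) (P : Prog) : Prog :=
  .seq (.assign (.lit p) (.lit 0) (.lit 0))
    (.loop e (.seq P (.assign (.lit p) (.lit 0) (.add (cell p) (.lit 1)))))

/-- Run `P` with cell 0 of array `p` counting from the value of `e` (excluding) down to 0. -/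
def countDown (p : ℕ) (e : NExpr) (P : Prog) : Prog :=
  .seq (.assign (.lit p) (.lit 0) e)
    (.loop e (.seq (.assign (.lit p) (.lit 0) (.sub (cell p) (.lit 1))) P))

theorem det_countUp {p : ℕ} {e : NExpr} {P : Prog} {c : Config W X Z E m n}
    (I : ℕ → Store → Vec W X Z E m n → Prop) (N : ℕ) (hN : e.eval (c.mem.write p 0 0) = N)
    (h0 : I 0 (c.mem.write p 0 0) c.vec)
    (hs : ∀ i < N, ∀ c' : Config W X Z E m n, c'.mem p 0 = i → I i c'.mem c'.vec →
      Det enc A P c' fun σ ψ => σ p 0 = i ∧ I (i + 1) (σ.write p 0 (i + 1)) ψ) :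
    Det enc A (countUp p e P) c fun σ ψ => σ p 0 = N ∧ I N σ ψ := by
  refine Det.seq (S := fun σ ψ => σ = c.mem.write p 0 0 ∧ ψ = c.vec) (det_assign ⟨rfl, rfl⟩) ?_
  rintro c₁ ⟨h1, h2⟩
  refine det_loop (fun i σ ψ => σ p 0 = i ∧ I i σ ψ) N (by rw [h1, hN]) ?_ ?_
  · rw [h1, h2]; exact ⟨by simp [Store.write_apply], h0⟩
  · rintro i hi c' ⟨h3, h4⟩
    refine Det.seq (hs i hi c' h3 h4) ?_
    rintro c'' ⟨h5, h6⟩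
    refine det_assign ?_
    simp only [NExpr.eval, eval_cell, h5]
    exact ⟨by simp [Store.write_apply], h6⟩

theorem branches_countUp {α : Type} [Fintype α] {p : ℕ} {e : NExpr} {P : Prog}
    {c : Config W X Z E m n}
    (I : (i : ℕ) → (Fin i → α) → Store → Vec W X Z E m n → Prop) (N : ℕ)
    (hN : e.eval (c.mem.write p 0 0) = N)
    (h0 : ∀ f, I 0 f (c.mem.write p 0 0) c.vec)
    (hs : ∀ i < N, ∀ f, ∀ c' : Config W X Z E m n, c'.mem p 0 = i → I i f c'.mem c'.vec →
      Branches enc A P c' fun (a : α) σ ψ =>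
        σ p 0 = i ∧ I (i + 1) (Fin.snoc (α := fun _ => α) f a) (σ.write p 0 (i + 1)) ψ) :
    Branches enc A (countUp p e P) c (I N) := by
  refine Det.seq_branches (S := fun σ ψ => σ = c.mem.write p 0 0 ∧ ψ = c.vec)
    (det_assign ⟨rfl, rfl⟩) ?_
  rintro c₁ ⟨h1, h2⟩
  refine Branches.mono (branches_loop (fun i f σ ψ => σ p 0 = i ∧ I i f σ ψ) N
    (by rw [h1, hN]) ?_ ?_) (fun _ _ _ h => h.2)
  · rw [h1, h2]; exact fun f => ⟨by simp [Store.write_apply], h0 f⟩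
  · rintro i hi f c' ⟨h3, h4⟩
    refine Branches.seq_det (hs i hi f c' h3 h4) ?_
    rintro a c'' ⟨h5, h6⟩
    refine det_assign ?_
    simp only [NExpr.eval, eval_cell, h5]
    exact ⟨by simp [Store.write_apply], h6⟩

/-- The counter is decreased before the body runs, so the body sees `N - 1, …, 0`: the values of
`countUp` in the opposite order, as needed to run a circuit backwards. -/
theorem det_countDown {p : ℕ} {e : NExpr} {P : Prog} {c : Config W X Z E m n}
    (I : ℕ → Store → Vec W X Z E m n → Prop) (N : ℕ) (hN : e.eval c.mem = N)
    (hN' : e.eval (c.mem.write p 0 N) = N)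
    (h0 : I N (c.mem.write p 0 N) c.vec)
    (hs : ∀ i < N, ∀ c' : Config W X Z E m n, c'.mem p 0 = i + 1 → I (i + 1) c'.mem c'.vec →
      Det enc A P { c' with mem := c'.mem.write p 0 i } fun σ ψ => σ p 0 = i ∧ I i σ ψ) :
    Det enc A (countDown p e P) c fun σ ψ => σ p 0 = 0 ∧ I 0 σ ψ := by
  refine Det.seq (S := fun σ ψ => σ = c.mem.write p 0 N ∧ ψ = c.vec)
    (det_assign ⟨by rw [hN]; rfl, rfl⟩) ?_
  rintro c₁ ⟨h1, h2⟩
  -- `det_loop` counts upwards, so its invariant after `i` rounds is the one for the counter value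
  -- `N - i`.
  have := det_loop (enc := enc) (A := A) (c := c₁) (e := e)
    (P := .seq (.assign (.lit p) (.lit 0) (.sub (cell p) (.lit 1))) P)
    (fun i σ ψ => i ≤ N → σ p 0 = N - i ∧ I (N - i) σ ψ) N (by rw [h1, hN']) ?_ ?_
  · exact this.mono (by intro σ ψ h; simpa using h)
  · rw [h1, h2]; exact fun _ => ⟨by simp [Store.write_apply], h0⟩
  · intro i hi c' h3
    obtain ⟨h3, h4⟩ := h3 (by omega)
    have e1 : N - i = (N - (i + 1)) + 1 := by omega
    rw [e1] at h3 h4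
    obtain ⟨c'', h5, h6⟩ := hs (N - (i + 1)) (by omega) { c' with time := c'.time + 1 } h3 h4
    refine ⟨c'', ?_, fun _ => h6⟩
    have e2 : N - (i + 1) + 1 - 1 = N - (i + 1) := by omega
    simpa [Prog.exec, NExpr.eval, h3, Config.tick, e2] using h5

end

/-! ### Reversible circuits of Toffoli gates -/

/-- Two stores that may differ only in cell 0 of the arrays `p, …, 19`. -/
def Store.Agree (p : ℕ) (σ τ : Store) : Prop :=
  ∀ a i, (a < p ∨ 20 ≤ a ∨ i ≠ 0) → σ a i = τ a i

theorem Store.Agree.refl (p : ℕ) (σ : Store) : σ.Agree p σ := fun _ _ _ => rfl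

theorem Store.Agree.trans {p : ℕ} {σ τ υ : Store} (h : σ.Agree p τ) (h' : τ.Agree p υ) :
    σ.Agree p υ := fun a i hi => (h a i hi).trans (h' a i hi)

theorem Store.Agree.anti {p p' : ℕ} {σ τ : Store} (h : σ.Agree p' τ) (hp : p ≤ p') :
    σ.Agree p τ := fun a i hi => h a i (by omega)

theorem Store.agree_write {p a : ℕ} (σ : Store) (v : ℕ) (hp : p ≤ a) (ha : a < 20) :
    σ.Agree p (σ.write a 0 v) := by
  intro b i hi
  rw [Store.write_apply, if_neg (by omega)]

theorem Store.Agree.write_succ {p i : ℕ} {σ τ : Store} (h : σ.Agree p τ) (hi : τ p 0 = i) :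
    (σ.write p 0 i).Agree (p + 1) τ := by
  intro a j hj
  rw [Store.write_apply]
  split_ifs with h'
  · rw [h'.1, h'.2, hi]
  · exact h a j (by omega)

/-- The expression does not read the arrays `p, …, 19`. -/
def NExpr.within (p : ℕ) : NExpr → Bool
  | .lit _ => true
  | .read a i =>
      (match a with
        | .lit v => decide (v < p) || decide (20 ≤ v)
        | .add (.lit v) _ => decide (20 ≤ v)
        | _ => false) && a.within p && i.within p
  | .add e f => e.within p && f.within p
  | .sub e f => e.within p && f.within p

/-- Besides literals, `within` admits array names of the form `20 + …`, `21 + …`, which are at least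
20 whatever the second summand is. These are the computed names of the arrays of stored points and
values. -/
theorem NExpr.eval_eq_of_within {p : ℕ} {σ τ : Store} (h : σ.Agree p τ) (e : NExpr)
    (he : e.within p = true) : e.eval σ = e.eval τ := by
  induction e with
  | lit v => rfl
  | add e f ihe ihf =>
    simp only [within, Bool.and_eq_true] at he
    simp only [eval, ihe he.1, ihf he.2]
  | sub e f ihe ihf =>
    simp only [within, Bool.and_eq_true] at he
    simp only [eval, ihe he.1, ihf he.2]
  | read a i iha ihi =>
    simp only [within, Bool.and_eq_true] at he
    simp only [eval, iha he.1.2, ihi he.2]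
    apply h
    have h1 := he.1.1
    split at h1
    · simp only [Bool.or_eq_true, decide_eq_true_eq] at h1
      simp only [eval]; omega
    · simp only [decide_eq_true_eq] at h1
      simp only [eval]; omega
    · simp at h1

/-- The address does not depend on the arrays `p, …, 19`. -/
def QAddr.within (p : ℕ) : QAddr → Bool
  | .work a i => a.within p && i.within p
  | .ctrl => true
  | .query j => j.within p
  | .answer j => j.within p
  | .out i j => i.within p && j.within p

theorem QAddr.resolve_eq_of_within {W k m n p : ℕ} {σ τ : Store} (h : σ.Agree p τ) (t : QAddr)
    (ht : t.within p = true) : t.resolve W k m n σ = t.resolve W k m n τ := by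
  cases t <;> simp only [within, Bool.and_eq_true] at ht <;> simp only [resolve]
  · rw [NExpr.eval_eq_of_within h _ ht.1, NExpr.eval_eq_of_within h _ ht.2]
  · rw [NExpr.eval_eq_of_within h _ ht]
  · rw [NExpr.eval_eq_of_within h _ ht]
  · rw [NExpr.eval_eq_of_within h _ ht.1, NExpr.eval_eq_of_within h _ ht.2]

/-- Descriptions of circuits of Toffoli gates. -/
inductive Circ : Type
  /-- the Toffoli gate with controls `c`, `d` and target `t`, provided that `e ≤ f` -/
  | gate (e f : NExpr) (c d t : QAddr)
  | seq (C D : Circ)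
  /-- a loop; the loop at nesting depth `p` counts in cell 0 of array `10 + p` -/
  | iter (e : NExpr) (C : Circ)

/-- A Toffoli gate: controls and target. -/
abbrev Gate (W k m n : ℕ) : Type := Qubit W k m n × Qubit W k m n × Qubit W k m n

/-- A program without effect. -/
def idle : Prog := .assign (.lit 19) (.lit 0) (.lit 0)

/-- The program that runs the circuit. -/
def Circ.up (p : ℕ) : Circ → Prog
  | .gate e f c d t => .ite e f (.ccnot c d t) idle
  | .seq C D => .seq (C.up p) (D.up p)
  | .iter e C => countUp p e (C.up (p + 1))

/-- The program that runs the circuit backwards. -/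
def Circ.down (p : ℕ) : Circ → Prog
  | .gate e f c d t => .ite e f (.ccnot c d t) idle
  | .seq C D => .seq (D.down p) (C.down p)
  | .iter e C => countDown p e (C.down (p + 1))

/-- The list of gates of a circuit. -/
def Circ.gates (W k m n : ℕ) (p : ℕ) (σ : Store) : Circ → List (Gate W k m n)
  | .gate e f c d t =>
      if e.eval σ ≤ f.eval σ then
        match c.resolve W k m n σ, d.resolve W k m n σ, t.resolve W k m n σ with
        | some c', some d', some t' => [(c', d', t')]
        | _, _, _ => []
      else []
  | .seq C D => C.gates W k m n p σ ++ D.gates W k m n p σ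
  | .iter e C => (List.range (e.eval σ)).flatMap fun i =>
      C.gates W k m n (p + 1) (σ.write p 0 i)

/-- The circuit reads loop counters only inside their loops. -/
def Circ.within (p : ℕ) : Circ → Bool
  | .gate e f c d t => e.within p && f.within p && c.within p && d.within p && t.within p
  | .seq C D => C.within p && D.within p
  | .iter e C => decide (p < 19) && e.within p && C.within (p + 1)

/-- Running a circuit changes nothing but loop counters. Hence its list of gates can be computed
once from the initial store, and it is the same list when the circuit is run backwards later. -/
theorem Circ.gates_eq_of_within {W k m n : ℕ} (C : Circ) {p : ℕ} {σ τ : Store}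
    (h : σ.Agree p τ) (hC : C.within p = true) :
    C.gates W k m n p σ = C.gates W k m n p τ := by
  induction C generalizing p σ τ with
  | gate e f c d t =>
    simp only [within, Bool.and_eq_true] at hC
    simp only [gates]
    rw [NExpr.eval_eq_of_within h e hC.1.1.1.1, NExpr.eval_eq_of_within h f hC.1.1.1.2,
      QAddr.resolve_eq_of_within h c hC.1.1.2, QAddr.resolve_eq_of_within h d hC.1.2,
      QAddr.resolve_eq_of_within h t hC.2]
  | seq C D ihC ihD =>
    simp only [within, Bool.and_eq_true] at hC
    simp only [gates, ihC h hC.1, ihD h hC.2]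
  | iter e C ih =>
    simp only [within, Bool.and_eq_true] at hC
    simp only [gates, NExpr.eval_eq_of_within h e hC.1.2]
    congr 1
    funext i
    refine ih (p := p + 1) ?_ hC.2
    intro a j hj
    rw [Store.write_apply, Store.write_apply]
    split_ifs with h'
    · rfl
    · exact h a j (by omega)

/-! ### Action of Toffoli circuits on basis states. -/

section
variable {W k m n q : ℕ} {X Z E : Type}

/-- The action of a gate on basis states. -/
def gateMap (enc : X ↪ BitStr k) (g : Gate W k m n) (s : Full W X Z E m n) : Full W X Z E m n :=
  if g.2.2.writable = true ∧ g.2.2 ≠ g.1 ∧ g.2.2 ≠ g.2.1 then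
    if g.1.get enc s && g.2.1.get enc s then g.2.2.flip s else s
  else s

/-- Vectors are transformed by precomposition. Running `g₁, …, g_r` therefore composes the vector
with `g₁ ∘ ⋯ ∘ g_r`, in which the last gate acts first on the argument; this explains the `foldr` in
`runMap` and the reversed lists below. -/
theorem gateFlip_eq_comp (enc : X ↪ BitStr k) (c d t : Qubit W k m n) (ψ : Vec W X Z E m n) :
    gateFlip enc [c, d] t ψ = ψ ∘ gateMap enc (c, d, t) := by
  funext s
  have h : (t.writable = true ∧ t ∉ [c, d]) ↔ (t.writable = true ∧ t ≠ c ∧ t ≠ d) := by simp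
  by_cases h1 : t.writable = true ∧ t ≠ c ∧ t ≠ d
  · simp only [gateFlip, gateMap, Function.comp_apply]
    rw [if_pos (h.2 h1), if_pos h1]
    simp
  · simp only [gateFlip, gateMap, Function.comp_apply]
    rw [if_neg (fun h' => h1 (h.1 h')), if_neg h1]

theorem Qubit.get_flip (enc : X ↪ BitStr k) (s : Full W X Z E m n) (q t : Qubit W k m n) :
    q.get enc (t.flip s) =
      if q = t ∧ t.writable = true then !(q.get enc s) else q.get enc s := by
  cases t <;> cases q <;>
    simp [Qubit.get, Qubit.flip, Qubit.writable, Function.update_apply] <;>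
    split_ifs <;> simp_all

theorem Qubit.flip_flip (s : Full W X Z E m n) (t : Qubit W k m n) : t.flip (t.flip s) = s := by
  cases t <;> simp [Qubit.flip]

theorem gateMap_gateMap (enc : X ↪ BitStr k) (g : Gate W k m n) (s : Full W X Z E m n) :
    gateMap enc g (gateMap enc g s) = s := by
  unfold gateMap
  split_ifs with h1 h2 h3
  · exact Qubit.flip_flip _ _
  -- The target is not a control, so flipping it does not change whether the gate fires.
  · rw [Qubit.get_flip, Qubit.get_flip, if_neg (fun h => h1.2.1 h.1.symm),
      if_neg (fun h => h1.2.2 h.1.symm)] at h3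
    exact absurd h2 h3
  · rfl
  · rfl

/-- The action on basis states of the last gate of a list, then the last but one, and so on. -/
def runMap (enc : X ↪ BitStr k) (L : List (Gate W k m n)) (s : Full W X Z E m n) :
    Full W X Z E m n := L.foldr (gateMap enc) s

theorem runMap_append (enc : X ↪ BitStr k) (L L' : List (Gate W k m n)) (s : Full W X Z E m n) :
    runMap enc (L ++ L') s = runMap enc L (runMap enc L' s) := List.foldr_append

theorem runMap_reverse (enc : X ↪ BitStr k) (L : List (Gate W k m n)) (s : Full W X Z E m n) :
    runMap enc L (runMap enc L.reverse s) = s := by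
  induction L generalizing s with
  | nil => rfl
  | cons g L ih =>
    rw [List.reverse_cons, runMap_append]
    change gateMap enc g (runMap enc L (runMap enc L.reverse (gateMap enc g s))) = s
    rw [ih, gateMap_gateMap]

/-- The value of a qubit as an element of the two-element field. -/
def Qubit.val (enc : X ↪ BitStr k) (s : Full W X Z E m n) (t : Qubit W k m n) : ZMod 2 :=
  if t.get enc s then 1 else 0

theorem Qubit.val_flip (enc : X ↪ BitStr k) (s : Full W X Z E m n) (q t : Qubit W k m n)
    (ht : t.writable = true) :
    q.val enc (t.flip s) = q.val enc s + if t = q then 1 else 0 := by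
  have h2 : (0 : ZMod 2) = 1 + 1 := by decide
  unfold Qubit.val
  rw [Qubit.get_flip]
  by_cases h : t = q
  · subst h
    cases t.get enc s <;> simp [ht, h2]
  · have h' : ¬ (q = t ∧ t.writable = true) := fun h' => h h'.1.symm
    rw [if_neg h, add_zero, if_neg h']

/-- Over the two-element field a Toffoli gate adds the product of its controls to its target; this
turns the analysis of circuits into polynomial arithmetic. -/
theorem Qubit.val_gateMap (enc : X ↪ BitStr k) (g : Gate W k m n) (s : Full W X Z E m n)
    (hw : g.2.2.writable = true) (h1 : g.2.2 ≠ g.1) (h2 : g.2.2 ≠ g.2.1) (t : Qubit W k m n) :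
    t.val enc (gateMap enc g s) =
      t.val enc s + if g.2.2 = t then g.1.val enc s * g.2.1.val enc s else 0 := by
  have h : gateMap enc g s = if g.1.get enc s && g.2.1.get enc s then g.2.2.flip s else s :=
    if_pos ⟨hw, h1, h2⟩
  rw [h]
  by_cases hc : (g.1.get enc s && g.2.1.get enc s) = true
  · rw [if_pos hc, Qubit.val_flip enc s t _ hw]
    rw [Bool.and_eq_true] at hc
    simp [Qubit.val, hc.1, hc.2]
  · rw [if_neg hc]
    have h0 : g.1.val enc s * g.2.1.val enc s = 0 := by
      unfold Qubit.val
      split_ifs <;> simp_all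
    simp [h0]

theorem Qubit.val_gateMap_of_ne (enc : X ↪ BitStr k) (g : Gate W k m n) (s : Full W X Z E m n)
    (t : Qubit W k m n) (h : g.2.2 ≠ t) : t.val enc (gateMap enc g s) = t.val enc s := by
  unfold gateMap
  split_ifs with h1 h2
  · rw [Qubit.val_flip enc s t _ h1.1, if_neg h, add_zero]
  · rfl
  · rfl

theorem Qubit.val_runMap_of_ne (enc : X ↪ BitStr k) (L : List (Gate W k m n))
    (s : Full W X Z E m n) (t : Qubit W k m n) (h : ∀ g ∈ L, g.2.2 ≠ t) :
    t.val enc (runMap enc L s) = t.val enc s := by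
  induction L with
  | nil => rfl
  | cons g L ih =>
    exact (Qubit.val_gateMap_of_ne enc g _ t (h g (by simp))).trans
      (ih fun g' hg' => h g' (by simp [hg']))

/-- Effect of a list of gates in which no target is a control. -/
theorem Qubit.val_runMap_reverse (enc : X ↪ BitStr k) (T : Qubit W k m n → Prop)
    (L : List (Gate W k m n)) (s : Full W X Z E m n)
    (hL : ∀ g ∈ L, g.2.2.writable = true ∧ T g.2.2 ∧ ¬ T g.1 ∧ ¬ T g.2.1) (t : Qubit W k m n) :
    t.val enc (runMap enc L.reverse s) =
      t.val enc s +
        (L.map fun g => if g.2.2 = t then g.1.val enc s * g.2.1.val enc s else 0).sum := by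
  induction L using List.reverseRecOn with
  | nil => simp [runMap]
  | append_singleton L g ih =>
    have hg := hL g (by simp)
    have hL' : ∀ g ∈ L, g.2.2.writable = true ∧ T g.2.2 ∧ ¬ T g.1 ∧ ¬ T g.2.1 :=
      fun g' h => hL g' (by simp [h])
    -- Qubits outside `T` are never targets, so the controls of the last gate still have their
    -- initial values.
    have hcd : ∀ t, ¬ T t → t.val enc (runMap enc L.reverse s) = t.val enc s := by
      intro t ht
      refine Qubit.val_runMap_of_ne enc _ s t fun g' h => ?_
      rintro rfl
      exact ht (hL' g' (by simpa using h)).2.1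
    rw [List.reverse_append]
    change t.val enc (gateMap enc g (runMap enc L.reverse s)) = _
    rw [Qubit.val_gateMap enc g _ hg.1 (fun h => hg.2.2.1 (h ▸ hg.2.1))
      (fun h => hg.2.2.2 (h ▸ hg.2.1)), ih hL', hcd _ hg.2.2.1, hcd _ hg.2.2.2]
    simp [add_assoc]

/-- Add a mask to the answer register. -/
def addMask (y : BitStr m) (s : Full W X Z E m n) : Full W X Z E m n :=
  (s.1, ((s.2.1.1, s.2.1.2.1, fun j => xor (s.2.1.2.2 j) (y j)), s.2.2))

/-- The qubit belongs to the answer register. -/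
def Qubit.IsAnswer (t : Qubit W k m n) : Prop := ∃ j, t = .answer j

theorem Qubit.get_addMask (enc : X ↪ BitStr k) (y : BitStr m) (s : Full W X Z E m n)
    (t : Qubit W k m n) (h : ¬ t.IsAnswer) : t.get enc (addMask y s) = t.get enc s := by
  cases t <;> first | rfl | exact absurd ⟨_, rfl⟩ h

theorem Qubit.flip_addMask (y : BitStr m) (s : Full W X Z E m n)
    (t : Qubit W k m n) (h : ¬ t.IsAnswer) : t.flip (addMask y s) = addMask y (t.flip s) := by
  cases t <;> first | rfl | exact absurd ⟨_, rfl⟩ h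

/-- Gates that neither read nor change the answer register commute with the mask. So uncomputation
cancels the computation even though the mask was added in between. -/
theorem runMap_addMask (enc : X ↪ BitStr k) (y : BitStr m) (L : List (Gate W k m n))
    (hL : ∀ g ∈ L, ¬ g.1.IsAnswer ∧ ¬ g.2.1.IsAnswer ∧ ¬ g.2.2.IsAnswer)
    (s : Full W X Z E m n) : runMap enc L (addMask y s) = addMask y (runMap enc L s) := by
  induction L with
  | nil => rfl
  | cons g L ih =>
    change gateMap enc g (runMap enc L _) = addMask y (gateMap enc g (runMap enc L s))
    rw [ih fun g' hg' => hL g' (by simp [hg'])]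
    obtain ⟨h1, h2, h3⟩ := hL g (by simp)
    unfold gateMap
    rw [Qubit.get_addMask _ _ _ _ h1, Qubit.get_addMask _ _ _ _ h2, Qubit.flip_addMask _ _ _ h3]
    split_ifs <;> rfl

theorem runMap_eq_addMask (enc : X ↪ BitStr k) (M : List (Gate W k m n))
    (hM : ∀ g ∈ M, ¬ g.1.IsAnswer ∧ ¬ g.2.1.IsAnswer ∧ g.2.2.IsAnswer)
    (s : Full W X Z E m n) :
    runMap enc M s = addMask (fun j => decide ((M.map fun g =>
      if g.2.2 = .answer j then g.1.val enc s * g.2.1.val enc s else 0).sum = 1)) s := by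
  induction M with
  | nil => simp [runMap, addMask]
  | cons g M ih =>
    change gateMap enc g (runMap enc M s) = _
    rw [ih fun g' hg' => hM g' (by simp [hg'])]
    obtain ⟨h1, h2, i, h3⟩ := hM g (by simp)
    unfold gateMap
    rw [Qubit.get_addMask _ _ _ _ h1, Qubit.get_addMask _ _ _ _ h2, if_pos, h3]
    · have hb : ∀ x : ZMod 2, decide (1 + x = 1) = !decide (x = 1) := by decide
      simp only [List.map_cons, List.sum_cons, h3]
      split_ifs with h
      · rw [Bool.and_eq_true] at h
        have hv : g.1.val enc s = 1 ∧ g.2.1.val enc s = 1 := by simp [Qubit.val, h.1, h.2]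
        simp only [Qubit.flip, addMask, hv.1, hv.2, one_mul]
        refine Prod.ext rfl (Prod.ext (Prod.ext rfl (Prod.ext rfl ?_)) rfl)
        funext j
        by_cases hj : j = i
        · subst hj
          simp only [Function.update_self, if_true, hb]
          simp
        · simp [hj, Ne.symm hj]
      · have h0 : g.1.val enc s * g.2.1.val enc s = 0 := by
          unfold Qubit.val
          split_ifs <;> simp_all
        simp [h0]
    · refine ⟨by rw [h3]; rfl, fun h => h1 ⟨i, h ▸ h3⟩, fun h => h2 ⟨i, h ▸ h3⟩⟩

/-- Compute with `C`, add a mask to the answer register, and uncompute. -/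
theorem runMap_conj (enc : X ↪ BitStr k) (C M : List (Gate W k m n))
    (hC : ∀ g ∈ C, ¬ g.1.IsAnswer ∧ ¬ g.2.1.IsAnswer ∧ ¬ g.2.2.IsAnswer)
    (hM : ∀ g ∈ M, ¬ g.1.IsAnswer ∧ ¬ g.2.1.IsAnswer ∧ g.2.2.IsAnswer)
    (s : Full W X Z E m n) :
    runMap enc C (runMap enc M (runMap enc C.reverse s)) =
      addMask (fun j => decide ((M.map fun g => if g.2.2 = .answer j then
        g.1.val enc (runMap enc C.reverse s) * g.2.1.val enc (runMap enc C.reverse s)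
        else 0).sum = 1)) s := by
  rw [runMap_eq_addMask enc M hM, runMap_addMask enc _ C hC, runMap_reverse]

variable [Fintype X] [DecidableEq X] [Fintype Z] [DecidableEq Z]
  [Fintype E] [DecidableEq E] {enc : X ↪ BitStr k} {A : OracleAlg X Z E m n q}

theorem det_gate {p : ℕ} (e f : NExpr) (c d t : QAddr) (c₀ : Config W X Z E m n) (hp : p ≤ 19) :
    Det enc A (.ite e f (.ccnot c d t) idle) c₀ fun σ ψ =>
      c₀.mem.Agree p σ ∧
        ψ = c₀.vec ∘ runMap enc ((Circ.gate e f c d t).gates W k m n p c₀.mem) := by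
  refine det_ite (fun h => ?_) fun h => ?_
  · simp only [Det, Prog.exec, Config.tick, Circ.gates, if_pos h]
    cases c.resolve W k m n c₀.mem <;> cases d.resolve W k m n c₀.mem <;>
      cases t.resolve W k m n c₀.mem <;>
      refine ⟨_, rfl, Store.Agree.refl _ _, ?_⟩ <;> try rfl
    simp only [Config.upd, gateFlip_eq_comp]
    rfl
  · refine det_assign ⟨Store.agree_write (a := 19) _ _ hp (by norm_num), ?_⟩
    simp only [Circ.gates, if_neg h]
    rfl

theorem Circ.det_up (C : Circ) {p : ℕ} (hp : p ≤ 19) (hC : C.within p = true)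
    (c : Config W X Z E m n) :
    Det enc A (C.up p) c fun σ ψ =>
      c.mem.Agree p σ ∧ ψ = c.vec ∘ runMap enc (C.gates W k m n p c.mem) := by
  induction C generalizing p c with
  | gate e f a d t => exact det_gate e f a d t _ hp
  | seq C D ihC ihD =>
    simp only [within, Bool.and_eq_true] at hC
    refine Det.seq (ihC hp hC.1 c) ?_
    rintro c' ⟨h1, h2⟩
    refine (ihD hp hC.2 c').mono ?_
    rintro σ ψ ⟨h3, h4⟩
    refine ⟨h1.trans h3, ?_⟩
    rw [h4, h2, ← D.gates_eq_of_within h1 hC.2]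
    funext s
    simp [gates, runMap_append]
  | iter e C ih =>
    simp only [within, Bool.and_eq_true, decide_eq_true_eq] at hC
    have hw : c.mem.Agree p (c.mem.write p 0 0) := Store.agree_write _ _ le_rfl (by omega)
    refine Det.mono (det_countUp (fun i σ ψ => c.mem.Agree p σ ∧ ψ = c.vec ∘ runMap enc
      ((List.range i).flatMap fun i => C.gates W k m n (p + 1) (c.mem.write p 0 i)))
      (e.eval c.mem) (NExpr.eval_eq_of_within hw e hC.1.2).symm ⟨hw, rfl⟩ ?_) fun σ ψ h => h.2
    rintro i - c' h1 ⟨h2, h3⟩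
    refine (ih (p := p + 1) (by omega) hC.2 c').mono ?_
    rintro σ ψ ⟨h4, h5⟩
    refine ⟨by rw [← h4 p 0 (by omega), h1], (h2.trans (h4.anti (by omega))).trans
      (Store.agree_write _ _ le_rfl (by omega)), ?_⟩
    rw [h5, h3, ← C.gates_eq_of_within (h2.write_succ h1) hC.2]
    funext s
    simp [List.range_succ, runMap_append]

theorem Circ.det_down (C : Circ) {p : ℕ} (hp : p ≤ 19) (hC : C.within p = true)
    (c : Config W X Z E m n) :
    Det enc A (C.down p) c fun σ ψ =>
      c.mem.Agree p σ ∧ ψ = c.vec ∘ runMap enc (C.gates W k m n p c.mem).reverse := by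
  induction C generalizing p c with
  | gate e f a d t =>
    refine (det_gate e f a d t _ hp).mono ?_
    rintro σ ψ ⟨h1, h2⟩
    refine ⟨h1, ?_⟩
    rw [h2]
    congr 2
    simp only [Circ.gates]
    split_ifs
    · cases a.resolve W k m n _ <;> cases d.resolve W k m n _ <;>
        cases t.resolve W k m n _ <;> rfl
    · rfl
  | seq C D ihC ihD =>
    simp only [within, Bool.and_eq_true] at hC
    refine Det.seq (ihD hp hC.2 c) ?_
    rintro c' ⟨h1, h2⟩
    refine (ihC hp hC.1 c').mono ?_
    rintro σ ψ ⟨h3, h4⟩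
    refine ⟨h1.trans h3, ?_⟩
    rw [h4, h2, ← C.gates_eq_of_within h1 hC.1]
    funext s
    simp [gates, runMap_append]
  | iter e C ih =>
    simp only [within, Bool.and_eq_true, decide_eq_true_eq] at hC
    have hw : ∀ v, c.mem.Agree p (c.mem.write p 0 v) :=
      fun v => Store.agree_write _ _ le_rfl (by omega)
    let G : ℕ → List (Gate W k m n) := fun i => C.gates W k m n (p + 1) (c.mem.write p 0 i)
    -- The invariant splits the reversed list of gates into a part `L` that has been run and the
    -- part that belongs to the counter values still to come.
    refine Det.mono (det_countDown (fun i σ ψ => c.mem.Agree p σ ∧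
      ∃ L, ψ = c.vec ∘ runMap enc L ∧
        ((List.range (e.eval c.mem)).flatMap G).reverse =
          L ++ ((List.range i).flatMap G).reverse)
      (e.eval c.mem) rfl (NExpr.eval_eq_of_within (hw _) e hC.1.2).symm
      ⟨hw _, [], rfl, rfl⟩ ?_) ?_
    · rintro i - c' h1 ⟨h2, L, h3, h4⟩
      have h5 : c.mem.Agree p (c'.mem.write p 0 i) :=
        h2.trans (Store.agree_write _ _ le_rfl (by omega))
      have h6 : (c'.mem.write p 0 i) p 0 = i := by simp [Store.write_apply]
      refine (ih (p := p + 1) (by omega) hC.2 _).mono ?_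
      rintro σ ψ ⟨h7, h8⟩
      refine ⟨(h7 p 0 (by omega)).symm.trans h6, h5.trans (h7.anti (by omega)),
        L ++ (G i).reverse, ?_, ?_⟩
      · rw [h8, ← C.gates_eq_of_within (h5.write_succ h6) hC.2]
        funext s
        simp [h3, runMap_append, G]
      · rw [h4]
        simp [List.range_succ]
    · rintro σ ψ ⟨-, h2, L, h3, h4⟩
      refine ⟨h2, ?_⟩
      rw [h3]
      simp only [List.range_zero, List.flatMap_nil, List.reverse_nil, List.append_nil] at h4
      rw [← h4]
      rfl

end

/-! ### The query circuit -/

/-- Cell `i` of array 0, which holds the parameters `n, q, k, m` and the number of the stage. -/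
def param (i : ℕ) : NExpr := .read (.lit 0) (.lit i)

/-- Twice the number of queries. -/
def twiceQ : NExpr := .add (param 1) (param 1)

/-- A bound for the degrees of powers of an input. -/
def degBound : NExpr := .read (.lit 4) twiceQ

/-- The work qubit that is set unless the input of the query has been reprogrammed. -/
def flagAddr : QAddr := .work (.add (.lit 1) twiceQ) (.lit 0)

/-- The row of work qubits for the comparison with the point with number `l`. -/
def matchAddr (l j : NExpr) : QAddr := .work (.add (.add (.lit 2) twiceQ) l) j

/-- Computes the coefficients of the powers of the input, considered as a polynomial. -/
def powCirc : Circ :=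
  .seq (.gate (.lit 0) (.lit 0) .ctrl .ctrl (.work (.lit 0) (.lit 0)))
    (.iter twiceQ (.iter (param 2) (.iter degBound
      (.gate (.lit 0) (.lit 0) (.query (cell 11)) (.work (cell 10) (cell 12))
        (.work (.add (cell 10) (.lit 1)) (.add (cell 11) (cell 12)))))))

/-- Compares the input with the reprogrammed points. -/
def matchCirc : Circ :=
  .seq (.iter (param 4) (.gate (.lit 0) (.lit 0) .ctrl .ctrl (matchAddr (cell 10) (.lit 0))))
    (.iter (param 2) (.iter (param 4) (.seq
      (.gate (.read (.add (.lit 20) (.add (cell 11) (cell 11))) (cell 10)) (.lit 0)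
        (matchAddr (cell 11) (cell 10)) (matchAddr (cell 11) (cell 10))
        (matchAddr (cell 11) (.add (cell 10) (.lit 1))))
      (.gate (.lit 0) (.lit 0) (matchAddr (cell 11) (cell 10)) (.query (cell 10))
        (matchAddr (cell 11) (.add (cell 10) (.lit 1)))))))

/-- Computes whether the input is none of the reprogrammed points. -/
def flagCirc : Circ :=
  .seq (.gate (.lit 0) (.lit 0) .ctrl .ctrl flagAddr)
    (.iter (param 4) (.gate (.lit 0) (.lit 0) (matchAddr (cell 10) (param 2))
      (matchAddr (cell 10) (param 2)) flagAddr))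

/-- All the preparations for a query. -/
def prepareCirc : Circ := .seq powCirc (.seq matchCirc flagCirc)

/-- Adds the value of the reprogrammed hash function to the answer register. -/
def answerCirc : Circ :=
  .seq (.iter (param 3) (.iter twiceQ (.iter degBound
      (.gate (.lit 1) (.read (.lit 7) (.add (.read (.lit 6) (cell 10))
          (.add (.read (.lit 5) (cell 11)) (cell 12))))
        flagAddr (.work (cell 11) (cell 12)) (.answer (cell 10))))))
    (.iter (param 4) (.iter (param 3)
      (.gate (.lit 1) (.read (.add (.lit 21) (.add (cell 10) (cell 10))) (cell 11))
        (matchAddr (cell 10) (param 2)) (matchAddr (cell 10) (param 2)) (.answer (cell 11)))))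

/-- A query to the simulated oracle. -/
def queryProg : Prog :=
  .seq (prepareCirc.up 10) (.seq (answerCirc.up 10) (prepareCirc.down 10))

theorem prepareCirc_within : prepareCirc.within 10 = true := by decide

theorem answerCirc_within : answerCirc.within 10 = true := by decide

/-- The parameters and the multiplication tables are in memory. -/
structure Params (n q k m s : ℕ) (σ : Store) : Prop where
  hn : σ 0 0 = n
  hq : σ 0 1 = q
  hk : σ 0 2 = k
  hm : σ 0 3 = m
  hs : σ 0 4 = s
  tab₁ : ∀ i ≤ 2 * q, σ 4 i = i * (k + 1)
  tab₂ : ∀ i ≤ 2 * q, σ 5 i = i * (2 * q * (k + 1))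
  tab₃ : ∀ j ≤ m, σ 6 j = j * (2 * q * (2 * q * (k + 1)))

/-- A bit as an element of the two-element field (0 beyond the length of the string). -/
def bitAt {l : ℕ} (b : BitStr l) (a : ℕ) : ZMod 2 :=
  if h : a < l then if b ⟨a, h⟩ then 1 else 0 else 0

open Polynomial in
/-- The polynomial with the given coefficients. -/
noncomputable def bitPoly {l : ℕ} (b : BitStr l) : (ZMod 2)[X] :=
  ∑ a ∈ Finset.range l, C (bitAt b a) * X ^ a

/-- One bit of the hash function with seed `lam`. -/
noncomputable def hashBit {k : ℕ} (lam : ℕ → ZMod 2) (t D j : ℕ) (b : BitStr k) : ZMod 2 :=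
  ∑ i ∈ Finset.range t, ∑ d ∈ Finset.range D,
    lam (j * (t * D) + (i * D + d)) * (bitPoly b ^ i).coeff d

/-- The hash function with seed `lam`, reprogrammed at the first `s` of the points `pts`. -/
noncomputable def tableOracle {X : Type} {k : ℕ} (enc : X ↪ BitStr k) (q m : ℕ)
    (lam : ℕ → ZMod 2) (s : ℕ) (pts : ℕ → BitStr k) (vals : ℕ → BitStr m) : X → BitStr m :=
  fun x j => decide ((1 + ∑ l ∈ Finset.range s, if enc x = pts l then 1 else 0) *
    hashBit lam (2 * q) (2 * q * (k + 1)) j (enc x) +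
    ∑ l ∈ Finset.range s, (if enc x = pts l then 1 else 0) * bitAt (vals l) j = 1)

/-- The stored seed. -/
def storedSeed (σ : Store) (i : ℕ) : ZMod 2 := if 1 ≤ σ 7 i then 1 else 0

/-- The stored points. -/
def storedPoint (k : ℕ) (σ : Store) (l : ℕ) : BitStr k := fun j => decide (σ (20 + (l + l)) j ≠ 0)

/-- The stored values. -/
def storedValue (m : ℕ) (σ : Store) (l : ℕ) : BitStr m := fun j => decide (σ (21 + (l + l)) j ≠ 0)

section
variable {W k m n q : ℕ} {X Z E : Type}

/-- Work qubits, indexed by natural numbers. -/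
def workQ (W k m n a i : ℕ) : Qubit W k m n :=
  if h : a < W ∧ i < W then .work ⟨a, h.1⟩ ⟨i, h.2⟩ else .ctrl

/-- Qubits of the query input, indexed by natural numbers. -/
def queryQ (W k m n a : ℕ) : Qubit W k m n := if h : a < k then .query ⟨a, h⟩ else .ctrl

/-- Qubits of the answer register, indexed by natural numbers. -/
def answerQ (W k m n j : ℕ) : Qubit W k m n := if h : j < m then .answer ⟨j, h⟩ else .ctrl

theorem resolve_work {σ : Store} {a i : NExpr} {a' i' : ℕ} (ha : a.eval σ = a')
    (hi : i.eval σ = i') (ha' : a' < W) (hi' : i' < W) :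
    (QAddr.work a i).resolve W k m n σ = some (workQ W k m n a' i') := by
  simp [QAddr.resolve, toFin?, workQ, ha, hi, ha', hi']

theorem resolve_query {σ : Store} {a : NExpr} {a' : ℕ} (ha : a.eval σ = a') (ha' : a' < k) :
    (QAddr.query a).resolve W k m n σ = some (queryQ W k m n a') := by
  simp [QAddr.resolve, toFin?, queryQ, ha, ha']

theorem resolve_answer {σ : Store} {a : NExpr} {a' : ℕ} (ha : a.eval σ = a') (ha' : a' < m) :
    (QAddr.answer a).resolve W k m n σ = some (answerQ W k m n a') := by
  simp [QAddr.resolve, toFin?, answerQ, ha, ha']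

theorem workQ_inj {a i a' i' : ℕ} (ha : a < W) (hi : i < W) (ha' : a' < W) (hi' : i' < W) :
    workQ W k m n a i = workQ W k m n a' i' ↔ a = a' ∧ i = i' := by
  simp [workQ, ha, hi, ha', hi']

theorem gates_gate {p : ℕ} {σ : Store} {e f : NExpr} {c d t : QAddr} {c' d' t' : Qubit W k m n}
    (hc : c.resolve W k m n σ = some c') (hd : d.resolve W k m n σ = some d')
    (ht : t.resolve W k m n σ = some t') :
    (Circ.gate e f c d t).gates W k m n p σ =
      if e.eval σ ≤ f.eval σ then [(c', d', t')] else [] := by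
  simp [Circ.gates, hc, hd, ht]

theorem gates_iter {p N : ℕ} {σ : Store} {e : NExpr} {C : Circ} {f : ℕ → List (Gate W k m n)}
    (he : e.eval σ = N) (hf : ∀ i < N, C.gates W k m n (p + 1) (σ.write p 0 i) = f i) :
    (Circ.iter e C).gates W k m n p σ = (List.range N).flatMap f := by
  simp only [Circ.gates, he]
  exact List.flatMap_congr fun i hi => hf i (List.mem_range.1 hi)

theorem sum_flatMap_range {α : Type} (N : ℕ) (f : ℕ → List α) (φ : α → ZMod 2) :
    (((List.range N).flatMap f).map φ).sum = ∑ i ∈ Finset.range N, ((f i).map φ).sum := by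
  induction N with
  | zero => rfl
  | succ N ih => simp [List.range_succ, Finset.sum_range_succ, ih]

/-- The gates that multiply row `r` by the input. -/
def powGates (W k m n D r : ℕ) : List (Gate W k m n) :=
  (List.range k).flatMap fun a => (List.range D).flatMap fun b =>
    [(queryQ W k m n a, workQ W k m n r b, workQ W k m n (r + 1) (a + b))]

/-- The gates that compare bit `j`. -/
def matchGates (W k m n R s : ℕ) (pts : ℕ → BitStr k) (j : ℕ) : List (Gate W k m n) :=
  (List.range s).flatMap fun l =>
    (if bitAt (pts l) j = 0 then
      [(workQ W k m n (R + l) j, workQ W k m n (R + l) j, workQ W k m n (R + l) (j + 1))]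
      else []) ++
    [(workQ W k m n (R + l) j, queryQ W k m n j, workQ W k m n (R + l) (j + 1))]

/-- Row `r + 1` of the work qubits is row `r` times the input, by schoolbook multiplication: bit `a`
of the input times coefficient `b` is added to coefficient `a + b`. The second bound on `W` leaves
room for all these columns. -/
theorem powCirc_gates {s : ℕ} {σ : Store} (h : Params n q k m s σ) (hW : 2 * q + n + 3 ≤ W)
    (hW' : 2 * q * (k + 1) + k + 1 ≤ W) :
    powCirc.gates W k m n 10 σ = [(.ctrl, .ctrl, workQ W k m n 0 0)] ++
      (List.range (2 * q)).flatMap (powGates W k m n (2 * q * (k + 1))) := by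
  have e1 : q + q = 2 * q := by ring
  rw [powCirc, Circ.gates]
  congr 1
  · rw [gates_gate (c' := .ctrl) (d' := .ctrl) (t' := workQ W k m n 0 0) rfl rfl
      (resolve_work rfl rfl (by omega) (by omega))]
    simp [NExpr.eval]
  refine gates_iter (by simp [twiceQ, param, NExpr.eval, h.hq, e1]) fun r hr => ?_
  refine gates_iter (by simp [param, NExpr.eval, Store.write_apply, h.hk]) fun a ha => ?_
  refine gates_iter (by simp [degBound, twiceQ, param, NExpr.eval, Store.write_apply, h.hq, e1,
    h.tab₁]) fun b hb => ?_
  rw [gates_gate (c' := queryQ W k m n a) (d' := workQ W k m n r b)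
    (t' := workQ W k m n (r + 1) (a + b)) (resolve_query (by simp [Store.write_apply]) ha)
    (resolve_work (by simp [Store.write_apply]) (by simp [Store.write_apply]) (by omega) (by omega))
    (resolve_work (by simp [Store.write_apply, NExpr.eval])
      (by simp [Store.write_apply, NExpr.eval]) (by omega) (by omega))]
  simp [NExpr.eval]

/-- In the row of a point, column `j + 1` receives column `j` times `x_j`, plus column `j` once more
if bit `j` of the point is 0. The factor is 1 exactly if the bits agree. The points are classical
data, so the extra gate is switched on by a classical test. -/
theorem matchCirc_gates {s : ℕ} {σ : Store} (h : Params n q k m s σ) (hs : s ≤ n)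
    (hW : 2 * q + n + 3 ≤ W) (hW' : 2 * q * (k + 1) + k + 1 ≤ W) :
    matchCirc.gates W k m n 10 σ =
      ((List.range s).flatMap fun l => [(.ctrl, .ctrl, workQ W k m n (2 + 2 * q + l) 0)]) ++
      (List.range k).flatMap (matchGates W k m n (2 + 2 * q) s (storedPoint k σ)) := by
  have e1 : q + q = 2 * q := by ring
  rw [matchCirc, Circ.gates]
  congr 1
  · refine gates_iter (by simp [param, NExpr.eval, h.hs]) fun l hl => ?_
    have hr : (matchAddr (cell 10) (.lit 0)).resolve W k m n (σ.write 10 0 l) =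
        some (workQ W k m n (2 + 2 * q + l) 0) :=
      resolve_work (by simp [param, twiceQ, NExpr.eval, Store.write_apply, h.hq, e1]) rfl
        (by omega) (by omega)
    rw [gates_gate (c' := .ctrl) (d' := .ctrl) rfl rfl hr]
    simp [NExpr.eval]
  refine gates_iter (by simp [param, NExpr.eval, h.hk]) fun j hj => ?_
  refine gates_iter (by simp [param, NExpr.eval, Store.write_apply, h.hs]) fun l hl => ?_
  have hr : ∀ v : NExpr, ∀ v' : ℕ, v.eval ((σ.write 10 0 j).write 11 0 l) = v' → v' < W →
      (matchAddr (cell 11) v).resolve W k m n ((σ.write 10 0 j).write (10 + 1) 0 l) =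
        some (workQ W k m n (2 + 2 * q + l) v') := fun v v' hv hv' =>
    resolve_work (by simp [param, twiceQ, NExpr.eval, Store.write_apply, h.hq, e1]) hv
        (by omega) hv'
  have hj1 := hr (cell 10) j (by simp [Store.write_apply]) (by omega)
  have hj2 := hr (.add (cell 10) (.lit 1)) (j + 1) (by simp [Store.write_apply, NExpr.eval])
    (by omega)
  rw [Circ.gates, gates_gate hj1 hj1 hj2, gates_gate hj1 (resolve_query
    (by simp [Store.write_apply]) hj) hj2]
  have e2 : bitAt (storedPoint k σ l) j = 0 ↔ σ (20 + (l + l)) j = 0 := by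
    simp [bitAt, storedPoint, hj]
  congr 1
  · simp only [e2]
    refine if_congr ?_ rfl rfl
    simp [NExpr.eval, Store.write_apply]
    rw [if_neg (by omega), if_neg (by omega)]

/-- The flag starts as a copy of the control bit, and the final column of every comparison is added
to it. -/
theorem flagCirc_gates {s : ℕ} {σ : Store} (h : Params n q k m s σ) (hs : s ≤ n)
    (hW : 2 * q + n + 3 ≤ W) (hW' : 2 * q * (k + 1) + k + 1 ≤ W) :
    flagCirc.gates W k m n 10 σ =
      [(.ctrl, .ctrl, workQ W k m n (1 + 2 * q) 0)] ++
      (List.range s).flatMap fun l => [(workQ W k m n (2 + 2 * q + l) k,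
        workQ W k m n (2 + 2 * q + l) k, workQ W k m n (1 + 2 * q) 0)] := by
  have e1 : q + q = 2 * q := by ring
  have hf : ∀ σ' : Store, σ' 0 1 = q → flagAddr.resolve W k m n σ' =
      some (workQ W k m n (1 + 2 * q) 0) := fun σ' hσ =>
    resolve_work (by simp [param, twiceQ, NExpr.eval, hσ, e1]) rfl (by omega) (by omega)
  rw [flagCirc, Circ.gates]
  congr 1
  · rw [gates_gate (c' := .ctrl) (d' := .ctrl) rfl rfl (hf σ h.hq)]
    simp [NExpr.eval]
  refine gates_iter (by simp [param, NExpr.eval, h.hs]) fun l hl => ?_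
  have hr : (matchAddr (cell 10) (param 2)).resolve W k m n (σ.write 10 0 l) =
      some (workQ W k m n (2 + 2 * q + l) k) :=
    resolve_work (by simp [param, twiceQ, NExpr.eval, Store.write_apply, h.hq, e1])
      (by simp [param, NExpr.eval, Store.write_apply, h.hk]) (by omega) (by omega)
  rw [gates_gate hr hr (hf _ (by simp [Store.write_apply, h.hq]))]
  simp [NExpr.eval]

theorem answerCirc_gates {s : ℕ} {σ : Store} (h : Params n q k m s σ) (hs : s ≤ n)
    (hW : 2 * q + n + 3 ≤ W) (hW' : 2 * q * (k + 1) + k + 1 ≤ W) :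
    answerCirc.gates W k m n 10 σ =
      ((List.range m).flatMap fun j => (List.range (2 * q)).flatMap fun i =>
        (List.range (2 * q * (k + 1))).flatMap fun d =>
          if storedSeed σ (j * (2 * q * (2 * q * (k + 1))) + (i * (2 * q * (k + 1)) + d)) = 1 then
            [(workQ W k m n (1 + 2 * q) 0, workQ W k m n i d, answerQ W k m n j)] else []) ++
      (List.range s).flatMap fun l => (List.range m).flatMap fun j =>
        if bitAt (storedValue m σ l) j = 1 then
          [(workQ W k m n (2 + 2 * q + l) k, workQ W k m n (2 + 2 * q + l) k,
            answerQ W k m n j)] else [] := by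
  have e1 : q + q = 2 * q := by ring
  rw [answerCirc, Circ.gates]
  congr 1
  · refine gates_iter (by simp [param, NExpr.eval, h.hm]) fun j hj => ?_
    refine gates_iter (by simp [twiceQ, param, NExpr.eval, Store.write_apply, h.hq, e1])
      fun i hi => ?_
    refine gates_iter (by simp [degBound, twiceQ, param, NExpr.eval, Store.write_apply, h.hq, e1,
      h.tab₁]) fun d hd => ?_
    have hr : flagAddr.resolve W k m n (((σ.write 10 0 j).write (10 + 1) 0 i).write (10 + 1 + 1) 0 d)
        = some (workQ W k m n (1 + 2 * q) 0) :=
      resolve_work (by simp [param, twiceQ, NExpr.eval, Store.write_apply, h.hq, e1]) rfl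
        (by omega) (by omega)
    rw [gates_gate (d' := workQ W k m n i d) (t' := answerQ W k m n j) hr
      (resolve_work (by simp [Store.write_apply]) (by simp [Store.write_apply])
        (by omega) (by omega))
      (resolve_answer (by simp [Store.write_apply]) hj)]
    refine if_congr ?_ rfl rfl
    simp [NExpr.eval, Store.write_apply, storedSeed, h.tab₂ i hi.le, h.tab₃ j hj.le,
      Nat.one_le_iff_ne_zero]
  · refine gates_iter (by simp [param, NExpr.eval, h.hs]) fun l hl => ?_
    refine gates_iter (by simp [param, NExpr.eval, Store.write_apply, h.hm]) fun j hj => ?_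
    have hr : (matchAddr (cell 10) (param 2)).resolve W k m n ((σ.write 10 0 l).write (10 + 1) 0 j)
        = some (workQ W k m n (2 + 2 * q + l) k) :=
      resolve_work (by simp [param, twiceQ, NExpr.eval, Store.write_apply, h.hq, e1])
        (by simp [param, NExpr.eval, Store.write_apply, h.hk]) (by omega) (by omega)
    rw [gates_gate hr hr (resolve_answer (by simp [Store.write_apply]) hj)]
    refine if_congr ?_ rfl rfl
    simp [NExpr.eval, Store.write_apply, storedValue, bitAt, hj]
    rw [if_neg (by omega), if_neg (by omega)]
    omega

end

/-! ### Evaluation of the query circuit -/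

open Polynomial in
theorem natDegree_bitPoly_le {l : ℕ} (b : BitStr l) : (bitPoly b).natDegree ≤ l := by
  refine natDegree_sum_le_of_forall_le _ _ fun a ha => ?_
  exact (natDegree_C_mul_X_pow_le _ _).trans (Finset.mem_range.1 ha).le

open Polynomial in
theorem coeff_bitPoly_pow_eq_zero {l r i : ℕ} (b : BitStr l) (h : r * l < i) :
    (bitPoly b ^ r).coeff i = 0 := by
  refine coeff_eq_zero_of_natDegree_lt (lt_of_le_of_lt (natDegree_pow_le.trans ?_) h)
  exact Nat.mul_le_mul_left _ (natDegree_bitPoly_le b)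

open Polynomial in
-- The convolution formula for the product of the polynomial with its power of exponent `r`.
-- Coefficients of that power from `D` on vanish, which is why the circuit may stop at column `D`.
theorem coeff_bitPoly_pow_succ {l : ℕ} (b : BitStr l) (r D i : ℕ) (hD : r * l < D) :
    (bitPoly b ^ (r + 1)).coeff i = ∑ a ∈ Finset.range l, ∑ d ∈ Finset.range D,
      if a + d = i then bitAt b a * (bitPoly b ^ r).coeff d else 0 := by
  have h0 : ∀ d, D ≤ d → (bitPoly b ^ r).coeff d = 0 := fun d hd =>
    coeff_bitPoly_pow_eq_zero b (by omega)
  rw [pow_succ']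
  generalize bitPoly b ^ r = Q at h0 ⊢
  rw [bitPoly, Finset.sum_mul, finsetSum_coeff]
  refine Finset.sum_congr rfl fun a _ => ?_
  rw [mul_assoc, coeff_C_mul, coeff_X_pow_mul']
  by_cases hai : a ≤ i
  · rw [if_pos hai]
    by_cases hd : i - a < D
    · rw [Finset.sum_eq_single (i - a)]
      · rw [if_pos (by omega)]
      · intro d _ hne
        rw [if_neg (by omega)]
      · intro h
        exact absurd (Finset.mem_range.2 hd) h
    · rw [h0 _ (by omega), mul_zero]
      refine (Finset.sum_eq_zero fun d hd' => ?_).symm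
      rw [if_neg]
      have := Finset.mem_range.1 hd'
      omega
  · rw [if_neg hai, mul_zero]
    refine (Finset.sum_eq_zero fun d hd' => ?_).symm
    rw [if_neg (by omega)]

section
variable {W k m n q : ℕ} {X Z E : Type}

theorem prod_matches {l : ℕ} (b b' : BitStr l) :
    ∏ j ∈ Finset.range l, ((if bitAt b' j = 0 then 1 else 0) + bitAt b j) =
      if b = b' then (1 : ZMod 2) else 0 := by
  split_ifs with h
  · subst h
    refine Finset.prod_eq_one fun j hj => ?_
    have := Finset.mem_range.1 hj
    simp only [bitAt, this, dif_pos]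
    split_ifs <;> simp_all
  · obtain ⟨j, hj⟩ := Function.ne_iff.1 h
    refine Finset.prod_eq_zero (Finset.mem_range.2 j.2) ?_
    -- Where the strings differ, the factor is `0 + 0` or `1 + 1`.
    have h2 : (1 : ZMod 2) + 1 = 0 := by decide
    simp only [bitAt, j.2, dif_pos, Fin.eta]
    cases hb : b j <;> cases hb' : b' j <;> simp_all

theorem val_queryQ (enc : X ↪ BitStr k) (s : Full W X Z E m n) {a : ℕ} (ha : a < k) :
    (queryQ W k m n a).val enc s = bitAt (enc s.2.1.2.1) a := by
  simp [queryQ, ha, Qubit.val, Qubit.get, bitAt]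

theorem workQ_writable (a i : ℕ) : (workQ W k m n a i).writable = true := by
  unfold workQ; split_ifs <;> rfl

/-- The qubit is the work qubit in row `a` and column `i`, where `T a i`. -/
def Qubit.IsWork (T : ℕ → ℕ → Prop) (t : Qubit W k m n) : Prop :=
  ∃ a i : Fin W, t = .work a i ∧ T a i

theorem isWork_workQ (T : ℕ → ℕ → Prop) {a i : ℕ} (ha : a < W) (hi : i < W) :
    (workQ W k m n a i).IsWork T ↔ T a i := by
  simp only [workQ, ha, hi, and_self, dif_pos, Qubit.IsWork]
  constructor
  · rintro ⟨a', i', h, hT⟩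
    obtain ⟨rfl, rfl⟩ := by simpa using h
    exact hT
  · exact fun h => ⟨_, _, rfl, h⟩

theorem not_isWork_queryQ (T : ℕ → ℕ → Prop) (a : ℕ) : ¬ (queryQ W k m n a).IsWork T := by
  rintro ⟨_, _, h, _⟩
  unfold queryQ at h
  split_ifs at h

theorem not_isWork_ctrl (T : ℕ → ℕ → Prop) : ¬ (Qubit.ctrl : Qubit W k m n).IsWork T := by
  rintro ⟨_, _, h, _⟩
  cases h

theorem powGates_mem {D r : ℕ} (hr : r + 1 < W) (hD : D + k ≤ W) {g : Gate W k m n}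
    (hg : g ∈ powGates W k m n D r) :
    g.2.2.writable = true ∧ g.2.2.IsWork (fun a _ => a = r + 1) ∧
      ¬ g.1.IsWork (fun a _ => a = r + 1) ∧ ¬ g.2.1.IsWork (fun a _ => a = r + 1) := by
  simp only [powGates, List.mem_flatMap, List.mem_range, List.mem_singleton] at hg
  obtain ⟨a, ha, b, hb, rfl⟩ := hg
  refine ⟨workQ_writable _ _, (isWork_workQ _ (by omega) (by omega)).2 rfl,
    not_isWork_queryQ _ _, fun h => ?_⟩
  have := (isWork_workQ _ (by omega) (by omega)).1 h
  omega

theorem val_of_not_isWork (enc : X ↪ BitStr k) (L : List (Gate W k m n))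
    (s : Full W X Z E m n) (t : Qubit W k m n) (h : ∀ g ∈ L, g.2.2.IsWork fun _ _ => True)
    (ht : ¬ t.IsWork fun _ _ => True) : t.val enc (runMap enc L.reverse s) = t.val enc s := by
  refine Qubit.val_runMap_of_ne enc _ s t fun g hg hgt => ?_
  exact ht (hgt ▸ h g (by simpa using hg))

theorem isWork_top (a i : ℕ) (ha : a < W) (hi : i < W) :
    (workQ W k m n a i).IsWork fun _ _ => True := (isWork_workQ _ ha hi).2 trivial

theorem pow_isWork {t : ℕ} (ht : t + 3 ≤ W) (hW' : t * (k + 1) + k + 1 ≤ W)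
    (r : ℕ) (hr : r ≤ t) :
    ∀ g ∈ [((.ctrl, .ctrl, workQ W k m n 0 0) : Gate W k m n)] ++
      (List.range r).flatMap (powGates W k m n (t * (k + 1))),
      g.2.2.IsWork fun _ _ => True := by
  intro g hg
  simp only [List.mem_append, List.mem_singleton, List.mem_flatMap, List.mem_range] at hg
  rcases hg with rfl | ⟨i, hi, hg⟩
  · exact isWork_top _ _ (by omega) (by omega)
  · obtain ⟨a, b, h, _⟩ := (powGates_mem (by omega) (by omega) hg).2.1
    exact ⟨a, b, h, trivial⟩

/-- Step `r` writes only to row `r + 1`, which is still 0, so the rows before it keep their powers.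
The control bit enters through row 0 and is carried along linearly; all rows stay 0 if it is 0. -/
theorem val_workQ_pow (enc : X ↪ BitStr k) (s : Full W X Z E m n) (hs : s.1 = fun _ => false)
    {t : ℕ} (ht : t + 3 ≤ W) (hW' : t * (k + 1) + k + 1 ≤ W) (r : ℕ) (hr : r ≤ t)
    (a i : ℕ) (ha : a < W) (hi : i < W) :
    (workQ W k m n a i).val enc (runMap enc ([(Qubit.ctrl, Qubit.ctrl, workQ W k m n 0 0)] ++
      (List.range r).flatMap (powGates W k m n (t * (k + 1)))).reverse s) =
      if a ≤ r then (Qubit.ctrl : Qubit W k m n).val enc s *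
        (bitPoly (enc s.2.1.2.1) ^ a).coeff i else 0 := by
  induction r generalizing a i with
  | zero =>
    simp only [List.range_zero, List.flatMap_nil, List.append_nil]
    rw [Qubit.val_runMap_reverse enc (Qubit.IsWork fun _ _ => True)]
    · have h0 : (workQ W k m n a i).val enc s = 0 := by
        simp [workQ, ha, hi, Qubit.val, Qubit.get, hs]
      -- A Toffoli gate with equal controls serves as a controlled not; it adds the square of the
      -- control value.
      have hc : ∀ c : ZMod 2, c * c = c := by decide
      simp only [List.map_cons, List.map_nil, List.sum_cons, List.sum_nil, add_zero, h0, zero_add,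
        workQ_inj (show 0 < W by omega) (show 0 < W by omega) ha hi, hc]
      by_cases ha0 : a = 0
      · subst ha0
        by_cases hi0 : i = 0
        · subst hi0; simp
        · simp [hi0, Ne.symm hi0, Polynomial.coeff_one]
      · rw [if_neg (by omega), if_neg (by omega)]
    · simp only [List.mem_singleton]
      rintro g rfl
      exact ⟨workQ_writable _ _, isWork_top _ _ (by omega) (by omega), not_isWork_ctrl _,
        not_isWork_ctrl _⟩
  | succ r ih =>
    rw [List.range_succ, List.flatMap_append, List.flatMap_singleton, ← List.append_assoc,
      List.reverse_append, runMap_append]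
    set L := [(Qubit.ctrl, Qubit.ctrl, workQ W k m n 0 0)] ++
      (List.range r).flatMap (powGates W k m n (t * (k + 1))) with hL
    rw [Qubit.val_runMap_reverse enc _ _ _ fun g hg => powGates_mem (by omega) (by omega) hg,
      ih (by omega) a i ha hi]
    have hx : ∀ c < k, (queryQ W k m n c).val enc (runMap enc L.reverse s) =
        bitAt (enc s.2.1.2.1) c := fun c hc => by
      rw [val_of_not_isWork enc L s _ (pow_isWork ht hW' r (by omega)) (not_isWork_queryQ _ _),
        val_queryQ _ _ hc]
    rw [powGates, sum_flatMap_range]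
    simp only [sum_flatMap_range, List.map_cons, List.map_nil, List.sum_cons, List.sum_nil,
      add_zero]
    by_cases har : a = r + 1
    · subst har
      rw [if_neg (by omega), if_pos le_rfl, zero_add,
        coeff_bitPoly_pow_succ _ r (t * (k + 1)) i (by nlinarith), Finset.mul_sum]
      refine Finset.sum_congr rfl fun c hc => ?_
      rw [Finset.mul_sum]
      refine Finset.sum_congr rfl fun d hd => ?_
      have hc' := Finset.mem_range.1 hc
      have hd' := Finset.mem_range.1 hd
      rw [hx c hc', ih (by omega) r d (by omega) (by omega), if_pos le_rfl]
      simp only [workQ_inj (show r + 1 < W by omega) (show c + d < W by omega)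
        (show r + 1 < W by omega) hi, true_and]
      split_ifs <;> ring
    · have h0 : ∀ c ∈ Finset.range k, ∀ d ∈ Finset.range (t * (k + 1)),
          ¬ workQ W k m n (r + 1) (c + d) = workQ W k m n a i := by
        intro c hc d hd h
        have hc' := Finset.mem_range.1 hc
        have hd' := Finset.mem_range.1 hd
        exact har ((workQ_inj (by omega) (by omega) ha hi).1 h).1.symm
      rw [Finset.sum_eq_zero fun c hc => Finset.sum_eq_zero fun d hd => if_neg (h0 c hc d hd),
        add_zero]
      by_cases h : a ≤ r
      · rw [if_pos h, if_pos (by omega)]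
      · rw [if_neg h, if_neg (by omega)]

end

/-! ### Comparison with the reprogrammed points, and the complete query. -/

section
variable {W k m n q : ℕ} {X Z E : Type}

theorem matchGates_mem {R s j : ℕ} {pts : ℕ → BitStr k} (hR : R + s ≤ W) (hk : k < W) (hj : j < k)
    {g : Gate W k m n} (hg : g ∈ matchGates W k m n R s pts j) :
    g.2.2.writable = true ∧ g.2.2.IsWork (fun a i => R ≤ a ∧ i = j + 1) ∧
      ¬ g.1.IsWork (fun a i => R ≤ a ∧ i = j + 1) ∧
      ¬ g.2.1.IsWork (fun a i => R ≤ a ∧ i = j + 1) := by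
  simp only [matchGates, List.mem_flatMap, List.mem_range, List.mem_append,
    List.mem_singleton] at hg
  obtain ⟨l, hl, hg⟩ := hg
  have hu : ¬ (workQ W k m n (R + l) j).IsWork (fun a i => R ≤ a ∧ i = j + 1) := fun h => by
    have := (isWork_workQ _ (by omega) (by omega)).1 h
    omega
  have ht : (workQ W k m n (R + l) (j + 1)).IsWork (fun a i => R ≤ a ∧ i = j + 1) :=
    (isWork_workQ _ (by omega) (by omega)).2 ⟨by omega, rfl⟩
  rcases hg with hg | rfl
  · split_ifs at hg
    · rw [List.mem_singleton] at hg
      subst hg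
      exact ⟨workQ_writable _ _, ht, hu, hu⟩
    · cases hg
  · exact ⟨workQ_writable _ _, ht, hu, not_isWork_queryQ _ _⟩

/-- The gates that initialize the comparisons. -/
def matchInit (W k m n R s : ℕ) : List (Gate W k m n) :=
  (List.range s).flatMap fun l => [(.ctrl, .ctrl, workQ W k m n (R + l) 0)]

theorem matchInit_mem {R s : ℕ} (hR : R + s ≤ W) {g : Gate W k m n}
    (hg : g ∈ matchInit W k m n R s) :
    g.2.2.writable = true ∧ g.2.2.IsWork (fun a _ => R ≤ a) ∧
      ¬ g.1.IsWork (fun a _ => R ≤ a) ∧ ¬ g.2.1.IsWork (fun a _ => R ≤ a) := by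
  simp only [matchInit, List.mem_flatMap, List.mem_range, List.mem_singleton] at hg
  obtain ⟨l, hl, rfl⟩ := hg
  exact ⟨workQ_writable _ _, (isWork_workQ _ (by omega) (by omega)).2 (by omega),
    not_isWork_ctrl _, not_isWork_ctrl _⟩

theorem match_isWork {R s : ℕ} {pts : ℕ → BitStr k} (hR : R + s ≤ W) (hk : k < W) {j : ℕ}
    (hj : j ≤ k) :
    ∀ g ∈ matchInit W k m n R s ++ (List.range j).flatMap (matchGates W k m n R s pts),
      g.2.2.IsWork fun a _ => R ≤ a := by
  intro g hg
  simp only [List.mem_append, List.mem_flatMap, List.mem_range] at hg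
  rcases hg with hg | ⟨i, hi, hg⟩
  · exact (matchInit_mem hR hg).2.1
  · obtain ⟨a, i, h, h'⟩ := (matchGates_mem hR hk (by omega) hg).2.1
    exact ⟨a, i, h, h'.1⟩

theorem val_of_not_isWork_of (enc : X ↪ BitStr k) (T : ℕ → ℕ → Prop) (L : List (Gate W k m n))
    (s : Full W X Z E m n) (t : Qubit W k m n) (h : ∀ g ∈ L, g.2.2.IsWork T)
    (ht : ¬ t.IsWork T) : t.val enc (runMap enc L.reverse s) = t.val enc s := by
  refine Qubit.val_runMap_of_ne enc _ s t fun g hg hgt => ?_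
  exact ht (hgt ▸ h g (by simpa using hg))

/-- Column `i` of the row of point `l` holds the control bit times the indicator that the first `i`
bits agree. Step `j` writes only to column `j + 1`, so no target of that step is one of its
controls. -/
theorem val_workQ_match (enc : X ↪ BitStr k) (s : Full W X Z E m n) {R S : ℕ}
    {pts : ℕ → BitStr k} (hR : R + S ≤ W) (hk : k < W) (b : BitStr k) (c : ZMod 2)
    (hb : ∀ j < k, (queryQ W k m n j).val enc s = bitAt b j)
    (hc : (Qubit.ctrl : Qubit W k m n).val enc s = c)
    (h0 : ∀ l < S, ∀ i < W, (workQ W k m n (R + l) i).val enc s = 0) (j : ℕ) (hj : j ≤ k)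
    (l i : ℕ) (hl : l < S) (hi : i < W) :
    (workQ W k m n (R + l) i).val enc (runMap enc (matchInit W k m n R S ++
      (List.range j).flatMap (matchGates W k m n R S pts)).reverse s) =
      if i ≤ j then c * ∏ j' ∈ Finset.range i,
        ((if bitAt (pts l) j' = 0 then 1 else 0) + bitAt b j') else 0 := by
  have hcc : ∀ c : ZMod 2, c * c = c := by decide
  induction j generalizing l i with
  | zero =>
    simp only [List.range_zero, List.flatMap_nil, List.append_nil]
    rw [Qubit.val_runMap_reverse enc _ _ _ fun g hg => matchInit_mem hR hg, h0 l hl i hi,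
      matchInit, sum_flatMap_range]
    simp only [List.map_cons, List.map_nil, List.sum_cons, List.sum_nil, add_zero, zero_add, hc,
      hcc]
    rw [Finset.sum_eq_single l]
    · simp only [workQ_inj (show R + l < W by omega) (show 0 < W by omega)
        (show R + l < W by omega) hi, true_and]
      by_cases hi0 : i = 0
      · subst hi0; simp
      · rw [if_neg (by omega), if_neg (by omega)]
    · intro l' hl' hne
      have := Finset.mem_range.1 hl'
      rw [if_neg]
      rw [workQ_inj (by omega) (by omega) (by omega) hi]
      omega
    · intro h
      exact absurd (Finset.mem_range.2 hl) h
  | succ j ih =>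
    rw [List.range_succ, List.flatMap_append, List.flatMap_singleton, ← List.append_assoc,
      List.reverse_append, runMap_append]
    set L := matchInit W k m n R S ++ (List.range j).flatMap (matchGates W k m n R S pts) with hL
    rw [Qubit.val_runMap_reverse enc _ _ _ fun g hg => matchGates_mem hR hk (by omega) hg,
      ih (by omega) l i hl hi]
    have hx : (queryQ W k m n j).val enc (runMap enc L.reverse s) = bitAt b j := by
      rw [val_of_not_isWork_of enc _ L s _ (match_isWork hR hk (by omega)) (not_isWork_queryQ _ _),
        hb j (by omega)]
    rw [matchGates, sum_flatMap_range, Finset.sum_eq_single l]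
    · have hu := ih (by omega) l j hl (by omega)
      rw [if_pos le_rfl] at hu
      rw [List.map_append, List.sum_append]
      simp only [List.map_cons, List.map_nil, List.sum_cons, List.sum_nil, add_zero,
        workQ_inj (show R + l < W by omega) (show j + 1 < W by omega)
        (show R + l < W by omega) hi, true_and, hx, hu]
      by_cases hij : i = j + 1
      · subst hij
        rw [if_neg (by omega), if_pos rfl, if_pos le_rfl, Finset.prod_range_succ, zero_add]
        by_cases hp : bitAt (pts l) j = 0
        · simp only [if_pos hp, List.map_cons, List.map_nil, List.sum_cons, List.sum_nil, add_zero,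
            if_true, hu, hcc]
          ring
        · simp only [if_neg hp, List.map_nil, List.sum_nil]
          ring
      · rw [if_neg (Ne.symm hij)]
        have : ((if bitAt (pts l) j = 0 then [(workQ W k m n (R + l) j, workQ W k m n (R + l) j,
            workQ W k m n (R + l) (j + 1))] else []).map fun g : Gate W k m n =>
            if g.2.2 = workQ W k m n (R + l) i then
              g.1.val enc (runMap enc L.reverse s) * g.2.1.val enc (runMap enc L.reverse s)
            else 0).sum = 0 := by
          split_ifs
          · simp only [List.map_cons, List.map_nil, List.sum_cons, List.sum_nil, add_zero,
              workQ_inj (show R + l < W by omega) (show j + 1 < W by omega)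
              (show R + l < W by omega) hi, true_and, if_neg (Ne.symm hij)]
          · rfl
        rw [this, add_zero, add_zero]
        by_cases h : i ≤ j
        · rw [if_pos h, if_pos (by omega)]
        · rw [if_neg h, if_neg (by omega)]
    · intro l' hl' hne
      have := Finset.mem_range.1 hl'
      have h1 : ¬ workQ W k m n (R + l') (j + 1) = workQ W k m n (R + l) i := by
        rw [workQ_inj (by omega) (by omega) (by omega) hi]
        omega
      split_ifs <;> simp [h1]
    · intro h
      exact absurd (Finset.mem_range.2 hl) h

theorem val_flag (enc : X ↪ BitStr k) (s : Full W X Z E m n) {F R S : ℕ} (hF : F < R)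
    (hR : R + S ≤ W) (hk : k < W) (c : ZMod 2)
    (hc : (Qubit.ctrl : Qubit W k m n).val enc s = c)
    (u : ℕ → ZMod 2) (hu : ∀ l < S, (workQ W k m n (R + l) k).val enc s = u l)
    (h0 : (workQ W k m n F 0).val enc s = 0) (L : List (Gate W k m n))
    (hL : L = [(.ctrl, .ctrl, workQ W k m n F 0)] ++ (List.range S).flatMap fun l =>
      [(workQ W k m n (R + l) k, workQ W k m n (R + l) k, workQ W k m n F 0)]) :
    (∀ g ∈ L, g.2.2.IsWork fun a _ => a = F) ∧
    (workQ W k m n F 0).val enc (runMap enc L.reverse s) =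
      c + ∑ l ∈ Finset.range S, u l := by
  have hcc : ∀ c : ZMod 2, c * c = c := by decide
  have hmem : ∀ g ∈ L, g.2.2.writable = true ∧ g.2.2.IsWork (fun a _ => a = F) ∧
      ¬ g.1.IsWork (fun a _ => a = F) ∧ ¬ g.2.1.IsWork (fun a _ => a = F) := by
    intro g hg
    have hT : (workQ W k m n F 0).IsWork (fun a _ => a = F) :=
      (isWork_workQ _ (by omega) (by omega)).2 rfl
    simp only [hL, List.mem_append, List.mem_flatMap, List.mem_range, List.mem_singleton] at hg
    rcases hg with rfl | ⟨l, hl, rfl⟩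
    · exact ⟨workQ_writable _ _, hT, not_isWork_ctrl _, not_isWork_ctrl _⟩
    · have : ¬ (workQ W k m n (R + l) k).IsWork (fun a _ => a = F) := fun h => by
        have := (isWork_workQ _ (by omega) (by omega)).1 h
        omega
      exact ⟨workQ_writable _ _, hT, this, this⟩
  refine ⟨fun g hg => (hmem g hg).2.1, ?_⟩
  rw [Qubit.val_runMap_reverse enc _ _ _ hmem, h0, hL, List.map_append, List.sum_append,
    sum_flatMap_range]
  simp only [List.map_cons, List.map_nil, List.sum_cons, List.sum_nil, add_zero, zero_add, if_true,
    hc, hcc]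
  congr 1
  exact Finset.sum_congr rfl fun l hl => hu l (Finset.mem_range.1 hl)

theorem not_isAnswer_workQ (a i : ℕ) : ¬ (workQ W k m n a i).IsAnswer := by
  rintro ⟨j, h⟩
  unfold workQ at h
  split_ifs at h

theorem not_isAnswer_queryQ (a : ℕ) : ¬ (queryQ W k m n a).IsAnswer := by
  rintro ⟨j, h⟩
  unfold queryQ at h
  split_ifs at h

theorem not_isAnswer_ctrl : ¬ (Qubit.ctrl : Qubit W k m n).IsAnswer := by
  rintro ⟨j, h⟩
  cases h

/-- The values of the work qubits after the preparations for a query. -/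
theorem prepareCirc_spec (enc : X ↪ BitStr k) {S : ℕ} {σ : Store} (h : Params n q k m S σ)
    (hS : S ≤ n) (hW : 2 * q + n + 3 ≤ W) (hW' : 2 * q * (k + 1) + k + 1 ≤ W) :
    (∀ g ∈ prepareCirc.gates W k m n 10 σ,
      ¬ g.1.IsAnswer ∧ ¬ g.2.1.IsAnswer ∧ ¬ g.2.2.IsAnswer) ∧
    ∀ s : Full W X Z E m n, s.1 = (fun _ => false) →
      (∀ i d, i < 2 * q → d < W → (workQ W k m n i d).val enc
        (runMap enc (prepareCirc.gates W k m n 10 σ).reverse s) =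
          (Qubit.ctrl : Qubit W k m n).val enc s * (bitPoly (enc s.2.1.2.1) ^ i).coeff d) ∧
      (∀ l < S, (workQ W k m n (2 + 2 * q + l) k).val enc
        (runMap enc (prepareCirc.gates W k m n 10 σ).reverse s) =
          (Qubit.ctrl : Qubit W k m n).val enc s *
            if enc s.2.1.2.1 = storedPoint k σ l then 1 else 0) ∧
      (workQ W k m n (1 + 2 * q) 0).val enc
        (runMap enc (prepareCirc.gates W k m n 10 σ).reverse s) =
          (Qubit.ctrl : Qubit W k m n).val enc s *
            (1 + ∑ l ∈ Finset.range S, if enc s.2.1.2.1 = storedPoint k σ l then 1 else 0) := by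
  have eP := powCirc_gates (W := W) h hW hW'
  have eM := matchCirc_gates (W := W) h hS hW hW'
  have eF := flagCirc_gates (W := W) h hS hW hW'
  have e0 : prepareCirc.gates W k m n 10 σ = powCirc.gates W k m n 10 σ ++
      (matchCirc.gates W k m n 10 σ ++ flagCirc.gates W k m n 10 σ) := rfl
  have hPw : ∀ g ∈ powCirc.gates W k m n 10 σ, g.2.2.IsWork fun _ _ => True := by
    rw [eP]; exact pow_isWork (by omega) hW' _ le_rfl
  have hMw : ∀ g ∈ matchCirc.gates W k m n 10 σ, g.2.2.IsWork fun a _ => 2 + 2 * q ≤ a := by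
    rw [eM]
    exact match_isWork (by omega) (by omega) le_rfl
  constructor
  · intro g hg
    rw [e0, eP, eM, eF] at hg
    simp only [List.mem_append, List.mem_flatMap, List.mem_range, List.mem_singleton, powGates,
      matchGates] at hg
    rcases hg with (rfl | ⟨r, hr, a, ha, b, hb, rfl⟩) |
      (⟨l, hl, rfl⟩ | ⟨j, hj, l, hl, hg | rfl⟩) | (rfl | ⟨l, hl, rfl⟩)
    · exact ⟨not_isAnswer_ctrl, not_isAnswer_ctrl, not_isAnswer_workQ _ _⟩
    · exact ⟨not_isAnswer_queryQ _, not_isAnswer_workQ _ _, not_isAnswer_workQ _ _⟩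
    · exact ⟨not_isAnswer_ctrl, not_isAnswer_ctrl, not_isAnswer_workQ _ _⟩
    · split_ifs at hg
      · rw [List.mem_singleton] at hg
        subst hg
        exact ⟨not_isAnswer_workQ _ _, not_isAnswer_workQ _ _, not_isAnswer_workQ _ _⟩
      · cases hg
    · exact ⟨not_isAnswer_workQ _ _, not_isAnswer_queryQ _, not_isAnswer_workQ _ _⟩
    · exact ⟨not_isAnswer_ctrl, not_isAnswer_ctrl, not_isAnswer_workQ _ _⟩
    · exact ⟨not_isAnswer_workQ _ _, not_isAnswer_workQ _ _, not_isAnswer_workQ _ _⟩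
  intro s hs
  rw [e0, List.reverse_append, List.reverse_append, runMap_append, runMap_append]
  set s₁ := runMap enc (powCirc.gates W k m n 10 σ).reverse s with hs₁
  set s₂ := runMap enc (matchCirc.gates W k m n 10 σ).reverse s₁ with hs₂
  have p₁ : ∀ a i, a < W → i < W → (workQ W k m n a i).val enc s₁ = if a ≤ 2 * q then
      (Qubit.ctrl : Qubit W k m n).val enc s * (bitPoly (enc s.2.1.2.1) ^ a).coeff i else 0 := by
    intro a i ha hi
    rw [hs₁, eP]
    exact val_workQ_pow enc s hs (by omega) hW' _ le_rfl a i ha hi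
  have c₁ : (Qubit.ctrl : Qubit W k m n).val enc s₁ = (Qubit.ctrl : Qubit W k m n).val enc s :=
    val_of_not_isWork enc _ s _ hPw (not_isWork_ctrl _)
  have c₂ : (Qubit.ctrl : Qubit W k m n).val enc s₂ = (Qubit.ctrl : Qubit W k m n).val enc s :=
    (val_of_not_isWork_of enc _ _ _ _ hMw (not_isWork_ctrl _)).trans c₁
  have b₁ : ∀ j < k, (queryQ W k m n j).val enc s₁ = bitAt (enc s.2.1.2.1) j := fun j hj =>
    (val_of_not_isWork enc _ s _ hPw (not_isWork_queryQ _ _)).trans (val_queryQ enc s hj)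
  have u₂ : ∀ l < S, (workQ W k m n (2 + 2 * q + l) k).val enc s₂ =
      (Qubit.ctrl : Qubit W k m n).val enc s *
        if enc s.2.1.2.1 = storedPoint k σ l then 1 else 0 := by
    intro l hl
    rw [hs₂, eM]
    refine (val_workQ_match enc s₁ (S := S) (R := 2 + 2 * q) (by omega) (by omega) _ _ b₁ c₁
      (fun l hl i hi => ?_) k le_rfl l k hl (by omega)).trans ?_
    -- The powers occupy rows `0, …, 2q` only, so the rows for the comparisons are still 0.
    · rw [p₁ _ _ (by omega) hi, if_neg (by omega)]
    · rw [if_pos le_rfl, prod_matches]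
  -- The comparisons change only rows from `2 + 2q` on; the powers and the flag in row `1 + 2q` are
  -- not affected.
  have low : ∀ a i, a < 2 + 2 * q → i < W → (workQ W k m n a i).val enc s₂ =
      (workQ W k m n a i).val enc s₁ := by
    intro a i ha hi
    refine val_of_not_isWork_of enc _ _ _ _ hMw fun hw => ?_
    have := (isWork_workQ _ (by omega) hi).1 hw
    omega
  have f₂ := val_flag enc s₂ (F := 1 + 2 * q) (R := 2 + 2 * q) (S := S) (by omega) (by omega)
    (by omega) _ c₂ _ u₂
    (by rw [low _ _ (by omega) (by omega), p₁ _ _ (by omega) (by omega), if_neg (by omega)])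
    _ eF
  have high : ∀ a i, a ≠ 1 + 2 * q → a < W → i < W → (workQ W k m n a i).val enc
      (runMap enc (flagCirc.gates W k m n 10 σ).reverse s₂) = (workQ W k m n a i).val enc s₂ := by
    intro a i ha haW hi
    exact val_of_not_isWork_of enc _ _ _ _ f₂.1 fun hw => ha ((isWork_workQ _ haW hi).1 hw)
  refine ⟨fun i d hi hd => ?_, fun l hl => ?_, ?_⟩
  · rw [high _ _ (by omega) (by omega) hd, low _ _ (by omega) hd, p₁ _ _ (by omega) hd,
      if_pos hi.le]
  · rw [high _ _ (by omega) (by omega) (by omega), u₂ l hl]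
  · rw [f₂.2, mul_add, mul_one, Finset.mul_sum]

/-- The whole circuit of a query. -/
def queryMapGates (W k m n : ℕ) (σ : Store) : List (Gate W k m n) :=
  prepareCirc.gates W k m n 10 σ ++ (answerCirc.gates W k m n 10 σ ++
    (prepareCirc.gates W k m n 10 σ).reverse)

/-- That the work qubits are restored is also needed when they are not 0: vectors are composed with
this map, and amplitudes at nonzero work qubits have to stay 0. -/
theorem runMap_queryMapGates (enc : X ↪ BitStr k) {S : ℕ} {σ : Store} (h : Params n q k m S σ)
    (hS : S ≤ n) (hW : 2 * q + n + 3 ≤ W) (hW' : 2 * q * (k + 1) + k + 1 ≤ W)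
    (s : Full W X Z E m n) :
    (runMap enc (queryMapGates W k m n σ) s).1 = s.1 ∧
    (s.1 = (fun _ => false) → runMap enc (queryMapGates W k m n σ) s = (s.1,
      queryMap (tableOracle enc q m (storedSeed σ) S (storedPoint k σ) (storedValue m σ)) s.2)) := by
  obtain ⟨hC, hspec⟩ := prepareCirc_spec (Z := Z) (E := E) enc h hS hW hW'
  have eA := answerCirc_gates (W := W) h hS hW hW'
  rw [queryMapGates, runMap_append, runMap_append, runMap_conj enc _ _ hC]
  · refine ⟨rfl, fun hs => ?_⟩
    obtain ⟨h1, h2, h3⟩ := hspec s hs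
    refine Prod.ext rfl (Prod.ext (Prod.ext rfl (Prod.ext rfl ?_)) rfl)
    funext j
    simp only [addMask, queryMap]
    congr 1
    set s' := runMap enc (prepareCirc.gates W k m n 10 σ).reverse s
    have hcc : ∀ c : ZMod 2, c * c = c := by decide
    have hans : ∀ j' < m, (answerQ W k m n j' = .answer j ↔ j' = j) := by
      intro j' hj'
      simp [answerQ, hj', Fin.ext_iff]
    have key : ((answerCirc.gates W k m n 10 σ).map fun g =>
        if g.2.2 = .answer j then g.1.val enc s' * g.2.1.val enc s' else 0).sum =
        (Qubit.ctrl : Qubit W k m n).val enc s *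
          ((1 + ∑ l ∈ Finset.range S, if enc s.2.1.2.1 = storedPoint k σ l then 1 else 0) *
          hashBit (storedSeed σ) (2 * q) (2 * q * (k + 1)) j (enc s.2.1.2.1) +
          ∑ l ∈ Finset.range S, (if enc s.2.1.2.1 = storedPoint k σ l then 1 else 0) *
            bitAt (storedValue m σ l) j) := by
      rw [eA, List.map_append, List.sum_append,
        mul_add (Qubit.val enc s Qubit.ctrl)]
      congr 1
      · rw [sum_flatMap_range, Finset.sum_eq_single (j : ℕ)]
        · rw [sum_flatMap_range, hashBit, Finset.mul_sum, Finset.mul_sum]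
          refine Finset.sum_congr rfl fun i hi => ?_
          rw [sum_flatMap_range, Finset.mul_sum, Finset.mul_sum]
          refine Finset.sum_congr rfl fun d hd => ?_
          have hi' := Finset.mem_range.1 hi
          have hd' := Finset.mem_range.1 hd
          have h01 : ∀ c : ZMod 2, c ≠ 1 → c = 0 := by decide
          by_cases hl : storedSeed σ (j * (2 * q * (2 * q * (k + 1))) +
            (i * (2 * q * (k + 1)) + d)) = 1
          · rw [if_pos hl, hl]
            simp only [List.map_cons, List.map_nil, List.sum_cons, List.sum_nil, add_zero,
              (hans j j.2).2 rfl, if_true]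
            rw [h1 i d hi' (by omega), h3]
            -- The control bit occurs twice in the product, in the flag and in the row of powers,
            -- and it is idempotent.
            linear_combination (1 + ∑ l ∈ Finset.range S,
              if enc s.2.1.2.1 = storedPoint k σ l then 1 else 0) *
              (bitPoly (enc s.2.1.2.1) ^ i).coeff d *
              hcc ((Qubit.ctrl : Qubit W k m n).val enc s)
          · rw [if_neg hl, h01 _ hl]
            simp
        · intro j' hj' hne
          have hj'' := Finset.mem_range.1 hj'
          have : ¬ answerQ W k m n j' = .answer j := fun h => hne ((hans j' hj'').1 h)
          rw [sum_flatMap_range]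
          refine Finset.sum_eq_zero fun i _ => ?_
          rw [sum_flatMap_range]
          refine Finset.sum_eq_zero fun d _ => ?_
          split_ifs <;> simp [this]
        · intro h
          exact absurd (Finset.mem_range.2 j.2) h
      · rw [sum_flatMap_range, Finset.mul_sum]
        refine Finset.sum_congr rfl fun l hl => ?_
        rw [sum_flatMap_range, Finset.sum_eq_single (j : ℕ)]
        · have hl' := Finset.mem_range.1 hl
          have h01 : ∀ c : ZMod 2, c ≠ 1 → c = 0 := by decide
          by_cases hb : bitAt (storedValue m σ l) j = 1
          · rw [if_pos hb, hb]
            simp only [List.map_cons, List.map_nil, List.sum_cons, List.sum_nil, add_zero,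
              (hans j j.2).2 rfl, if_true]
            rw [hcc, h2 l hl', mul_one]
          · rw [if_neg hb, h01 _ hb]
            simp
        · intro j' hj' hne
          have hj'' := Finset.mem_range.1 hj'
          have : ¬ answerQ W k m n j' = .answer j := fun h => hne ((hans j' hj'').1 h)
          split_ifs <;> simp [this]
        · intro h
          exact absurd (Finset.mem_range.2 j.2) h
    rw [key]
    have hb : ∀ (b : Bool) (e : ZMod 2),
        decide ((if b = true then 1 else 0) * e = 1) = (b && decide (e = 1)) := by decide
    exact hb _ _
  · intro g hg
    rw [eA] at hg
    simp only [List.mem_append, List.mem_flatMap, List.mem_range] at hg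
    have ha : ∀ j < m, (answerQ W k m n j).IsAnswer := fun j hj =>
      ⟨⟨j, hj⟩, by simp [answerQ, hj]⟩
    rcases hg with ⟨j, hj, i, hi, d, hd, hg⟩ | ⟨l, hl, j, hj, hg⟩ <;> split_ifs at hg <;>
      first
      | (rw [List.mem_singleton] at hg
         subst hg
         exact ⟨not_isAnswer_workQ _ _, not_isAnswer_workQ _ _, ha j hj⟩)
      | cases hg

/-- A state of the memory of the oracle algorithm, with all work qubits 0. -/
def embed (W : ℕ) (ψ : Mem X Z E m n → ℂ) : Vec W X Z E m n :=
  fun s => if s.1 = (fun _ => false) then ψ s.2 else 0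

variable [Fintype X] [DecidableEq X] [Fintype Z] [DecidableEq Z]
  [Fintype E] [DecidableEq E] {enc : X ↪ BitStr k} {A : OracleAlg X Z E m n q}

theorem det_queryProg {S : ℕ} (c : Config W X Z E m n) (h : Params n q k m S c.mem) (hS : S ≤ n)
    (hW : 2 * q + n + 3 ≤ W) (hW' : 2 * q * (k + 1) + k + 1 ≤ W) (ψ : Mem X Z E m n → ℂ)
    (hψ : c.vec = embed W ψ) :
    Det enc A queryProg c fun σ φ => c.mem.Agree 10 σ ∧
      φ = embed W (applyOracle (tableOracle enc q m (storedSeed c.mem) S (storedPoint k c.mem)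
        (storedValue m c.mem)) ψ) := by
  have key : ∀ φ : Vec W X Z E m n, φ = c.vec ∘ runMap enc (queryMapGates W k m n c.mem) →
      φ = embed W (applyOracle (tableOracle enc q m (storedSeed c.mem) S (storedPoint k c.mem)
        (storedValue m c.mem)) ψ) := by
    rintro φ rfl
    funext s
    obtain ⟨h1, h2⟩ := runMap_queryMapGates (Z := Z) (E := E) enc h hS hW hW' s
    simp only [Function.comp_apply, hψ, embed, h1]
    split_ifs with hs
    · rw [h2 hs]; rfl
    · rfl
  refine Det.seq (Circ.det_up _ (by norm_num) prepareCirc_within c) ?_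
  rintro c₁ ⟨a₁, v₁⟩
  refine Det.seq (Circ.det_up _ (by norm_num) answerCirc_within c₁) ?_
  rintro c₂ ⟨a₂, v₂⟩
  refine (Circ.det_down _ (by norm_num) prepareCirc_within c₂).mono ?_
  rintro σ φ ⟨a₃, v₃⟩
  refine ⟨(a₁.trans a₂).trans a₃, key _ ?_⟩
  rw [v₃, v₂, v₁, ← Circ.gates_eq_of_within _ a₁ answerCirc_within,
    ← Circ.gates_eq_of_within _ (a₁.trans a₂) prepareCirc_within]
  funext s
  simp [queryMapGates, runMap_append]

end

/-! ### Classical subroutines -/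

/-- Cell `i` of array `arr` becomes `i` times the stride, provided that cell 0 is 0. -/
def mulTable (arr : ℕ) (bound stride : NExpr) : Prog :=
  countUp 10 bound (.assign (.lit arr) (.add (cell 10) (.lit 1))
    (.add (.read (.lit arr) (cell 10)) stride))

/-- Copy the first cells of array `src` to array `dst`. -/
def copyArray (dst : NExpr) (src : ℕ) (bound : NExpr) : Prog :=
  countUp 10 bound (.assign dst (cell 10) (.read (.lit src) (cell 10)))

/-- Fill the first cells of array `arr` with random numbers from 0 to `e`. -/
def fillRandom (arr : ℕ) (bound e : NExpr) : Prog :=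
  countUp 10 bound (.rand (.lit arr) (cell 10) e)

/-- Count one more. -/
def incr (p : ℕ) : Prog := .assign (.lit p) (.lit 0) (.add (cell p) (.lit 1))

/-- Compute in cell 0 of array 12 the rank of the cell of array 8 pointed to by array 10. -/
def rankProg : Prog :=
  countUp 11 (param 0)
    (.ite (.add (.read (.lit 8) (cell 11)) (.lit 1)) (.read (.lit 8) (cell 10)) (incr 12)
      (.ite (.read (.lit 8) (cell 11)) (.read (.lit 8) (cell 10))
        (.ite (.add (cell 11) (.lit 1)) (cell 10) (incr 12) idle) idle))

/-- Write to array 1 the permutation that sorts array 8. -/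
def sortProg : Prog :=
  countUp 10 (param 0) (.seq (.assign (.lit 12) (.lit 0) (.lit 0))
    (.seq rankProg (.assign (.lit 1) (cell 12) (cell 10))))

/-- `i` precedes `j` in the stable order by values of `v`. -/
def Precedes (v : ℕ → ℕ) (i j : ℕ) : Prop := v i < v j ∨ (v i = v j ∧ i < j)

instance (v : ℕ → ℕ) (i j : ℕ) : Decidable (Precedes v i j) :=
  inferInstanceAs (Decidable (_ ∨ _))

/-- The number of elements that precede `j`. -/
def rank (v : ℕ → ℕ) (n j : ℕ) : ℕ := ((Finset.range n).filter fun i => Precedes v i j).card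

theorem rank_lt_rank {v : ℕ → ℕ} {n i j : ℕ} (hi : i < n) (h : Precedes v i j) :
    rank v n i < rank v n j := by
  refine Finset.card_lt_card ⟨fun l hl => ?_, fun hs => ?_⟩
  · obtain ⟨h1, h2⟩ := Finset.mem_filter.1 hl
    refine Finset.mem_filter.2 ⟨h1, ?_⟩
    unfold Precedes at h h2 ⊢
    omega
  · have h1 := (Finset.mem_filter.1 (hs (Finset.mem_filter.2 ⟨Finset.mem_range.2 hi, h⟩))).2
    unfold Precedes at h1
    omega

theorem rank_lt {v : ℕ → ℕ} {n j : ℕ} (hj : j < n) : rank v n j < n := by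
  have : rank v n j < (Finset.range n).card := by
    refine Finset.card_lt_card ⟨Finset.filter_subset _ _, fun hs => ?_⟩
    have h1 := (Finset.mem_filter.1 (hs (Finset.mem_range.2 hj))).2
    unfold Precedes at h1
    omega
  simpa using this

theorem rank_inj {v : ℕ → ℕ} {n i j : ℕ} (hi : i < n) (hj : j < n)
    (h : rank v n i = rank v n j) : i = j := by
  by_contra hne
  have : Precedes v i j ∨ Precedes v j i := by unfold Precedes; omega
  rcases this with h' | h'
  · exact absurd h (rank_lt_rank hi h').ne
  · exact absurd h (rank_lt_rank hj h').ne'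

/-- The permutation that sorts `v`. -/
noncomputable def sortPerm (n : ℕ) (v : ℕ → ℕ) : Equiv.Perm (Fin n) :=
  (Equiv.ofBijective (fun j : Fin n => (⟨rank v n j, rank_lt j.2⟩ : Fin n))
    (Finite.injective_iff_bijective.1 fun i j h =>
      Fin.ext (rank_inj i.2 j.2 (by simpa using h)))).symm

theorem rank_sortPerm {n : ℕ} (v : ℕ → ℕ) (s : Fin n) : rank v n (sortPerm n v s) = s := by
  have h := (sortPerm n v).symm_apply_apply s
  have h' : (sortPerm n v).symm (sortPerm n v s) = ⟨rank v n (sortPerm n v s), rank_lt (Fin.is_lt _)⟩ :=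
    rfl
  rw [h'] at h
  exact congrArg Fin.val h

theorem sortPerm_mono {n : ℕ} (v : ℕ → ℕ) {s t : Fin n} (h : s ≤ t) :
    v (sortPerm n v s) ≤ v (sortPerm n v t) := by
  by_contra hlt
  have := rank_lt_rank (n := n) (Fin.is_lt (sortPerm n v t)) (Or.inl (not_le.1 hlt))
  rw [rank_sortPerm, rank_sortPerm] at this
  exact absurd h (not_le.2 this)

section
variable {W k m n q : ℕ} {X Z E : Type} [Fintype X] [DecidableEq X] [Fintype Z] [DecidableEq Z]
  [Fintype E] [DecidableEq E] {enc : X ↪ BitStr k} {A : OracleAlg X Z E m n q}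

theorem det_mulTable {arr N d : ℕ} {bound stride : NExpr} (c : Config W X Z E m n)
    (harr : arr ≠ 10) (h0 : c.mem arr 0 = 0)
    (hb : ∀ σ : Store, (∀ a i, a ≠ arr → a ≠ 10 → σ a i = c.mem a i) → bound.eval σ = N)
    (hd : ∀ σ : Store, (∀ a i, a ≠ arr → a ≠ 10 → σ a i = c.mem a i) → stride.eval σ = d) :
    Det enc A (mulTable arr bound stride) c fun σ ψ => ψ = c.vec ∧
      (∀ i ≤ N, σ arr i = i * d) ∧ ∀ a i, a ≠ arr → a ≠ 10 → σ a i = c.mem a i := by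
  refine Det.mono (det_countUp (fun j σ ψ => ψ = c.vec ∧
      (∀ i ≤ j, σ arr i = i * d) ∧ ∀ a i, a ≠ arr → a ≠ 10 → σ a i = c.mem a i) N
      (hb _ fun a i h h' => by simp [Store.write_apply, h']) ⟨rfl, ?_, ?_⟩ ?_) fun σ ψ h => h.2
  · intro i hi
    obtain rfl : i = 0 := by omega
    simp [Store.write_apply, harr, h0]
  · intro a i h h'
    simp [Store.write_apply, h']
  · rintro i hi c' h1 ⟨h2, h3, h4⟩
    refine det_assign ⟨?_, h2, ?_, ?_⟩
    · simp [Store.write_apply, NExpr.eval, h1, harr.symm]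
    · intro j hj
      simp only [Store.write_apply, NExpr.eval, eval_cell, h1, hd c'.mem h4, h3 i le_rfl, harr,
        false_and, if_false, true_and]
      split_ifs with h
      · rw [h]; ring
      · exact h3 j (by omega)
    · intro a j h h'
      simp [Store.write_apply, NExpr.eval, h, h', h4]

theorem det_copyArray {dst : NExpr} {src D N : ℕ} {bound : NExpr} (c : Config W X Z E m n)
    (hD : D ≠ 10) (hsrc : src ≠ D) (hsrc' : src ≠ 10)
    (hb : ∀ σ : Store, (∀ a i, a ≠ D → a ≠ 10 → σ a i = c.mem a i) → bound.eval σ = N)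
    (hd : ∀ σ : Store, (∀ a i, a ≠ D → a ≠ 10 → σ a i = c.mem a i) → dst.eval σ = D) :
    Det enc A (copyArray dst src bound) c fun σ ψ => ψ = c.vec ∧
      (∀ i < N, σ D i = c.mem src i) ∧ ∀ a i, a ≠ D → a ≠ 10 → σ a i = c.mem a i := by
  refine Det.mono (det_countUp (fun j σ ψ => ψ = c.vec ∧
      (∀ i < j, σ D i = c.mem src i) ∧ ∀ a i, a ≠ D → a ≠ 10 → σ a i = c.mem a i) N
      (hb _ fun a i h h' => by simp [Store.write_apply, h']) ⟨rfl, ?_, ?_⟩ ?_) fun σ ψ h => h.2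
  · intro i hi
    omega
  · intro a i h h'
    simp [Store.write_apply, h']
  · rintro i hi c' h1 ⟨h2, h3, h4⟩
    refine det_assign ⟨?_, h2, ?_, ?_⟩
    · simp [Store.write_apply, h1, hd c'.mem h4, hD.symm]
    · intro j hj
      simp only [Store.write_apply, NExpr.eval, eval_cell, h1, hd c'.mem h4, h4 src i hsrc hsrc',
        hD, false_and, if_false, true_and]
      split_ifs with h
      · rw [h]
      · exact h3 j (by omega)
    · intro a j h h'
      simp [Store.write_apply, hd c'.mem h4, h, h', h4]

/-- Each draw scales the vector by `1 / √(V + 1)`, so that the squared norm of a branch contains its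
probability. -/
theorem branches_fillRandom {arr N V : ℕ} {bound e : NExpr} (c : Config W X Z E m n)
    (harr : arr ≠ 10)
    (hb : ∀ σ : Store, (∀ a i, a ≠ arr → a ≠ 10 → σ a i = c.mem a i) → bound.eval σ = N)
    (he : ∀ σ : Store, (∀ a i, a ≠ arr → a ≠ 10 → σ a i = c.mem a i) → e.eval σ = V) :
    Branches enc A (fillRandom arr bound e) c fun (f : Fin N → Fin (V + 1)) σ ψ =>
      ψ = (((Real.sqrt (V + 1) : ℝ) : ℂ)⁻¹ ^ N) • c.vec ∧
      (∀ i : Fin N, σ arr i = f i) ∧ ∀ a i, a ≠ arr → a ≠ 10 → σ a i = c.mem a i := by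
  refine branches_countUp (fun j (f : Fin j → Fin (V + 1)) σ ψ =>
      ψ = (((Real.sqrt (V + 1) : ℝ) : ℂ)⁻¹ ^ j) • c.vec ∧
      (∀ i : Fin j, σ arr i = f i) ∧ ∀ a i, a ≠ arr → a ≠ 10 → σ a i = c.mem a i) N
      (hb _ fun a i h h' => by simp [Store.write_apply, h']) (fun f => ⟨?_, ?_, ?_⟩) ?_
  · simp
  · exact fun i => i.elim0
  · intro a i h h'
    simp [Store.write_apply, h']
  · rintro i hi f c' h1 ⟨h2, h3, h4⟩
    refine ⟨fun v => { mem := c'.mem.write arr i v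
                       vec := fun s => ((Real.sqrt (V + 1) : ℝ) : ℂ)⁻¹ * c'.vec s
                       time := c'.time + 1 }, ?_, fun v => ⟨?_, ?_, ?_, ?_⟩⟩
    · simp only [Prog.exec, he c'.mem h4, NExpr.eval, eval_cell, h1]
      rw [← List.map_coe_finRange_eq_range, List.map_map, Fin.univ_def]
      rfl
    · simp [Store.write_apply, h1, harr.symm]
    · funext s
      simp only [h2, Pi.smul_apply, smul_eq_mul]
      ring
    · intro j
      refine Fin.lastCases ?_ (fun j => ?_) j
      · simp [Store.write_apply, harr]
      · have := j.2
        simp [Store.write_apply, harr, h3, this.ne]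
    · intro a j h h'
      simp [Store.write_apply, h, h', h4]

theorem det_incr {p : ℕ} {c : Config W X Z E m n} {Q : Store → Vec W X Z E m n → Prop}
    (h : Q (c.mem.write p 0 (c.mem p 0 + 1)) c.vec) : Det enc A (incr p) c Q := det_assign h

theorem det_rankProg (c : Config W X Z E m n) (hn : c.mem 0 0 = n) {j : ℕ}
    (hj : c.mem 10 0 = j) (h0 : c.mem 12 0 = 0) :
    Det enc A rankProg c fun σ ψ => ψ = c.vec ∧ σ 12 0 = rank (c.mem 8) n j ∧
      ∀ a i, a ≠ 11 → a ≠ 12 → a ≠ 19 → σ a i = c.mem a i := by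
  refine Det.mono (det_countUp (fun i σ ψ => ψ = c.vec ∧
      σ 12 0 = ((Finset.range i).filter fun i => Precedes (c.mem 8) i j).card ∧
      ∀ a i, a ≠ 11 → a ≠ 12 → a ≠ 19 → σ a i = c.mem a i) n
      (by simp [param, NExpr.eval, Store.write_apply, hn]) ⟨rfl, ?_, ?_⟩ ?_) fun σ ψ h => h.2
  · simp [Store.write_apply, h0]
  · intro a i h h' h''
    simp [Store.write_apply, h]
  · rintro i hi c' h1 ⟨h2, h3, h4⟩
    have e8 : ∀ l, c'.mem 8 l = c.mem 8 l := fun l => h4 8 l (by norm_num) (by norm_num)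
      (by norm_num)
    have e10 : c'.mem 10 0 = j := (h4 10 0 (by norm_num) (by norm_num) (by norm_num)).trans hj
    rw [Finset.range_add_one, Finset.filter_insert]
    have yes : ∀ c'' : Config W X Z E m n, c''.mem = c'.mem → c''.vec = c'.vec →
        Precedes (c.mem 8) i j → Det enc A (incr 12) c'' fun σ ψ => σ 11 0 = i ∧ ψ = c.vec ∧
          (σ.write 11 0 (i + 1)) 12 0 = (if Precedes (c.mem 8) i j then
            insert i ((Finset.range i).filter fun i => Precedes (c.mem 8) i j)
            else (Finset.range i).filter fun i => Precedes (c.mem 8) i j).card ∧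
          ∀ a l, a ≠ 11 → a ≠ 12 → a ≠ 19 → (σ.write 11 0 (i + 1)) a l = c.mem a l := by
      intro c'' e1 e2 hP
      refine det_incr ⟨?_, by rw [e2, h2], ?_, ?_⟩
      · simp [Store.write_apply, e1, h1]
      · rw [if_pos hP, Finset.card_insert_of_notMem (by simp)]
        simp [Store.write_apply, e1, h3]
      · intro a l h h' h''
        simp [Store.write_apply, e1, h, h', h4 a l h h' h'']
    have no : ∀ c'' : Config W X Z E m n, c''.mem = c'.mem → c''.vec = c'.vec →
        ¬ Precedes (c.mem 8) i j → Det enc A idle c'' fun σ ψ => σ 11 0 = i ∧ ψ = c.vec ∧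
          (σ.write 11 0 (i + 1)) 12 0 = (if Precedes (c.mem 8) i j then
            insert i ((Finset.range i).filter fun i => Precedes (c.mem 8) i j)
            else (Finset.range i).filter fun i => Precedes (c.mem 8) i j).card ∧
          ∀ a l, a ≠ 11 → a ≠ 12 → a ≠ 19 → (σ.write 11 0 (i + 1)) a l = c.mem a l := by
      intro c'' e1 e2 hP
      refine det_assign ⟨?_, by rw [e2, h2], ?_, ?_⟩
      · simp [Store.write_apply, NExpr.eval, e1, h1]
      · rw [if_neg hP]
        simp [Store.write_apply, NExpr.eval, e1, h3]
      · intro a l h h' h''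
        simp [Store.write_apply, NExpr.eval, e1, h, h'', h4 a l h h' h'']
    -- The three tests are `v i < v j`, then `v i ≤ v j` (which now means equality), then `i < j` to
    -- break the tie.
    refine det_ite (fun g1 => yes _ rfl rfl ?_) fun g1 => det_ite (fun g2 => det_ite
      (fun g3 => yes _ rfl rfl ?_) fun g3 => no _ rfl rfl ?_) fun g2 => no _ rfl rfl ?_ <;>
    simp only [NExpr.eval, eval_cell, Config.tick, e8, e10, h1] at * <;>
    unfold Precedes <;> omega

/-- The input `j` is written to the cell given by its rank, so array 1 becomes the inverse of the
rank function, which is `sortPerm`. -/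
theorem det_sortProg (c : Config W X Z E m n) (hn : c.mem 0 0 = n) :
    Det enc A sortProg c fun σ ψ => ψ = c.vec ∧
      (∀ s : Fin n, σ 1 s = sortPerm n (c.mem 8) s) ∧
      ∀ a i, a ≠ 1 → (a < 10 ∨ 20 ≤ a) → σ a i = c.mem a i := by
  refine Det.mono (det_countUp (fun j σ ψ => ψ = c.vec ∧
      (∀ i < j, σ 1 (rank (c.mem 8) n i) = i) ∧
      ∀ a i, a ≠ 1 → (a < 10 ∨ 20 ≤ a) → σ a i = c.mem a i) n
      (by simp [param, NExpr.eval, Store.write_apply, hn]) ⟨rfl, ?_, ?_⟩ ?_) ?_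
  · intro i hi
    omega
  · intro a i h h'
    rw [Store.write_apply, if_neg (by omega)]
  · rintro j hj c' h1 ⟨h2, h3, h4⟩
    refine Det.seq (S := fun σ ψ => σ = c'.mem.write 12 0 0 ∧ ψ = c'.vec)
      (det_assign ⟨rfl, rfl⟩) ?_
    rintro c₁ ⟨e1, e2⟩
    refine Det.seq (det_rankProg c₁ (j := j) ?_ ?_ ?_) ?_
    · rw [e1, Store.write_apply, if_neg (by omega), h4 0 0 (by omega) (by omega), hn]
    · rw [e1, Store.write_apply, if_neg (by omega), h1]
    · rw [e1]; simp [Store.write_apply]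
    rintro c₂ ⟨f1, f2, f3⟩
    have e8 : c₁.mem 8 = c.mem 8 := by
      funext l
      rw [e1, Store.write_apply, if_neg (by omega), h4 8 l (by omega) (by omega)]
    have e10 : c₂.mem 10 0 = j := by
      rw [f3 10 0 (by omega) (by omega) (by omega), e1, Store.write_apply, if_neg (by omega), h1]
    refine det_assign ?_
    simp only [NExpr.eval, eval_cell, f2, e8, e10]
    refine ⟨?_, by rw [f1, e2, h2], ?_, ?_⟩
    · rw [Store.write_apply, if_neg (by omega), e10]
    · intro i hi
      rw [Store.write_apply, if_neg (by omega), Store.write_apply]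
      by_cases hij : i = j
      · rw [if_pos (by rw [hij]; simp), hij]
      · have hne : rank (c.mem 8) n i ≠ rank (c.mem 8) n j := fun h =>
          hij (rank_inj (by omega) hj h)
        rw [if_neg (fun h => hne h.2), f3 _ _ (by omega) (by omega) (by omega), e1,
          Store.write_apply, if_neg (by omega), h3 i (by omega)]
    · intro a l h h'
      rw [Store.write_apply, if_neg (by omega), Store.write_apply, if_neg (by omega),
        f3 _ _ (by omega) (by omega) (by omega), e1, Store.write_apply, if_neg (by omega),
        h4 a l h h']
  · rintro σ ψ ⟨-, h2, h3, h4⟩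
    refine ⟨h2, fun s => ?_, h4⟩
    have := h3 (sortPerm n (c.mem 8) s) (Fin.is_lt _)
    rwa [rank_sortPerm] at this

end

/-! ### The simulator -/

/-- The index up to which queries are to be made, doubled. -/
def target : NExpr := .read (.lit 9) (.lit 1)

/-- Make queries, as long as twice the index of the query to follow is at most the target. -/
def runTo : Prog :=
  .loop (param 1) (.ite (.add (.add (cell 9) (cell 9)) (.lit 2)) target
    (.seq queryProg (.seq (.call (cell 9)) (incr 9))) idle)

/-- Measure the query input or, if the target is the end, the output register. -/
def measProg : Prog :=
  countUp 10 (param 2) (.ite (.add target (.lit 1)) twiceQ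
    (.meas (.query (cell 10)) (.lit 2) (cell 10))
    (.meas (.out (.read (.lit 1) (param 4)) (cell 10)) (.lit 2) (cell 10)))

/-- A stage that outputs a point. -/
def mainStage : Prog :=
  .seq (.assign (.lit 9) (.lit 1) (.read (.lit 8) (.read (.lit 1) (param 4))))
    (.seq runTo (.seq measProg
      (.seq (.assign (.lit 9) (.lit 1) (.add target (.lit 1))) runTo)))

/-- The last stage. -/
def finalStage : Prog := .seq (.assign (.lit 9) (.lit 1) twiceQ) runTo

/-- Multiplication tables. -/
def tablesProg : Prog :=
  .seq (mulTable 4 twiceQ (.add (param 2) (.lit 1)))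
    (.seq (mulTable 5 twiceQ degBound) (mulTable 6 (param 3) (.read (.lit 5) twiceQ)))

/-- Random choices: the schedule of the measurements and the seed of the hash function. -/
def chooseProg : Prog :=
  .seq (fillRandom 8 (param 0) twiceQ)
    (.seq (fillRandom 7 (.read (.lit 6) (param 3)) (.lit 1)) sortProg)

/-- Store the last point and the value received for it. -/
def receiveProg : Prog :=
  .seq (copyArray (.add (.lit 20) (.add (.sub (param 4) (.lit 1)) (.sub (param 4) (.lit 1)))) 2
      (param 2))
    (copyArray (.add (.lit 21) (.add (.sub (param 4) (.lit 1)) (.sub (param 4) (.lit 1)))) 3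
      (param 3))

/-- A stage of the simulator, when the tables are in memory. -/
def stageProg : Prog :=
  .seq (.ite (param 4) (.lit 0) chooseProg receiveProg)
    (.ite (.add (param 4) (.lit 1)) (param 0) mainStage finalStage)

/-- The simulator. -/
def simulator : Prog := .seq (.ite (param 4) (.lit 0) tablesProg idle) stageProg

section
variable {W k m n q : ℕ} {X Z E : Type}

/-- The value of the register that is measured for the input with number `j`, if the target is
`τ`. -/
def measuredReg (q τ : ℕ) (j : Fin n) (μ : Mem X Z E m n) : X :=
  if τ + 1 ≤ 2 * q then μ.1.2.1 else μ.2.1 j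

/-- Projection to the states in which the measured register encodes as `b`. -/
def projReg (enc : X ↪ BitStr k) (q τ : ℕ) (j : Fin n) (b : BitStr k)
    (ψ : Mem X Z E m n → ℂ) : Mem X Z E m n → ℂ :=
  fun μ => if enc (measuredReg q τ j μ) = b then ψ μ else 0

/-- The stored data define this oracle. -/
noncomputable def storedOracle (enc : X ↪ BitStr k) (q m S : ℕ) (σ : Store) : X → BitStr m :=
  tableOracle enc q m (storedSeed σ) S (storedPoint k σ) (storedValue m σ)

theorem Params.congr {S : ℕ} {σ τ : Store} (h : Params n q k m S σ)
    (hσ : ∀ a i, (a = 0 ∨ a = 4 ∨ a = 5 ∨ a = 6) → τ a i = σ a i) : Params n q k m S τ where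
  hn := by rw [hσ _ _ (by norm_num), h.hn]
  hq := by rw [hσ _ _ (by norm_num), h.hq]
  hk := by rw [hσ _ _ (by norm_num), h.hk]
  hm := by rw [hσ _ _ (by norm_num), h.hm]
  hs := by rw [hσ _ _ (by norm_num), h.hs]
  tab₁ i hi := by rw [hσ _ _ (by norm_num), h.tab₁ i hi]
  tab₂ i hi := by rw [hσ _ _ (by norm_num), h.tab₂ i hi]
  tab₃ j hj := by rw [hσ _ _ (by norm_num), h.tab₃ j hj]

theorem storedOracle_congr (enc : X ↪ BitStr k) (q m S : ℕ) {σ τ : Store}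
    (hσ : ∀ a i, (a = 7 ∨ 20 ≤ a) → τ a i = σ a i) :
    storedOracle enc q m S τ = storedOracle enc q m S σ := by
  have h1 : storedSeed τ = storedSeed σ := by
    funext i; simp only [storedSeed, hσ 7 i (by norm_num)]
  have h2 : storedPoint k τ = storedPoint k σ := by
    funext l j; simp only [storedPoint, hσ (20 + (l + l)) j (Or.inr (by omega))]
  have h3 : storedValue m τ = storedValue m σ := by
    funext l j; simp only [storedValue, hσ (21 + (l + l)) j (Or.inr (by omega))]
  rw [storedOracle, storedOracle, h1, h2, h3]

theorem tableOracle_congr (enc : X ↪ BitStr k) (q m S : ℕ) (lam : ℕ → ZMod 2)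
    {pts pts' : ℕ → BitStr k} {vals vals' : ℕ → BitStr m} (hp : ∀ l < S, pts l = pts' l)
    (hv : ∀ l < S, vals l = vals' l) :
    tableOracle enc q m lam S pts vals = tableOracle enc q m lam S pts' vals' := by
  have e1 : ∀ x, ∑ l ∈ Finset.range S, (if enc x = pts l then (1 : ZMod 2) else 0) =
      ∑ l ∈ Finset.range S, if enc x = pts' l then 1 else 0 := fun x =>
    Finset.sum_congr rfl fun l hl => by rw [hp l (Finset.mem_range.1 hl)]
  have e2 : ∀ x j, ∑ l ∈ Finset.range S, (if enc x = pts l then (1 : ZMod 2) else 0) *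
      bitAt (vals l) j = ∑ l ∈ Finset.range S, (if enc x = pts' l then 1 else 0) *
      bitAt (vals' l) j := fun x j =>
    Finset.sum_congr rfl fun l hl => by
      rw [hp l (Finset.mem_range.1 hl), hv l (Finset.mem_range.1 hl)]
  funext x j
  simp only [tableOracle, e1, e2]

variable [Fintype X] [DecidableEq X] [Fintype Z] [DecidableEq Z]
  [Fintype E] [DecidableEq E] {enc : X ↪ BitStr k} {A : OracleAlg X Z E m n q}

/-- One query to `G` and the operation with index `i`. -/
noncomputable def stepQ (A : OracleAlg X Z E m n q) (G : X → BitStr m) (i : ℕ)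
    (ψ : Mem X Z E m n → ℂ) : Mem X Z E m n → ℂ :=
  if h : i < q then (A.step ⟨i, h⟩).mulVec (applyOracle G ψ) else ψ

/-- The queries `i, …, i + d - 1`. -/
noncomputable def advance (A : OracleAlg X Z E m n q) (G : X → BitStr m) (i : ℕ) :
    ℕ → (Mem X Z E m n → ℂ) → Mem X Z E m n → ℂ
  | 0, ψ => ψ
  | d + 1, ψ => stepQ A G (i + d) (advance A G i d ψ)

theorem applyCall_embed (A : OracleAlg X Z E m n q) {i : ℕ} (hi : i < q)
    (ψ : Mem X Z E m n → ℂ) :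
    applyCall A i (embed W ψ) = embed W ((A.step ⟨i, hi⟩).mulVec ψ) := by
  funext s
  simp only [applyCall, hi, dif_pos, embed]
  split_ifs with hs
  · rfl
  · exact congrFun (Matrix.mulVec_zero _) _

/-- A query is made as long as `2 * cur + 2 ≤ τ`, that is, until `τ / 2` queries have been made. The
remaining rounds of the loop are idle, and the truncated difference `τ / 2 - cur` is 0 if that
number has already been reached. The target `2q + 1` has to be allowed because a stage raises its
target by one. -/
theorem det_runTo {S cur τ : ℕ} (c : Config W X Z E m n) (h : Params n q k m S c.mem)
    (hS : S ≤ n) (hW : 2 * q + n + 3 ≤ W) (hW' : 2 * q * (k + 1) + k + 1 ≤ W)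
    (ψ : Mem X Z E m n → ℂ) (hψ : c.vec = embed W ψ) (hcur : c.mem 9 0 = cur)
    (hτ : c.mem 9 1 = τ) (hτ' : τ ≤ 2 * q + 1) :
    Det enc A runTo c fun σ φ =>
      φ = embed W (advance A (storedOracle enc q m S c.mem) cur (τ / 2 - cur) ψ) ∧
      σ 9 0 = cur + (τ / 2 - cur) ∧
      ∀ a i, (a < 9 ∨ 20 ≤ a ∨ (a = 9 ∧ i ≠ 0)) → σ a i = c.mem a i := by
  have := det_loop (enc := enc) (A := A) (c := c) (e := param 1)
    (P := .ite (.add (.add (cell 9) (cell 9)) (.lit 2)) target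
      (.seq queryProg (.seq (.call (cell 9)) (incr 9))) idle)
    (fun j σ φ => φ = embed W (advance A (storedOracle enc q m S c.mem) cur
        (min j (τ / 2 - cur)) ψ) ∧ σ 9 0 = cur + min j (τ / 2 - cur) ∧
      ∀ a i, (a < 9 ∨ 20 ≤ a ∨ (a = 9 ∧ i ≠ 0)) → σ a i = c.mem a i) q h.hq
    ⟨by simpa [advance] using hψ, by simpa using hcur, fun _ _ _ => rfl⟩ ?_
  · have e : min q (τ / 2 - cur) = τ / 2 - cur := by omega
    rw [e] at this
    exact this
  rintro j hj c₁ ⟨v₁, cur₁, fr₁⟩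
  have hτ₁ : c₁.mem 9 1 = τ := (fr₁ 9 1 (by norm_num)).trans hτ
  refine det_ite (fun hle => ?_) fun hle => ?_
  · simp only [NExpr.eval, eval_cell, target, cur₁, hτ₁] at hle
    have hm : min j (τ / 2 - cur) = j := by omega
    have hm' : min (j + 1) (τ / 2 - cur) = j + 1 := by omega
    rw [hm] at v₁ cur₁ hle
    have P₁ : Params n q k m S c₁.tick.mem := h.congr fun a i ha => fr₁ a i (by omega)
    have G₁ : storedOracle enc q m S c₁.mem = storedOracle enc q m S c.mem :=
      storedOracle_congr enc q m S fun a i ha => fr₁ a i (by omega)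
    refine Det.seq (det_queryProg c₁.tick P₁ hS hW hW' _ v₁) ?_
    rintro c₂ ⟨a₂, v₂⟩
    have cur₂ : c₂.mem 9 0 = cur + j := (a₂ 9 0 (by norm_num)).symm.trans cur₁
    change c₂.vec = embed W (applyOracle (storedOracle enc q m S c₁.mem) _) at v₂
    rw [G₁] at v₂
    refine Det.seq (S := fun σ φ => σ = c₂.mem ∧ φ = applyCall A (cur + j) c₂.vec)
      ⟨_, rfl, rfl, by simp [Config.upd, cur₂]⟩ ?_
    rintro c₃ ⟨m₃, v₃⟩
    refine det_incr ⟨?_, ?_, ?_⟩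
    · rw [v₃, v₂, applyCall_embed A (show cur + j < q by omega), hm']
      simp only [advance, stepQ]
      rw [dif_pos]
    · rw [hm', m₃, cur₂, Store.write_apply, if_pos ⟨rfl, rfl⟩, add_assoc]
    · intro a i hai
      rw [Store.write_apply, if_neg (by omega), m₃, ← a₂ a i (by omega)]
      exact fr₁ a i hai
  · simp only [NExpr.eval, eval_cell, target, cur₁, hτ₁] at hle
    have hm : min (j + 1) (τ / 2 - cur) = min j (τ / 2 - cur) := by omega
    rw [hm]
    refine det_assign ⟨v₁, ?_, ?_⟩
    · simp only [NExpr.eval]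
      rw [Store.write_apply, if_neg (by omega)]
      exact cur₁
    · intro a i hai
      simp only [NExpr.eval]
      rw [Store.write_apply, if_neg (by omega)]
      exact fr₁ a i hai

theorem branches_meas {r : QAddr} {a i : NExpr} {c : Config W X Z E m n} {r' : Qubit W k m n}
    (hr : r.resolve W k m n c.mem = some r') {Q : Bool → Store → Vec W X Z E m n → Prop}
    (h : ∀ b : Bool, Q b (c.mem.write (a.eval c.mem) (i.eval c.mem) (if b then 1 else 0))
      (measProj enc r' b c.vec)) :
    Branches enc A (.meas r a i) c Q := by
  refine ⟨fun b => { mem := c.mem.write (a.eval c.mem) (i.eval c.mem) (if b then 1 else 0)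
                     vec := measProj enc r' b c.vec
                     time := c.time + 1 }, ?_, h⟩
  simp only [Prog.exec, hr]
  -- The semantics lists the outcome 0 first, the enumeration of `Bool` has `true` first.
  exact Multiset.coe_eq_coe.2 (List.Perm.swap _ _ _)

/-- The register is measured bit by bit; after `k` bits the projection is onto one value of the
encoding. Targets below `2q` refer to the query input, and the target `2q` to the output register of
the input handled in this stage. -/
theorem branches_measProg {S τ : ℕ} (c : Config W X Z E m n) (h : Params n q k m S c.mem)
    (ψ : Mem X Z E m n → ℂ) (hψ : c.vec = embed W ψ) (hτ : c.mem 9 1 = τ) (j : Fin n)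
    (hj : c.mem 1 S = j) :
    Branches enc A measProg c fun (b : BitStr k) σ φ =>
      φ = embed W (projReg enc q τ j b ψ) ∧
      (∀ i : Fin k, σ 2 i = if b i then 1 else 0) ∧
      ∀ a i, a ≠ 2 → a ≠ 10 → σ a i = c.mem a i := by
  refine Branches.mono (branches_countUp (fun i (f : Fin i → Bool) σ φ =>
      φ = embed W (fun μ => if ∀ l : Fin i, ∀ hl : (l : ℕ) < k,
        enc (measuredReg q τ j μ) ⟨l, hl⟩ = f l then ψ μ else 0) ∧
      (∀ l : Fin i, σ 2 l = if f l then 1 else 0) ∧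
      ∀ a i, a ≠ 2 → a ≠ 10 → σ a i = c.mem a i) k
      (by simp [param, NExpr.eval, Store.write_apply, h.hk]) (fun f => ⟨?_, ?_, ?_⟩) ?_) ?_
  · exact hψ.trans (congrArg _ (funext fun μ => (if_pos fun l : Fin 0 => l.elim0).symm))
  · exact fun l => l.elim0
  · intro a i h1 h2
    rw [Store.write_apply, if_neg (by omega)]
  · rintro i hi f c₁ h1 ⟨h2, h3, h4⟩
    -- The induction step is the same for the query input and for an output register; only the value
    -- that is read matters.
    have key : ∀ (reg : Qubit W k m n) (b : Bool),
        (∀ s : Full W X Z E m n, reg.get enc s = enc (measuredReg q τ j s.2) ⟨i, hi⟩) →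
        measProj enc reg b c₁.vec = embed W (fun μ => if ∀ l : Fin (i + 1), ∀ hl : (l : ℕ) < k,
          enc (measuredReg q τ j μ) ⟨l, hl⟩ = Fin.snoc (α := fun _ => Bool) f b l
          then ψ μ else 0) := by
      intro reg b hreg
      funext s
      simp only [measProj, hreg, h2, embed]
      have e : (∀ l : Fin (i + 1), ∀ hl : (l : ℕ) < k, enc (measuredReg q τ j s.2) ⟨l, hl⟩ =
          Fin.snoc (α := fun _ => Bool) f b l) ↔
          (∀ l : Fin i, ∀ hl : (l : ℕ) < k, enc (measuredReg q τ j s.2) ⟨l, hl⟩ = f l) ∧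
          enc (measuredReg q τ j s.2) ⟨i, hi⟩ = b := by
        constructor
        · intro H
          refine ⟨fun l hl => ?_, ?_⟩
          · simpa using H l.castSucc (by simpa using hl)
          · simpa using H (Fin.last i) (by simpa using hi)
        · rintro ⟨H1, H2⟩ l hl
          refine Fin.lastCases (motive := fun l => ∀ hl : (l : ℕ) < k,
            enc (measuredReg q τ j s.2) ⟨l, hl⟩ = Fin.snoc (α := fun _ => Bool) f b l)
            ?_ (fun l => ?_) l hl
          · intro _; simpa using H2
          · intro hl; simpa using H1 l (by simpa using hl)
      simp only [e]
      by_cases g1 : enc (measuredReg q τ j s.2) ⟨i, hi⟩ = b <;>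
        by_cases g2 : ∀ l : Fin i, ∀ hl : (l : ℕ) < k,
          enc (measuredReg q τ j s.2) ⟨l, hl⟩ = f l <;> simp [g1, g2]
    have fin : ∀ (b : Bool),
        ((c₁.mem.write 2 i (if b then 1 else 0)) 10 0 = i) ∧
        (∀ l : Fin (i + 1), ((c₁.mem.write 2 i (if b then 1 else 0)).write 10 0 (i + 1)) 2 l =
          if Fin.snoc (α := fun _ => Bool) f b l then 1 else 0) ∧
        ∀ a l, a ≠ 2 → a ≠ 10 →
          ((c₁.mem.write 2 i (if b then 1 else 0)).write 10 0 (i + 1)) a l = c.mem a l := by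
      intro b
      refine ⟨by rw [Store.write_apply, if_neg (by omega), h1], fun l => ?_, fun a l g1 g2 => ?_⟩
      · rw [Store.write_apply, if_neg (by omega), Store.write_apply]
        refine Fin.lastCases ?_ (fun l => ?_) l
        · simp
        · have := l.2
          simp [h3, this.ne]
      · rw [Store.write_apply, if_neg (by omega), Store.write_apply, if_neg (by omega), h4 a l g1 g2]
    have ev : c₁.mem 9 1 = τ := (h4 9 1 (by norm_num) (by norm_num)).trans hτ
    have eq₁ : c₁.mem 0 1 = q := (h4 0 1 (by norm_num) (by norm_num)).trans h.hq
    refine branches_ite (fun hle => ?_) fun hle => ?_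
    · simp only [NExpr.eval, target, twiceQ, param, ev, eq₁] at hle
      refine branches_meas (r' := .query ⟨i, hi⟩) (by simp [QAddr.resolve, Config.tick, h1, toFin?, hi])
        fun b => ?_
      simp only [NExpr.eval, eval_cell, Config.tick, h1]
      obtain ⟨f1, f2, f3⟩ := fin b
      refine ⟨f1, key _ b fun s => ?_, f2, f3⟩
      simp only [Qubit.get, measuredReg]
      rw [if_pos (by omega)]
    · simp only [NExpr.eval, target, twiceQ, param, ev, eq₁] at hle
      have e1 : c₁.mem 0 4 = S := (h4 0 4 (by norm_num) (by norm_num)).trans h.hs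
      have e2 : c₁.mem 1 S = j := (h4 1 S (by norm_num) (by norm_num)).trans hj
      refine branches_meas (r' := .out j ⟨i, hi⟩) (by
          simp [QAddr.resolve, Config.tick, NExpr.eval, param, h1, e1, e2, toFin?, hi])
        fun b => ?_
      simp only [NExpr.eval, eval_cell, Config.tick, h1]
      obtain ⟨f1, f2, f3⟩ := fin b
      refine ⟨f1, key _ b fun s => ?_, f2, f3⟩
      simp only [Qubit.get, measuredReg]
      rw [if_neg (by omega)]
  · rintro b σ φ ⟨h2, h3, h4⟩
    refine ⟨?_, h3, h4⟩
    rw [h2]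
    congr 1
    funext μ
    simp only [projReg]
    refine if_congr ?_ rfl rfl
    constructor
    · exact fun H => funext fun l => H l l.2
    · rintro H l hl
      rw [H]

end

/-! ### The effect of the individual stages. -/

section
variable {W k m n q : ℕ} {X Z E : Type}

/-- The memory of the simulator in stage `S`, with `e` reprogrammed points. -/
structure SimInv (n q k m : ℕ) (lam : ℕ → ZMod 2) (v : ℕ → ℕ) (pts : ℕ → BitStr k)
    (vals : ℕ → BitStr m) (S e cur : ℕ) (σ : Store) : Prop where
  params : Params n q k m S σ
  seed : storedSeed σ = lam
  sched : σ 8 = v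
  perm : ∀ s : Fin n, σ 1 s = sortPerm n v s
  points : ∀ l < e, storedPoint k σ l = pts l
  values : ∀ l < e, storedValue m σ l = vals l
  cur : σ 9 0 = cur

variable {lam : ℕ → ZMod 2} {v : ℕ → ℕ} {pts : ℕ → BitStr k} {vals : ℕ → BitStr m}

theorem SimInv.congr {S e cur cur' : ℕ} {σ τ : Store}
    (h : SimInv n q k m lam v pts vals S e cur σ)
    (hσ : ∀ a i, ((a < 9 ∧ a ≠ 2 ∧ a ≠ 3) ∨ 20 ≤ a) → τ a i = σ a i) (hc : τ 9 0 = cur') :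
    SimInv n q k m lam v pts vals S e cur' τ where
  params := h.params.congr fun a i ha => hσ a i (by omega)
  seed := by
    rw [← h.seed]
    funext i; simp only [storedSeed, hσ 7 i (by omega)]
  sched := by
    rw [← h.sched]
    funext i; exact hσ 8 i (by omega)
  perm s := by rw [hσ 1 s (by omega), h.perm]
  points l hl := by
    rw [← h.points l hl]
    funext j; simp only [storedPoint, hσ (20 + (l + l)) j (by omega)]
  values l hl := by
    rw [← h.values l hl]
    funext j; simp only [storedValue, hσ (21 + (l + l)) j (by omega)]
  cur := hc

theorem SimInv.storedOracle_eq {S cur : ℕ} {σ : Store} (enc : X ↪ BitStr k)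
    (h : SimInv n q k m lam v pts vals S S cur σ) :
    storedOracle enc q m S σ = tableOracle enc q m lam S pts vals := by
  rw [storedOracle, h.seed]
  exact tableOracle_congr enc q m S lam h.points h.values

variable [Fintype X] [DecidableEq X] [Fintype Z] [DecidableEq Z]
  [Fintype E] [DecidableEq E] {enc : X ↪ BitStr k} {A : OracleAlg X Z E m n q}

/-- The effect of a stage with oracle `G` and measurement time `τ` of the input with number `j`,
if the outcome is `b`, on the state and on the number of queries made. -/
noncomputable def stageStep (enc : X ↪ BitStr k) (A : OracleAlg X Z E m n q) (G : X → BitStr m)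
    (τ : ℕ) (j : Fin n) (b : BitStr k) (p : (Mem X Z E m n → ℂ) × ℕ) :
    (Mem X Z E m n → ℂ) × ℕ :=
  (advance A G (p.2 + (τ / 2 - p.2)) ((τ + 1) / 2 - (p.2 + (τ / 2 - p.2)))
    (projReg enc q τ j b (advance A G p.2 (τ / 2 - p.2) p.1)),
    p.2 + (τ / 2 - p.2) + ((τ + 1) / 2 - (p.2 + (τ / 2 - p.2))))

/-- The state and the number of queries made after `s` stages. -/
noncomputable def simPair (enc : X ↪ BitStr k) (A : OracleAlg X Z E m n q) (lam : ℕ → ZMod 2)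
    (v : ℕ → ℕ) (pts : ℕ → BitStr k) (vals : ℕ → BitStr m) (ψ : Mem X Z E m n → ℂ) :
    ℕ → (Mem X Z E m n → ℂ) × ℕ
  | 0 => (ψ, 0)
  | s + 1 =>
    if h : s < n then
      stageStep enc A (tableOracle enc q m lam s pts vals) (v (sortPerm n v ⟨s, h⟩))
        (sortPerm n v ⟨s, h⟩) (pts s) (simPair enc A lam v pts vals ψ s)
    else simPair enc A lam v pts vals ψ s

/-- Outcomes of later stages are irrelevant, so the sequence of outcomes can be filled in one entry
per stage. -/
theorem simPair_congr {pts pts' : ℕ → BitStr k} (ψ : Mem X Z E m n → ℂ) (s : ℕ)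
    (h : ∀ l < s, pts l = pts' l) :
    simPair enc A lam v pts vals ψ s = simPair enc A lam v pts' vals ψ s := by
  induction s with
  | zero => rfl
  | succ s ih =>
    simp only [simPair]
    rw [ih fun l hl => h l (by omega), h s (by omega),
      tableOracle_congr enc q m s lam (fun l hl => h l (by omega)) fun _ _ => rfl]

/-- If at most `τ / 2` queries have been made before, the second call of `runTo`, with target `τ +
1`, makes exactly one query for odd `τ` and none for even `τ`. It still uses the old oracle, because
the new point is stored only in the next stage. The parity of `τ` thus decides whether the
reprogramming takes effect after the measured query or with it. -/
theorem branches_mainStage {s cur : ℕ} (hs : s < n) (hv : ∀ j < n, v j ≤ 2 * q)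
    (hW : 2 * q + n + 3 ≤ W) (hW' : 2 * q * (k + 1) + k + 1 ≤ W)
    (c : Config W X Z E m n) (h : SimInv n q k m lam v pts vals s s cur c.mem)
    (ψ : Mem X Z E m n → ℂ) (hψ : c.vec = embed W ψ) :
    Branches enc A mainStage c fun (b : BitStr k) σ φ =>
      φ = embed W (stageStep enc A (tableOracle enc q m lam s pts vals)
        (v (sortPerm n v ⟨s, hs⟩)) (sortPerm n v ⟨s, hs⟩) b (ψ, cur)).1 ∧
      SimInv n q k m lam v pts vals s s (stageStep enc A (tableOracle enc q m lam s pts vals)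
        (v (sortPerm n v ⟨s, hs⟩)) (sortPerm n v ⟨s, hs⟩) b (ψ, cur)).2 σ ∧
      ∀ i : Fin k, σ 2 i = if b i then 1 else 0 := by
  set j := sortPerm n v ⟨s, hs⟩ with hj
  set τ := v j with hτ
  set G := tableOracle enc q m lam s pts vals with hG
  have hτ' : τ ≤ 2 * q := hv _ j.2
  have hperm : c.mem 1 s = j := h.perm ⟨s, hs⟩
  refine Det.seq_branches (S := fun σ φ => σ = c.mem.write 9 1 τ ∧ φ = c.vec)
    (det_assign ⟨?_, rfl⟩) ?_
  · simp only [NExpr.eval, param, h.params.hs, hperm, h.sched, hτ]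
  rintro c₁ ⟨m₁, v₁⟩
  have i₁ : SimInv n q k m lam v pts vals s s cur c₁.mem := by
    refine h.congr (fun a i ha => ?_) ?_
    · rw [m₁, Store.write_apply, if_neg (by omega)]
    · rw [m₁, Store.write_apply, if_neg (by omega), h.cur]
  have t₁ : c₁.mem 9 1 = τ := by rw [m₁, Store.write_apply, if_pos ⟨rfl, rfl⟩]
  refine Det.seq_branches (det_runTo c₁ i₁.params hs.le hW hW' ψ (v₁.trans hψ) i₁.cur t₁
    (by omega)) ?_
  rintro c₂ ⟨v₂, cur₂, fr₂⟩
  have i₂ := i₁.congr (fun a i ha => fr₂ a i (by omega)) cur₂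
  have t₂ : c₂.mem 9 1 = τ := (fr₂ 9 1 (by omega)).trans t₁
  rw [i₁.storedOracle_eq enc] at v₂
  refine Branches.seq_det (branches_measProg c₂ i₂.params _ v₂ t₂ j (i₂.perm ⟨s, hs⟩)) ?_
  rintro b c₃ ⟨v₃, o₃, fr₃⟩
  have i₃ := i₂.congr (fun a i ha => fr₃ a i (by omega) (by omega))
    ((fr₃ 9 0 (by omega) (by omega)).trans i₂.cur)
  have t₃ : c₃.mem 9 1 = τ := (fr₃ 9 1 (by omega) (by omega)).trans t₂
  refine Det.seq (S := fun σ φ => σ = c₃.mem.write 9 1 (τ + 1) ∧ φ = c₃.vec)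
    (det_assign ⟨?_, rfl⟩) ?_
  · simp only [NExpr.eval, target, t₃]
  rintro c₄ ⟨m₄, v₄⟩
  have i₄ : SimInv n q k m lam v pts vals s s (cur + (τ / 2 - cur)) c₄.mem := by
    refine i₃.congr (fun a i ha => ?_) ?_
    · rw [m₄, Store.write_apply, if_neg (by omega)]
    · rw [m₄, Store.write_apply, if_neg (by omega), i₃.cur]
  have t₄ : c₄.mem 9 1 = τ + 1 := by rw [m₄, Store.write_apply, if_pos ⟨rfl, rfl⟩]
  refine (det_runTo c₄ i₄.params hs.le hW hW' _ (v₄.trans v₃) i₄.cur t₄ (by omega)).mono ?_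
  rintro σ φ ⟨v₅, cur₅, fr₅⟩
  rw [i₄.storedOracle_eq enc] at v₅
  refine ⟨v₅, i₄.congr (fun a i ha => fr₅ a i (by omega)) cur₅, fun i => ?_⟩
  rw [fr₅ 2 i (by omega), m₄, Store.write_apply, if_neg (by omega), o₃]

theorem det_finalStage {cur : ℕ} (hW : 2 * q + n + 3 ≤ W) (hW' : 2 * q * (k + 1) + k + 1 ≤ W)
    (c : Config W X Z E m n) (h : SimInv n q k m lam v pts vals n n cur c.mem)
    (ψ : Mem X Z E m n → ℂ) (hψ : c.vec = embed W ψ) :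
    Det enc A finalStage c fun _ φ =>
      φ = embed W (advance A (tableOracle enc q m lam n pts vals) cur (q - cur) ψ) := by
  refine Det.seq (S := fun σ φ => σ = c.mem.write 9 1 (2 * q) ∧ φ = c.vec)
    (det_assign ⟨?_, rfl⟩) ?_
  · simp only [NExpr.eval, twiceQ, param, h.params.hq]
    rw [two_mul]
  rintro c₁ ⟨m₁, v₁⟩
  have i₁ : SimInv n q k m lam v pts vals n n cur c₁.mem := by
    refine h.congr (fun a i ha => ?_) ?_
    · rw [m₁, Store.write_apply, if_neg (by omega)]
    · rw [m₁, Store.write_apply, if_neg (by omega), h.cur]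
  refine (det_runTo c₁ i₁.params le_rfl hW hW' ψ (v₁.trans hψ) i₁.cur
    (by rw [m₁, Store.write_apply, if_pos ⟨rfl, rfl⟩]) (by omega)).mono ?_
  rintro σ φ ⟨v₂, -, -⟩
  rw [v₂, i₁.storedOracle_eq enc, show 2 * q / 2 = q by omega]

theorem det_receiveProg {s cur : ℕ} (c : Config W X Z E m n)
    (h : SimInv n q k m lam v pts vals (s + 1) s cur c.mem)
    (hp : ∀ i : Fin k, c.mem 2 i = if pts s i then 1 else 0)
    (hv : ∀ i : Fin m, c.mem 3 i = if vals s i then 1 else 0) :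
    Det enc A receiveProg c fun σ φ => φ = c.vec ∧
      SimInv n q k m lam v pts vals (s + 1) (s + 1) cur σ := by
  refine Det.seq (det_copyArray (D := 20 + (s + s)) (N := k) c (by omega) (by omega) (by omega)
    (fun σ hσ => ?_) fun σ hσ => ?_) ?_
  · simp only [NExpr.eval, param]
    rw [hσ 0 2 (by omega) (by omega), h.params.hk]
  · simp only [NExpr.eval, param]
    rw [hσ 0 4 (by omega) (by omega), h.params.hs]
    simp
  rintro c₁ ⟨v₁, p₁, f₁⟩
  refine (det_copyArray (D := 21 + (s + s)) (N := m) c₁ (by omega) (by omega) (by omega)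
    (fun σ hσ => ?_) fun σ hσ => ?_).mono ?_
  · simp only [NExpr.eval, param]
    rw [hσ 0 3 (by omega) (by omega), f₁ 0 3 (by omega) (by omega), h.params.hm]
  · simp only [NExpr.eval, param]
    rw [hσ 0 4 (by omega) (by omega), f₁ 0 4 (by omega) (by omega), h.params.hs]
    simp
  rintro σ φ ⟨v₂, p₂, f₂⟩
  have f : ∀ a i, a ≠ 20 + (s + s) → a ≠ 21 + (s + s) → a ≠ 10 → σ a i = c.mem a i :=
    fun a i h1 h2 h3 => (f₂ a i h2 h3).trans (f₁ a i h1 h3)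
  refine ⟨v₂.trans v₁, ?_⟩
  refine ⟨h.params.congr fun a i ha => f a i (by omega) (by omega) (by omega), ?_, ?_, ?_, ?_, ?_, ?_⟩
  · rw [← h.seed]
    funext i; simp only [storedSeed, f 7 i (by omega) (by omega) (by omega)]
  · rw [← h.sched]
    funext i; exact f 8 i (by omega) (by omega) (by omega)
  · intro s'
    rw [f 1 s' (by omega) (by omega) (by omega), h.perm]
  · intro l hl
    by_cases hls : l = s
    · subst hls
      funext i
      simp only [storedPoint]
      rw [f₂ _ _ (by omega) (by omega), p₁ i i.2, hp]
      cases pts l i <;> simp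
    · rw [← h.points l (by omega)]
      funext i
      simp only [storedPoint, f (20 + (l + l)) i (by omega) (by omega) (by omega)]
  · intro l hl
    by_cases hls : l = s
    · subst hls
      funext i
      simp only [storedValue]
      rw [p₂ i i.2, f₁ 3 i (by omega) (by omega), hv]
      cases vals l i <;> simp
    · rw [← h.values l (by omega)]
      funext i
      simp only [storedValue, f (21 + (l + l)) i (by omega) (by omega) (by omega)]
  · rw [f 9 0 (by omega) (by omega) (by omega), h.cur]

/-- Expressions have no product, so multiples are tabulated by repeated addition. Each stride is the
last entry of the table before: `k + 1`, then `2q (k + 1)`, then `(2q)² (k + 1)`. The seed is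
addressed with these tables. -/
theorem det_tablesProg {S : ℕ} (c : Config W X Z E m n) (hn : c.mem 0 0 = n) (hq : c.mem 0 1 = q)
    (hk : c.mem 0 2 = k) (hm : c.mem 0 3 = m) (hS : c.mem 0 4 = S) (h4 : c.mem 4 0 = 0)
    (h5 : c.mem 5 0 = 0) (h6 : c.mem 6 0 = 0) :
    Det enc A tablesProg c fun σ φ => φ = c.vec ∧ Params n q k m S σ ∧
      ∀ a i, a ≠ 4 → a ≠ 5 → a ≠ 6 → a ≠ 10 → σ a i = c.mem a i := by
  refine Det.seq (det_mulTable (N := 2 * q) (d := k + 1) c (by omega) h4 (fun σ hσ => ?_)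
    fun σ hσ => ?_) ?_
  · simp only [NExpr.eval, param, twiceQ]
    rw [hσ 0 1 (by omega) (by omega), hq, two_mul]
  · simp only [NExpr.eval, param]
    rw [hσ 0 2 (by omega) (by omega), hk]
  rintro c₁ ⟨v₁, t₁, f₁⟩
  have q₁ : c₁.mem 0 1 = q := (f₁ 0 1 (by omega) (by omega)).trans hq
  refine Det.seq (det_mulTable (N := 2 * q) (d := 2 * q * (k + 1)) c₁ (by omega)
    ((f₁ 5 0 (by omega) (by omega)).trans h5) (fun σ hσ => ?_) fun σ hσ => ?_) ?_
  · simp only [NExpr.eval, param, twiceQ]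
    rw [hσ 0 1 (by omega) (by omega), q₁, two_mul]
  · simp only [NExpr.eval, param, degBound, twiceQ]
    rw [hσ 0 1 (by omega) (by omega), q₁, hσ 4 _ (by omega) (by omega), ← two_mul, t₁ _ le_rfl]
  rintro c₂ ⟨v₂, t₂, f₂⟩
  have q₂ : c₂.mem 0 1 = q := (f₂ 0 1 (by omega) (by omega)).trans q₁
  refine (det_mulTable (N := m) (d := 2 * q * (2 * q * (k + 1))) c₂ (by omega)
    ((f₂ 6 0 (by omega) (by omega)).trans ((f₁ 6 0 (by omega) (by omega)).trans h6))
    (fun σ hσ => ?_) fun σ hσ => ?_).mono ?_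
  · simp only [NExpr.eval, param]
    rw [hσ 0 3 (by omega) (by omega), f₂ 0 3 (by omega) (by omega), f₁ 0 3 (by omega) (by omega), hm]
  · simp only [NExpr.eval, param, twiceQ]
    rw [hσ 0 1 (by omega) (by omega), q₂, hσ 5 _ (by omega) (by omega), ← two_mul, t₂ _ le_rfl]
  rintro σ φ ⟨v₃, t₃, f₃⟩
  have f : ∀ a i, a ≠ 4 → a ≠ 5 → a ≠ 6 → a ≠ 10 → σ a i = c.mem a i :=
    fun a i h1 h2 h3 h4 => (f₃ a i h3 h4).trans ((f₂ a i h2 h4).trans (f₁ a i h1 h4))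
  have f0 : ∀ i, σ 0 i = c.mem 0 i := fun i => f 0 i (by omega) (by omega) (by omega) (by omega)
  refine ⟨v₃.trans (v₂.trans v₁), ⟨?_, ?_, ?_, ?_, ?_, ?_, ?_, t₃⟩, f⟩
  · rw [f0, hn]
  · rw [f0, hq]
  · rw [f0, hk]
  · rw [f0, hm]
  · rw [f0, hS]
  · intro i hi
    rw [f₃ _ _ (by omega) (by omega), f₂ _ _ (by omega) (by omega), t₁ i hi]
  · intro i hi
    rw [f₃ _ _ (by omega) (by omega), t₂ i hi]

/-- The random choices of the simulator: a schedule and a seed. -/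
abbrev Choice (n q k m : ℕ) : Type :=
  (Fin n → Fin (2 * q + 1)) × (Fin (m * (2 * q * (2 * q * (k + 1)))) → Fin (1 + 1))

/-- The amplitude of each choice. -/
noncomputable def choiceAmp (n q k m : ℕ) : ℂ :=
  ((Real.sqrt ((2 * q : ℕ) + 1) : ℝ) : ℂ)⁻¹ ^ n *
    ((Real.sqrt ((1 : ℕ) + 1) : ℝ) : ℂ)⁻¹ ^ (m * (2 * q * (2 * q * (k + 1))))

/-- The memory holds the random choices. -/
def Holds (f : Choice n q k m) (lam : ℕ → ZMod 2) (v : ℕ → ℕ) : Prop :=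
  (∀ j : Fin n, v j = f.1 j) ∧
    ∀ i : Fin (m * (2 * q * (2 * q * (k + 1)))), lam i = if (f.2 i : ℕ) = 1 then 1 else 0

/-- No point has been stored yet, so the invariant holds for arbitrary `pts` and `vals`; they are
fixed later, when the outcomes are known. -/
theorem branches_chooseProg (c : Config W X Z E m n) (h : Params n q k m 0 c.mem)
    (hcur : c.mem 9 0 = 0) :
    Branches enc A chooseProg c fun (f : Choice n q k m) σ φ =>
      φ = choiceAmp n q k m • c.vec ∧ ∃ lam v, Holds f lam v ∧
        ∀ pts vals, SimInv n q k m lam v pts vals 0 0 0 σ := by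
  refine Branches.seq (branches_fillRandom (N := n) (V := 2 * q) c (by omega)
    (fun σ hσ => ?_) fun σ hσ => ?_) ?_
  · simp only [NExpr.eval, param]
    rw [hσ 0 0 (by omega) (by omega), h.hn]
  · simp only [NExpr.eval, param, twiceQ]
    rw [hσ 0 1 (by omega) (by omega), h.hq, two_mul]
  rintro f₁ c₁ ⟨v₁, p₁, r₁⟩
  refine Branches.seq_det (branches_fillRandom (N := m * (2 * q * (2 * q * (k + 1)))) (V := 1) c₁
    (by omega) (fun σ hσ => ?_) fun σ hσ => rfl) ?_
  · simp only [NExpr.eval, param]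
    rw [hσ 0 3 (by omega) (by omega), hσ 6 _ (by omega) (by omega), r₁ 0 3 (by omega) (by omega),
      r₁ 6 _ (by omega) (by omega), h.hm, h.tab₃ m le_rfl]
  rintro f₂ c₂ ⟨v₂, p₂, r₂⟩
  have r : ∀ a i, a ≠ 8 → a ≠ 7 → a ≠ 10 → c₂.mem a i = c.mem a i := fun a i h1 h2 h3 =>
    (r₂ a i h2 h3).trans (r₁ a i h1 h3)
  refine (det_sortProg c₂ ((r 0 0 (by omega) (by omega) (by omega)).trans h.hn)).mono ?_
  rintro σ φ ⟨v₃, p₃, r₃⟩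
  have e8 : σ 8 = c₂.mem 8 := funext fun i => r₃ 8 i (by omega) (by omega)
  refine ⟨?_, storedSeed σ, σ 8, ⟨fun j => ?_, fun i => ?_⟩, fun pts vals => ⟨?_, rfl, rfl, ?_,
    fun l hl => absurd hl (Nat.not_lt_zero _), fun l hl => absurd hl (Nat.not_lt_zero _), ?_⟩⟩
  · rw [v₃, v₂, v₁, smul_smul, choiceAmp, mul_comm]
  · rw [e8, r₂ 8 j (by omega) (by omega), p₁]
  · simp only [storedSeed]
    rw [r₃ 7 i (by omega) (by omega), p₂]
    refine if_congr ?_ rfl rfl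
    have := (f₂ i).2
    omega
  · exact h.congr fun a i ha => (r₃ a i (by omega) (by omega)).trans
      (r a i (by omega) (by omega) (by omega))
  · intro s
    rw [p₃, e8]
  · rw [r₃ 9 0 (by omega) (by omega), r 9 0 (by omega) (by omega) (by omega), hcur]

end

/-! ### The interaction -/

section
variable {W k m n q : ℕ} {X Z E : Type}

/-- The values that are received for the outputs of the stages. -/
noncomputable def received (T : Fin n → BitStr m) (v : ℕ → ℕ) (l : ℕ) : BitStr m :=
  if h : l < n then T (sortPerm n v ⟨l, h⟩) else fun _ => false

theorem Params.stageInput {S : ℕ} {σ : Store} (h : Params n q k m S σ) (T : Fin n → BitStr m)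
    (perm : Fin n → ℕ) (s : ℕ) : Params n q k m s (stageInput T perm s σ) where
  hn := by simp [MeasureReprogram.stageInput, h.hn]
  hq := by simp [MeasureReprogram.stageInput, h.hq]
  hk := by simp [MeasureReprogram.stageInput, h.hk]
  hm := by simp [MeasureReprogram.stageInput, h.hm]
  hs := by simp [MeasureReprogram.stageInput]
  tab₁ i hi := by simp [MeasureReprogram.stageInput, h.tab₁ i hi]
  tab₂ i hi := by simp [MeasureReprogram.stageInput, h.tab₂ i hi]
  tab₃ j hj := by simp [MeasureReprogram.stageInput, h.tab₃ j hj]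

theorem stageInput_of_ne {σ : Store} (T : Fin n → BitStr m) (perm : Fin n → ℕ) (s : ℕ) {a : ℕ}
    (i : ℕ) (h0 : a ≠ 0) (h3 : a ≠ 3) : stageInput T perm s σ a i = σ a i := by
  simp [stageInput, h0, h3]

variable {lam : ℕ → ZMod 2} {v : ℕ → ℕ} {pts : ℕ → BitStr k} {vals : ℕ → BitStr m}

theorem SimInv.stageInput {S e cur : ℕ} {σ : Store}
    (h : SimInv n q k m lam v pts vals S e cur σ) (T : Fin n → BitStr m)
    (perm : Fin n → ℕ) (s : ℕ) :
    SimInv n q k m lam v pts vals s e cur (stageInput T perm s σ) where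
  params := h.params.stageInput T perm s
  seed := by
    rw [← h.seed]
    funext i; simp only [storedSeed, stageInput_of_ne T perm s i (a := 7) (by omega) (by omega)]
  sched := by
    rw [← h.sched]
    funext i; exact stageInput_of_ne T perm s i (by omega) (by omega)
  perm s' := by rw [stageInput_of_ne T perm s _ (by omega) (by omega), h.perm]
  points l hl := by
    rw [← h.points l hl]
    funext j
    simp only [storedPoint, stageInput_of_ne T perm s j (a := 20 + (l + l)) (by omega) (by omega)]
  values l hl := by
    rw [← h.values l hl]
    funext j
    simp only [storedValue, stageInput_of_ne T perm s j (a := 21 + (l + l)) (by omega) (by omega)]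
  cur := by rw [stageInput_of_ne T perm s _ (by omega) (by omega), h.cur]

variable [Fintype X] [DecidableEq X] [Fintype Z] [DecidableEq Z]
  [Fintype E] [DecidableEq E] {enc : X ↪ BitStr k} {A : OracleAlg X Z E m n q}

/-- The simulated run when the seed is `lam`, the schedule `v` and the outcomes are `pts`. -/
noncomputable def simRun (enc : X ↪ BitStr k) (A : OracleAlg X Z E m n q)
    (T : Fin n → BitStr m) (lam : ℕ → ZMod 2) (v : ℕ → ℕ) (pts : ℕ → BitStr k) :
    ℕ → (Mem X Z E m n → ℂ) × ℕ :=
  simPair enc A lam v pts (received T v) (choiceAmp n q k m • A.init)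

/-- The interaction after stage `s < n`. -/
structure StageInv (enc : X ↪ BitStr k) (A : OracleAlg X Z E m n q) (T : Fin n → BitStr m)
    (lam : ℕ → ZMod 2) (v : ℕ → ℕ) (pts : ℕ → BitStr k) (s : ℕ) (r : Interaction W k X Z E m n) :
    Prop where
  inv : SimInv n q k m lam v pts (received T v) s s (simRun enc A T lam v pts (s + 1)).2 r.cfg.mem
  vec : r.cfg.vec = embed W (simRun enc A T lam v pts (s + 1)).1
  out : ∀ i : Fin k, r.cfg.mem 2 i = if pts s i then 1 else 0
  perm : ∀ i, r.perm i = sortPerm n v i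
  outs : ∀ i : Fin n, (i : ℕ) ≤ s → r.outs i = pts i

theorem Holds.le {f : Choice n q k m} {lam : ℕ → ZMod 2} {v : ℕ → ℕ} (h : Holds f lam v) :
    ∀ j < n, v j ≤ 2 * q := fun j hj => by
  have := h.1 ⟨j, hj⟩
  have := (f.1 ⟨j, hj⟩).2
  simp only at *
  omega

/-- The interaction after stage `s` with outcome `d`. -/
def Interaction.next (s : ℕ) (r : Interaction W k X Z E m n) (d : Config W X Z E m n) :
    Interaction W k X Z E m n where
  cfg := d
  perm := if s = 0 then fun i => d.mem 1 i else r.perm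
  outs := fun i => if (i : ℕ) = s then fun j => decide (d.mem 2 j ≠ 0) else r.outs i

theorem runStage_eq {ι : Type} [Fintype ι] {S : Prog} {T : Fin n → BitStr m} {s : ℕ}
    {r : Interaction W k X Z E m n} {Q : ι → Store → Vec W X Z E m n → Prop}
    (h : Branches enc A S { r.cfg with mem := stageInput T r.perm s r.cfg.mem } Q) :
    ∃ g : ι → Config W X Z E m n,
      (runStage S enc A T s r : Multiset (Interaction W k X Z E m n)) =
        Finset.univ.val.map (fun i => r.next s (g i)) ∧ ∀ i, Q i (g i).mem (g i).vec := by
  obtain ⟨g, h1, h2⟩ := h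
  refine ⟨g, ?_, h2⟩
  have h3 : (runStage S enc A T s r : Multiset (Interaction W k X Z E m n)) =
      (S.exec enc A { r.cfg with mem := stageInput T r.perm s r.cfg.mem } :
        Multiset (Config W X Z E m n)).map (r.next s) := rfl
  rw [h3, h1, Multiset.map_map]
  rfl

/-- The branches are indexed by the random choices and the outcome `b`. The quantifier over `pts`
leaves the entries for the later stages open. -/
theorem stage_first (hn : 0 < n) (hW : 2 * q + n + 3 ≤ W)
    (hW' : 2 * q * (k + 1) + k + 1 ≤ W) (enc : X ↪ BitStr k) (A : OracleAlg X Z E m n q)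
    (T : Fin n → BitStr m) :
    ∃ g : Choice n q k m × BitStr k → Interaction W k X Z E m n,
      (runStages W simulator enc A T 1 : Multiset (Interaction W k X Z E m n)) =
        Finset.univ.val.map g ∧
      ∀ f b, ∃ lam v, Holds f lam v ∧ ∀ pts,
        StageInv enc A T lam v (Function.update pts 0 b) 0 (g (f, b)) := by
  set r := startInteraction W k A with hr
  set c : Config W X Z E m n := { r.cfg with mem := stageInput T r.perm 0 r.cfg.mem } with hc
  have hv : c.vec = embed W A.init := rfl
  have h4 : c.mem 0 4 = 0 := by simp [hc, stageInput]
  have main : Branches enc A simulator c fun (p : Choice n q k m × BitStr k) σ φ =>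
      ∃ lam v, Holds p.1 lam v ∧ ∀ pts vals, φ = embed W (simPair enc A lam v
          (Function.update pts 0 p.2) vals (choiceAmp n q k m • A.init) 1).1 ∧
        SimInv n q k m lam v (Function.update pts 0 p.2) vals 0 0
          (simPair enc A lam v (Function.update pts 0 p.2) vals (choiceAmp n q k m • A.init) 1).2 σ ∧
        ∀ i : Fin k, σ 2 i = if p.2 i then 1 else 0 := by
    refine Det.seq_branches (det_ite (fun _ => det_tablesProg (n := n) (q := q) (k := k) (m := m)
      (S := 0) c.tick ?_ ?_ ?_ ?_ h4 ?_ ?_ ?_) fun h => ?_) ?_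
    · simp [Config.tick, hc, hr, stageInput, startInteraction]
    · simp [Config.tick, hc, hr, stageInput, startInteraction]
    · simp [Config.tick, hc, hr, stageInput, startInteraction]
    · simp [Config.tick, hc, hr, stageInput, startInteraction]
    · simp [Config.tick, hc, hr, stageInput, startInteraction]
    · simp [Config.tick, hc, hr, stageInput, startInteraction]
    · simp [Config.tick, hc, hr, stageInput, startInteraction]
    · exact absurd (show c.mem 0 4 ≤ 0 by rw [h4]) h
    rintro c₁ ⟨v₁, p₁, f₁⟩
    have cur₁ : c₁.mem 9 0 = 0 := by
      rw [f₁ 9 0 (by omega) (by omega) (by omega) (by omega)]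
      simp [Config.tick, hc, hr, stageInput, startInteraction]
    refine Branches.seq (branches_ite (fun _ => branches_chooseProg c₁.tick p₁ cur₁) fun h => ?_) ?_
    · exact absurd (show c₁.mem 0 4 ≤ 0 by rw [p₁.hs]) h
    rintro f c₂ ⟨v₂, lam, v, hf, i₂⟩
    refine branches_ite (fun _ => ?_) fun h => ?_
    · have v₂' : c₂.tick.vec = embed W (choiceAmp n q k m • A.init) := by
        change c₂.vec = _
        rw [v₂]
        change _ • c₁.vec = _
        rw [v₁]
        change _ • c.vec = _
        rw [hv]
        funext s
        simp [embed]
      obtain ⟨g, h1, h2⟩ := branches_mainStage (enc := enc) (A := A) hn hf.le hW hW' c₂.tick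
        (i₂ (fun _ _ => false) (fun _ _ => false)) _ v₂'
      refine ⟨g, h1, fun b => ⟨lam, v, hf, fun pts vals => ?_⟩⟩
      obtain ⟨w₁, w₂, w₃⟩ := h2 b
      have e : simPair enc A lam v (Function.update pts 0 b) vals (choiceAmp n q k m • A.init) 1 =
          stageStep enc A (tableOracle enc q m lam 0 (fun _ _ => false) (fun _ _ => false))
            (v (sortPerm n v ⟨0, hn⟩)) (sortPerm n v ⟨0, hn⟩) b (choiceAmp n q k m • A.init, 0) := by
        -- With 0 reprogrammed points, neither points nor values enter the oracle.
        have e' : tableOracle enc q m lam 0 (Function.update pts 0 b) vals =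
            tableOracle enc q m lam 0 (fun _ _ => false) (fun _ _ => false) :=
          tableOracle_congr enc q m 0 lam (fun l hl => by omega) fun l hl => by omega
        simp [simPair, hn, e']
      rw [e]
      refine ⟨w₁, ⟨w₂.params, w₂.seed, w₂.sched, w₂.perm, fun l hl => by omega,
        fun l hl => by omega, w₂.cur⟩, w₃⟩
    · have i := i₂ (fun _ _ => false) (fun _ _ => false)
      have : (NExpr.add (param 4) (.lit 1)).eval c₂.mem ≤ (param 0).eval c₂.mem := by
        simp only [NExpr.eval, param, i.params.hs, i.params.hn]
        omega
      exact absurd this h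
  obtain ⟨g, h1, h2⟩ := runStage_eq main
  refine ⟨fun p => r.next 0 (g p), by simpa [runStages] using h1, fun f b => ?_⟩
  obtain ⟨lam, v, hf, H⟩ := h2 (f, b)
  refine ⟨lam, v, hf, fun pts => ?_⟩
  obtain ⟨w₁, w₂, w₃⟩ := H pts (received T v)
  refine ⟨w₂, w₁, fun i => ?_, fun i => ?_, fun i hi => ?_⟩
  · exact w₃ i
  · simpa [Interaction.next] using w₂.perm i
  · have hi0 : (i : ℕ) = 0 := by omega
    simp only [Interaction.next, hi0, if_true, Function.update_self]
    funext j
    rw [w₃ j]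
    by_cases hb : b j = true <;> simp [hb]

theorem received_eq (T : Fin n → BitStr m) (v : ℕ → ℕ) {perm : Fin n → ℕ}
    (hperm : ∀ i, perm i = sortPerm n v i) {s : ℕ} (hs : s < n) :
    reply T perm s = received T v s := by
  simp [reply, received, hs, hperm]

theorem stage_ready {T : Fin n → BitStr m} {s : ℕ} (hs : s < n) {r : Interaction W k X Z E m n}
    (h : StageInv enc A T lam v pts s r) :
    Det enc A (.seq (.ite (param 4) (.lit 0) tablesProg idle)
        (.ite (param 4) (.lit 0) chooseProg receiveProg))
      { r.cfg with mem := stageInput T r.perm (s + 1) r.cfg.mem } fun σ φ => φ = r.cfg.vec ∧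
        SimInv n q k m lam v pts (received T v) (s + 1) (s + 1)
          (simRun enc A T lam v pts (s + 1)).2 σ := by
  have i₁ := h.inv.stageInput T r.perm (s + 1)
  refine Det.seq (S := fun σ φ => φ = r.cfg.vec ∧
      σ = (stageInput T r.perm (s + 1) r.cfg.mem).write 19 0 0)
    (det_ite (fun hle => ?_) fun _ => det_assign ⟨rfl, rfl⟩) ?_
  · simp only [NExpr.eval, param, i₁.params.hs] at hle
    omega
  rintro c ⟨v₁, m₁⟩
  have f₁ : ∀ a i, a ≠ 19 → c.mem a i = stageInput T r.perm (s + 1) r.cfg.mem a i :=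
    fun a i ha => by rw [m₁, Store.write_apply, if_neg (by omega)]
  have i₂ := i₁.congr (fun a i ha => f₁ a i (by omega))
    ((f₁ 9 0 (by omega)).trans i₁.cur)
  refine det_ite (fun hle => ?_) fun _ =>
    (det_receiveProg c.tick i₂ (fun i => ?_) fun i => ?_).mono fun σ φ H => ⟨H.1.trans v₁, H.2⟩
  · simp only [NExpr.eval, param, i₂.params.hs] at hle
    omega
  · exact (f₁ 2 i (by omega)).trans
      ((stageInput_of_ne T r.perm (s + 1) _ (by omega) (by omega)).trans (h.out i))
  · refine (f₁ 3 i (by omega)).trans ?_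
    unfold MeasureReprogram.stageInput
    rw [if_neg (by omega), dif_pos ⟨rfl, i.2, by omega⟩]
    simp only [Nat.add_sub_cancel]
    rw [received_eq T v h.perm hs]

/-- Used to regroup the simulator as the preparations covered by `stage_ready`, followed by the
stage proper. -/
theorem exec_seq_assoc {P Q R : Prog} {c : Config W X Z E m n} :
    Prog.exec enc A (.seq P (.seq Q R)) c = Prog.exec enc A (.seq (.seq P Q) R) c := by
  simp only [Prog.exec, List.flatMap_assoc]

theorem stage_next {T : Fin n → BitStr m} {s : ℕ} (hs : s + 1 < n) (hW : 2 * q + n + 3 ≤ W)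
    (hW' : 2 * q * (k + 1) + k + 1 ≤ W) (hv : ∀ j < n, v j ≤ 2 * q)
    {r : Interaction W k X Z E m n} (h : StageInv enc A T lam v pts s r) :
    ∃ g : BitStr k → Interaction W k X Z E m n,
      (runStage simulator enc A T (s + 1) r : Multiset (Interaction W k X Z E m n)) =
        Finset.univ.val.map g ∧
      ∀ b, StageInv enc A T lam v (Function.update pts (s + 1) b) (s + 1) (g b) := by
  have sim : ∀ b, simRun enc A T lam v (Function.update pts (s + 1) b) (s + 1) =
      simRun enc A T lam v pts (s + 1) := fun b =>
    simPair_congr _ _ fun l hl => Function.update_of_ne (by omega) _ _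
  have main : Branches enc A simulator
      { r.cfg with mem := stageInput T r.perm (s + 1) r.cfg.mem } fun (b : BitStr k) σ φ =>
      φ = embed W (simRun enc A T lam v (Function.update pts (s + 1) b) (s + 2)).1 ∧
        SimInv n q k m lam v (Function.update pts (s + 1) b) (received T v) (s + 1) (s + 1)
          (simRun enc A T lam v (Function.update pts (s + 1) b) (s + 2)).2 σ ∧
        ∀ i : Fin k, σ 2 i = if b i then 1 else 0 := by
    have : Branches enc A (.seq (.seq (.ite (param 4) (.lit 0) tablesProg idle)
        (.ite (param 4) (.lit 0) chooseProg receiveProg))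
        (.ite (.add (param 4) (.lit 1)) (param 0) mainStage finalStage))
        { r.cfg with mem := stageInput T r.perm (s + 1) r.cfg.mem } fun (b : BitStr k) σ φ =>
        φ = embed W (simRun enc A T lam v (Function.update pts (s + 1) b) (s + 2)).1 ∧
          SimInv n q k m lam v (Function.update pts (s + 1) b) (received T v) (s + 1) (s + 1)
            (simRun enc A T lam v (Function.update pts (s + 1) b) (s + 2)).2 σ ∧
          ∀ i : Fin k, σ 2 i = if b i then 1 else 0 := by
      refine Det.seq_branches (stage_ready (by omega) h) ?_
      rintro c ⟨v₁, i₁⟩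
      refine branches_ite (fun _ => ?_) fun hle => ?_
      · refine (branches_mainStage hs hv hW hW' c.tick i₁ _ (v₁.trans h.vec)).mono ?_
        rintro b σ φ ⟨w₁, w₂, w₃⟩
        have e : simRun enc A T lam v (Function.update pts (s + 1) b) (s + 2) =
            stageStep enc A (tableOracle enc q m lam (s + 1) pts (received T v))
              (v (sortPerm n v ⟨s + 1, hs⟩)) (sortPerm n v ⟨s + 1, hs⟩) b
              (simRun enc A T lam v pts (s + 1)) := by
          have e' : tableOracle enc q m lam (s + 1) (Function.update pts (s + 1) b) (received T v) =
              tableOracle enc q m lam (s + 1) pts (received T v) :=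
            tableOracle_congr enc q m _ lam (fun l hl => Function.update_of_ne (by omega) _ _)
              fun _ _ => rfl
          have e2 := sim b
          unfold simRun at e2 ⊢
          rw [simPair, dif_pos hs, e', e2, Function.update_self]
        rw [e]
        refine ⟨w₁, ⟨w₂.params, w₂.seed, w₂.sched, w₂.perm, fun l hl => ?_, w₂.values, w₂.cur⟩, w₃⟩
        rw [w₂.points l hl, Function.update_of_ne (by omega)]
      · have : (NExpr.add (param 4) (.lit 1)).eval c.mem ≤ (param 0).eval c.mem := by
          simp only [NExpr.eval, param, i₁.params.hs, i₁.params.hn]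
          omega
        exact absurd this hle
    obtain ⟨g, h1, h2⟩ := this
    exact ⟨g, by rw [← h1]; exact congrArg _ exec_seq_assoc, h2⟩
  obtain ⟨g, h1, h2⟩ := runStage_eq main
  refine ⟨_, h1, fun b => ?_⟩
  obtain ⟨w₁, w₂, w₃⟩ := h2 b
  refine ⟨w₂, w₁, fun i => ?_, fun i => ?_, fun i hi => ?_⟩
  · rw [Function.update_self]
    exact w₃ i
  · exact h.perm i
  · by_cases hi' : (i : ℕ) = s + 1
    · simp only [Interaction.next, hi', if_true, Function.update_self]
      funext j
      rw [w₃ j]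
      by_cases hb : b j = true <;> simp [hb]
    · simp only [Interaction.next, hi', if_false]
      rw [h.outs i (by omega), Function.update_of_ne hi']

theorem stage_last {T : Fin n → BitStr m} {s : ℕ} (hs : s + 1 = n) (hW : 2 * q + n + 3 ≤ W)
    (hW' : 2 * q * (k + 1) + k + 1 ≤ W)
    {r : Interaction W k X Z E m n} (h : StageInv enc A T lam v pts s r) :
    ∃ r' : Interaction W k X Z E m n, runStage simulator enc A T (s + 1) r = [r'] ∧
      r'.perm = r.perm ∧ r'.outs = r.outs ∧
      r'.cfg.vec = embed W (advance A (tableOracle enc q m lam n pts (received T v))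
        (simRun enc A T lam v pts n).2 (q - (simRun enc A T lam v pts n).2)
        (simRun enc A T lam v pts n).1) := by
  have main : Det enc A simulator
      { r.cfg with mem := stageInput T r.perm (s + 1) r.cfg.mem } fun _ φ =>
      φ = embed W (advance A (tableOracle enc q m lam n pts (received T v))
        (simRun enc A T lam v pts n).2 (q - (simRun enc A T lam v pts n).2)
        (simRun enc A T lam v pts n).1) := by
    have : Det enc A (.seq (.seq (.ite (param 4) (.lit 0) tablesProg idle)
        (.ite (param 4) (.lit 0) chooseProg receiveProg))
        (.ite (.add (param 4) (.lit 1)) (param 0) mainStage finalStage))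
        { r.cfg with mem := stageInput T r.perm (s + 1) r.cfg.mem } fun _ φ =>
        φ = embed W (advance A (tableOracle enc q m lam n pts (received T v))
          (simRun enc A T lam v pts n).2 (q - (simRun enc A T lam v pts n).2)
          (simRun enc A T lam v pts n).1) := by
      refine Det.seq (stage_ready (by omega) h) ?_
      rintro c ⟨v₁, i₁⟩
      refine det_ite (fun hle => ?_) fun _ => ?_
      · simp only [NExpr.eval, param, i₁.params.hs, i₁.params.hn] at hle
        omega
      · rw [hs] at i₁
        refine det_finalStage hW hW' c.tick i₁ _ ?_
        exact (v₁.trans h.vec).trans (by simp only [hs])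
    obtain ⟨c', h1, h2⟩ := this
    exact ⟨c', by rw [← h1]; exact exec_seq_assoc, h2⟩
  obtain ⟨c', h1, h2⟩ := main
  refine ⟨r.next (s + 1) c', ?_, ?_, ?_, h2⟩
  · simp only [runStage, h1]
    rfl
  · simp [Interaction.next]
  · funext i
    simp only [Interaction.next]
    rw [if_neg (by have := i.2; omega)]

end

/-! ### Well-formedness and a lower bound for the simulation -/

theorem rank_congr {v w : ℕ → ℕ} {n j : ℕ} (h : ∀ i < n, v i = w i) (hj : j < n) :
    rank v n j = rank w n j := by
  unfold rank
  congr 1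
  refine Finset.filter_congr fun i hi => ?_
  rw [Precedes, Precedes, h i (Finset.mem_range.1 hi), h j hj]

theorem sortPerm_congr {v w : ℕ → ℕ} {n : ℕ} (h : ∀ i < n, v i = w i) :
    sortPerm n v = sortPerm n w := by
  ext s
  refine congrArg Fin.val (Fin.ext (rank_inj (v := w) (Fin.is_lt _) (Fin.is_lt _) ?_))
  rw [rank_sortPerm, ← rank_congr h (Fin.is_lt _), rank_sortPerm]

section
variable {W k m n q : ℕ} {X Z E : Type} {lam : ℕ → ZMod 2} {v : ℕ → ℕ} {pts : ℕ → BitStr k}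
  {vals : ℕ → BitStr m}
  [Fintype X] [DecidableEq X] [Fintype Z] [DecidableEq Z]
  [Fintype E] [DecidableEq E] {enc : X ↪ BitStr k} {A : OracleAlg X Z E m n q}

theorem stepQ_zero (A : OracleAlg X Z E m n q) (G : X → BitStr m) (i : ℕ) :
    stepQ A G i 0 = 0 := by
  unfold stepQ
  split_ifs
  · exact Matrix.mulVec_zero _
  · rfl

theorem advance_zero (A : OracleAlg X Z E m n q) (G : X → BitStr m) (i d : ℕ) :
    advance A G i d 0 = 0 := by
  induction d with
  | zero => rfl
  | succ d ih => rw [advance, ih, stepQ_zero]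

theorem embed_zero : embed W (0 : Mem X Z E m n → ℂ) = 0 := by
  funext s
  simp [embed]

/-- A nonzero vector after the projection of a stage has a basis state whose register encodes as the
outcome. Zero vectors stay zero, so a final vector that does not vanish vouches for all earlier
outcomes. -/
theorem exists_enc_eq {ψ : Mem X Z E m n → ℂ} {s : ℕ}
    (h : (simPair enc A lam v pts vals ψ s).1 ≠ 0) :
    ∀ l < s, l < n → ∃ x, pts l = enc x := by
  induction s with
  | zero => exact fun l hl => absurd hl (Nat.not_lt_zero _)
  | succ s ih =>
    intro l hl hln
    by_cases hs : s < n
    · rw [simPair, dif_pos hs, stageStep] at h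
      simp only at h
      set φ := advance A (tableOracle enc q m lam s pts vals) (simPair enc A lam v pts vals ψ s).2
        (v (sortPerm n v ⟨s, hs⟩) / 2 - (simPair enc A lam v pts vals ψ s).2)
        (simPair enc A lam v pts vals ψ s).1 with hφ
      have hp : projReg enc q (v (sortPerm n v ⟨s, hs⟩)) (sortPerm n v ⟨s, hs⟩) (pts s) φ ≠ 0 := by
        intro h0
        rw [h0, advance_zero] at h
        exact h rfl
      by_cases hls : l = s
      · subst hls
        obtain ⟨μ, hμ⟩ := Function.ne_iff.1 hp
        simp only [projReg, Pi.zero_apply, ne_eq, ite_eq_right_iff, Classical.not_imp] at hμ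
        exact ⟨_, hμ.1.symm⟩
      · refine ih (fun h0 => hp ?_) l (by omega) hln
        rw [hφ, h0, advance_zero]
        funext μ
        simp [projReg]
    · rw [simPair, dif_neg hs] at h
      exact ih h l (by omega) hln

theorem StageInv.announces_and_outputs {T : Fin n → BitStr m} {s : ℕ}
    {r : Interaction W k X Z E m n} (h : StageInv enc A T lam v pts s r)
    (hr : (simRun enc A T lam v pts (s + 1)).1 ≠ 0) :
    (∃ π, r.Announces π) ∧ ∀ i : Fin n, (i : ℕ) ≤ s → ∃ x, r.outs i = enc x := by
  refine ⟨⟨_, h.perm⟩, fun i hi => ?_⟩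
  rw [h.outs i hi]
  exact exists_enc_eq hr i (by omega) i.2

theorem exists_stageInv (hn : 0 < n) (hW : 2 * q + n + 3 ≤ W) (hW' : 2 * q * (k + 1) + k + 1 ≤ W)
    (enc : X ↪ BitStr k) (A : OracleAlg X Z E m n q) (T : Fin n → BitStr m) (s : ℕ) (hs : s < n) :
    ∀ r ∈ runStages W simulator enc A T (s + 1), ∃ (f : Choice n q k m) (lam : ℕ → ZMod 2)
      (v : ℕ → ℕ) (pts : ℕ → BitStr k), Holds f lam v ∧ StageInv enc A T lam v pts s r := by
  induction s with
  | zero =>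
    intro r hr
    obtain ⟨g, h1, h2⟩ := stage_first hn hW hW' enc A T
    rw [← Multiset.mem_coe, h1] at hr
    obtain ⟨⟨f, b⟩, -, rfl⟩ := Multiset.mem_map.1 hr
    obtain ⟨lam, v, hf, H⟩ := h2 f b
    exact ⟨f, lam, v, _, hf, H fun _ _ => false⟩
  | succ s ih =>
    intro r hr
    rw [runStages, List.mem_flatMap] at hr
    obtain ⟨r₁, hr₁, hr⟩ := hr
    obtain ⟨f, lam, v, pts, hf, h₁⟩ := ih (by omega) r₁ hr₁
    obtain ⟨g, h1, h2⟩ := stage_next hs hW hW' hf.le h₁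
    rw [← Multiset.mem_coe, h1] at hr
    obtain ⟨b, -, rfl⟩ := Multiset.mem_map.1 hr
    exact ⟨f, lam, v, _, hf, h2 b⟩

theorem simulator_wellFormed (hn : 0 < n) (hW : 2 * q + n + 3 ≤ W)
    (hW' : 2 * q * (k + 1) + k + 1 ≤ W) (enc : X ↪ BitStr k) (A : OracleAlg X Z E m n q) :
    WellFormed W simulator enc A := by
  intro T s hs r hr hv
  rcases Nat.lt_or_ge s n with hsn | hsn
  · obtain ⟨f, lam, v, pts, hf, h⟩ := exists_stageInv hn hW hW' enc A T s hsn r hr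
    refine h.announces_and_outputs fun h0 => hv ?_
    rw [h.vec, h0, embed_zero]
  · obtain ⟨s, rfl⟩ : ∃ s', s = s' + 1 := ⟨s - 1, by omega⟩
    rw [runStages, List.mem_flatMap] at hr
    obtain ⟨r₁, hr₁, hr⟩ := hr
    obtain ⟨f, lam, v, pts, hf, h⟩ := exists_stageInv hn hW hW' enc A T s (by omega) r₁ hr₁
    have hsn' : s + 1 = n := by omega
    obtain ⟨r', h1, h2, h3, h4⟩ := stage_last hsn' hW hW' h
    rw [h1, List.mem_singleton] at hr
    subst hr
    obtain ⟨⟨π, h5⟩, h6⟩ := h.announces_and_outputs fun h0 => hv <| by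
      rw [hsn'] at h0
      rw [h4, h0, advance_zero, embed_zero]
    exact ⟨⟨π, fun i => by rw [h2]; exact h5 i⟩, fun i hi => by
      rw [h3]
      exact h6 i (by omega)⟩

/-- The outcomes that lead to the output `xo`. -/
noncomputable def goodPts (enc : X ↪ BitStr k) (xo : Fin n → X) (v : ℕ → ℕ) (l : ℕ) : BitStr k :=
  if h : l < n then enc (xo (sortPerm n v ⟨l, h⟩)) else fun _ => false

theorem sum_map_flatMap {α β : Type} (L : List α) (f : α → List β) (F : β → ℝ) :
    ((L.flatMap f).map F).sum = (L.map fun a => ((f a).map F).sum).sum := by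
  induction L with
  | nil => rfl
  | cons a L ih => simp [ih]

theorem sum_map_of_eq {α ι : Type} [Fintype ι] {L : List α} {g : ι → α}
    (h : (L : Multiset α) = Finset.univ.val.map g) (F : α → ℝ) :
    (L.map F).sum = ∑ i, F (g i) := by
  have : ((L : Multiset α).map F).sum = (L.map F).sum := by simp
  rw [← this, h, Multiset.map_map]
  rfl

/-- For each random choice the one branch is kept in which all outcomes are the right points.
Dropping the other branches only decreases a sum of nonnegative terms. -/
theorem exists_good_stage (hn : 0 < n) (hW : 2 * q + n + 3 ≤ W)
    (hW' : 2 * q * (k + 1) + k + 1 ≤ W) (enc : X ↪ BitStr k) (A : OracleAlg X Z E m n q)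
    (T : Fin n → BitStr m) (xo : Fin n → X) (s : ℕ) (hs : s < n) :
    ∃ g : Choice n q k m → Interaction W k X Z E m n,
      (∀ F : Interaction W k X Z E m n → ℝ, (∀ r, 0 ≤ F r) →
        ∑ f, F (g f) ≤ ((runStages W simulator enc A T (s + 1)).map F).sum) ∧
      ∀ f, ∃ lam v, Holds f lam v ∧ StageInv enc A T lam v (goodPts enc xo v) s (g f) := by
  induction s with
  | zero =>
    obtain ⟨g, h1, h2⟩ := stage_first hn hW hW' enc A T
    -- The stored schedule is provided only after the outcome has been fixed, so the right outcome
    -- is first named through `f`. Both give the same permutation, which depends on the first `n`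
    -- entries only.
    set vOf : Choice n q k m → ℕ → ℕ := fun f j => if h : j < n then f.1 ⟨j, h⟩ else 0 with hvOf
    refine ⟨fun f => g (f, goodPts enc xo (vOf f) 0), fun F hF => ?_, fun f => ?_⟩
    · rw [sum_map_of_eq h1, Fintype.sum_prod_type (fun p => F (g p))]
      exact Finset.sum_le_sum fun f _ => Finset.single_le_sum (f := fun b => F (g (f, b)))
        (fun b _ => hF _) (Finset.mem_univ _)
    · obtain ⟨lam, v, hf, H⟩ := h2 f (goodPts enc xo (vOf f) 0)
      have e : goodPts enc xo (vOf f) = goodPts enc xo v := by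
        have : sortPerm n (vOf f) = sortPerm n v := sortPerm_congr fun i hi => by
          rw [hvOf, hf.1 ⟨i, hi⟩]
          simp [hi]
        funext l
        simp only [goodPts, this]
      simp only [e] at H ⊢
      have := H (goodPts enc xo v)
      rw [Function.update_eq_self] at this
      exact ⟨lam, v, hf, this⟩
  | succ s ih =>
    obtain ⟨g, h1, h2⟩ := ih (by omega)
    choose lam v hf h2 using h2
    choose g' h3 h4 using fun f => stage_next hs hW hW' (hf f).le (h2 f)
    refine ⟨fun f => g' f (goodPts enc xo (v f) (s + 1)), fun F hF => ?_, fun f => ?_⟩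
    · rw [runStages, sum_map_flatMap]
      refine le_trans (Finset.sum_le_sum fun f _ => ?_) (h1 _ fun r =>
        List.sum_nonneg fun x hx => ?_)
      · rw [sum_map_of_eq (h3 f)]
        exact Finset.single_le_sum (f := fun b => F (g' f b)) (fun b _ => hF _) (Finset.mem_univ _)
      · obtain ⟨r', -, rfl⟩ := List.mem_map.1 hx
        exact hF r'
    · have := h4 f (goodPts enc xo (v f) (s + 1))
      rw [Function.update_eq_self] at this
      exact ⟨lam f, v f, hf f, this⟩

theorem exists_good (hn : 0 < n) (hW : 2 * q + n + 3 ≤ W)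
    (hW' : 2 * q * (k + 1) + k + 1 ≤ W) (enc : X ↪ BitStr k) (A : OracleAlg X Z E m n q)
    (T : Fin n → BitStr m) (xo : Fin n → X) :
    ∃ g : Choice n q k m → Interaction W k X Z E m n,
      (∀ F : Interaction W k X Z E m n → ℝ, (∀ r, 0 ≤ F r) →
        ∑ f, F (g f) ≤ ((runStages W simulator enc A T (n + 1)).map F).sum) ∧
      ∀ f, (g f).Extracts enc xo ∧ ∃ lam v, Holds f lam v ∧
        (g f).cfg.vec = embed W (advance A
          (tableOracle enc q m lam n (goodPts enc xo v) (received T v))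
          (simRun enc A T lam v (goodPts enc xo v) n).2
          (q - (simRun enc A T lam v (goodPts enc xo v) n).2)
          (simRun enc A T lam v (goodPts enc xo v) n).1) := by
  obtain ⟨s, hs⟩ : ∃ s, s + 1 = n := ⟨n - 1, by omega⟩
  obtain ⟨g, h1, h2⟩ := exists_good_stage hn hW hW' enc A T xo s (by omega)
  choose lam v hf h2 using h2
  choose g' h3 h4 h5 h6 using fun f => stage_last hs hW hW' (h2 f)
  refine ⟨g', fun F hF => ?_, fun f => ⟨⟨sortPerm n (v f), fun i => ?_, fun i => ?_⟩,
    lam f, v f, hf f, h6 f⟩⟩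
  · rw [runStages, sum_map_flatMap]
    have := h1 (fun r => ((runStage simulator enc A T n r).map F).sum) fun r =>
      List.sum_nonneg fun x hx => by
        obtain ⟨r', -, rfl⟩ := List.mem_map.1 hx
        exact hF r'
    rw [hs] at this
    refine le_trans (le_of_eq ?_) this
    refine Finset.sum_congr rfl fun f _ => ?_
    have e := h3 f
    simp only [hs] at e
    rw [e]
    simp
  · rw [h4, (h2 f).perm]
  · rw [h5, (h2 f).outs i (by have := i.2; omega)]
    simp [goodPts]

end

/-! ### Measuring queries and reprogramming -/

section
variable {m n q : ℕ} {X Z E : Type} [Fintype X] [DecidableEq X] [Fintype Z] [DecidableEq Z]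
  [Fintype E] [DecidableEq E]

open scoped Classical in
/-- The oracle `G`, reprogrammed to `T j` at `xo j` for all `j ∈ S`. -/
noncomputable def patch (xo : Fin n → X) (T : Fin n → BitStr m) (G : X → BitStr m)
    (S : Finset (Fin n)) (x : X) : BitStr m :=
  if h : ∃ j ∈ S, xo j = x then T h.choose else G x

theorem patch_of_mem {xo : Fin n → X} (hxo : Function.Injective xo) (T : Fin n → BitStr m)
    (G : X → BitStr m) {S : Finset (Fin n)} {j : Fin n} (hj : j ∈ S) :
    patch xo T G S (xo j) = T j := by
  have h : ∃ i ∈ S, xo i = xo j := ⟨j, hj, rfl⟩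
  rw [patch, dif_pos h, hxo h.choose_spec.2]

theorem patch_of_forall_ne {xo : Fin n → X} (T : Fin n → BitStr m)
    (G : X → BitStr m) {S : Finset (Fin n)} {x : X} (hx : ∀ j ∈ S, xo j ≠ x) :
    patch xo T G S x = G x := by
  rw [patch, dif_neg]
  rintro ⟨j, hj, h⟩
  exact hx j hj h

/-- The inputs that are reprogrammed at query `i`, if input `j` is measured at query `a / 2` and
reprogrammed at query `(a + 1) / 2`, where `w j = some a`, or reprogrammed all the time, if
`w j = none`. -/
def activeSet (w : Fin n → Option ℕ) (i : ℕ) : Finset (Fin n) :=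
  Finset.univ.filter fun j => ∀ a ∈ w j, a ≤ 2 * i

/-- Projection to the states that query the right point, if there is a measurement. -/
def projQuery (xo : Fin n → X) (w : Fin n → Option ℕ) (i : ℕ) (ψ : Mem X Z E m n → ℂ) :
    Mem X Z E m n → ℂ :=
  fun μ => if ∀ j, ∀ a ∈ w j, a / 2 = i → μ.1.2.1 = xo j then ψ μ else 0

/-- The state after `i` queries in a run with measurements and reprogramming according to `w`. -/
noncomputable def modeState (A : OracleAlg X Z E m n q) (xo : Fin n → X) (T : Fin n → BitStr m)
    (G : X → BitStr m) (w : Fin n → Option ℕ) : ℕ → Mem X Z E m n → ℂ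
  | 0 => A.init
  | i + 1 => stepQ A (patch xo T G (activeSet w i)) i (projQuery xo w i (modeState A xo T G w i))

variable {A : OracleAlg X Z E m n q} {xo : Fin n → X} {T : Fin n → BitStr m} {G : X → BitStr m}

theorem modeState_none (i : ℕ) (hi : i ≤ q) :
    modeState A xo T G (fun _ => none) i = A.state (patch xo T G Finset.univ) i := by
  induction i with
  | zero => rfl
  | succ i ih =>
    have e1 : activeSet (fun _ : Fin n => (none : Option ℕ)) i = Finset.univ := by
      simp [activeSet]
    rw [modeState, OracleAlg.state, dif_pos (show i < q by omega), stepQ,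
      dif_pos (show i < q by omega), e1, ← ih (by omega)]
    congr 2
    funext μ
    simp [projQuery]

theorem modeState_congr {w w' : Fin n → Option ℕ} (i : ℕ)
    (hact : ∀ l < i, activeSet w l = activeSet w' l)
    (hpr : ∀ l < i, ∀ ψ : Mem X Z E m n → ℂ, projQuery xo w l ψ = projQuery xo w' l ψ) :
    modeState A xo T G w i = modeState A xo T G w' i := by
  induction i with
  | zero => rfl
  | succ i ih =>
    rw [modeState, modeState, hact i (by omega), hpr i (by omega),
      ih (fun l hl => hact l (by omega)) fun l hl => hpr l (by omega)]

theorem stepQ_sum (A : OracleAlg X Z E m n q) (G : X → BitStr m) (i : ℕ) (s : Finset ℕ)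
    (ε : ℕ → ℂ) (ψ : ℕ → Mem X Z E m n → ℂ) :
    stepQ A G i (∑ a ∈ s, ε a • ψ a) = ∑ a ∈ s, ε a • stepQ A G i (ψ a) := by
  unfold stepQ
  split_ifs with h
  · have : applyOracle G (∑ a ∈ s, ε a • ψ a) = ∑ a ∈ s, ε a • applyOracle G (ψ a) := by
      funext μ
      simp [applyOracle]
    rw [this, Matrix.mulVec_sum]
    exact Finset.sum_congr rfl fun a _ => Matrix.mulVec_smul _ _ _
  · rfl

theorem projQuery_sum (w : Fin n → Option ℕ) (i : ℕ) (s : Finset ℕ)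
    (ε : ℕ → ℂ) (ψ : ℕ → Mem X Z E m n → ℂ) :
    projQuery xo w i (∑ a ∈ s, ε a • ψ a) = ∑ a ∈ s, ε a • projQuery xo w i (ψ a) := by
  funext μ
  simp only [projQuery, Finset.sum_apply, Pi.smul_apply]
  split_ifs <;> simp

theorem stepQ_add (A : OracleAlg X Z E m n q) (G : X → BitStr m) (i : ℕ)
    (ψ φ : Mem X Z E m n → ℂ) : stepQ A G i (ψ + φ) = stepQ A G i ψ + stepQ A G i φ := by
  unfold stepQ
  split_ifs with h
  · rw [← Matrix.mulVec_add]
    rfl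
  · rfl

/-- Two oracles that agree on all queried points. -/
theorem stepQ_congr (A : OracleAlg X Z E m n q) {G G' : X → BitStr m} (i : ℕ)
    {ψ : Mem X Z E m n → ℂ} (h : ∀ μ, ψ μ ≠ 0 → G μ.1.2.1 = G' μ.1.2.1) :
    stepQ A G i ψ = stepQ A G' i ψ := by
  unfold stepQ
  split_ifs with hi
  · congr 1
    funext μ
    simp only [applyOracle]
    by_cases hμ : G μ.1.2.1 = G' μ.1.2.1
    · simp only [queryMap, hμ]
    · have h1 : ψ (queryMap G μ) = 0 := by
        by_contra h0
        exact hμ (h (queryMap G μ) h0)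
      have h2 : ψ (queryMap G' μ) = 0 := by
        by_contra h0
        exact hμ (h (queryMap G' μ) h0)
      rw [h1, h2]
  · rfl

theorem mem_activeSet {w : Fin n → Option ℕ} {i : ℕ} {j : Fin n} :
    j ∈ activeSet w i ↔ ∀ a ∈ w j, a ≤ 2 * i := by
  simp [activeSet]

theorem activeSet_update_congr (w : Fin n → Option ℕ) (j : Fin n) {o o' : Option ℕ} {i : ℕ}
    (h : (∀ a ∈ o, a ≤ 2 * i) ↔ ∀ a ∈ o', a ≤ 2 * i) :
    activeSet (Function.update w j o) i = activeSet (Function.update w j o') i := by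
  ext l
  rw [mem_activeSet, mem_activeSet]
  by_cases hl : l = j
  · subst hl
    rw [Function.update_self, Function.update_self]
    exact h
  · rw [Function.update_of_ne hl, Function.update_of_ne hl]

theorem projQuery_update (w : Fin n → Option ℕ) (j : Fin n) (o : Option ℕ) (i : ℕ)
    (ψ : Mem X Z E m n → ℂ) :
    projQuery xo (Function.update w j o) i ψ = fun μ =>
      if ∀ a ∈ o, a / 2 = i → μ.1.2.1 = xo j then
        projQuery xo (Function.update w j none) i ψ μ else 0 := by
  funext μ
  have e : (∀ l, ∀ a ∈ Function.update w j o l, a / 2 = i → μ.1.2.1 = xo l) ↔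
      (∀ a ∈ o, a / 2 = i → μ.1.2.1 = xo j) ∧
      ∀ l, ∀ a ∈ Function.update w j none l, a / 2 = i → μ.1.2.1 = xo l := by
    constructor
    · intro H
      refine ⟨by simpa using H j, fun l => ?_⟩
      by_cases hl : l = j
      · subst hl; simp
      · have := H l
        rwa [Function.update_of_ne hl] at this ⊢
    · rintro ⟨H1, H2⟩ l
      by_cases hl : l = j
      · subst hl; rwa [Function.update_self]
      · have := H2 l
        rwa [Function.update_of_ne hl] at this ⊢
  simp only [projQuery, e]
  exact ite_and _ _ _ _

theorem projQuery_update_of_ne (w : Fin n → Option ℕ) (j : Fin n) {a i : ℕ} (ha : a / 2 ≠ i)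
    (ψ : Mem X Z E m n → ℂ) :
    projQuery xo (Function.update w j (some a)) i ψ =
      projQuery xo (Function.update w j none) i ψ := by
  rw [projQuery_update w j (some a)]
  funext μ
  rw [if_pos]
  intro b hb h
  obtain rfl : a = b := by simpa using hb
  exact absurd h ha

/-- A run in which an input is reprogrammed all the time is an alternating sum of runs in which it
is measured first. -/
theorem modeState_eq_sum (w : Fin n → Option ℕ) (j : Fin n) (i : ℕ) :
    modeState A xo T G (Function.update w j none) i =
      ∑ a ∈ Finset.range (2 * i + 1),
        (-1 : ℂ) ^ a • modeState A xo T G (Function.update w j (some a)) i := by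
  induction i with
  | zero => simp [modeState]
  | succ i ih =>
    -- `S` and `R` are the active sets at query `i` with `j` active and with `j` inactive; they
    -- agree on all other inputs.
    set S := activeSet (Function.update w j none) i with hS
    have act : ∀ a, a ≤ 2 * i → activeSet (Function.update w j (some a)) i = S := fun a ha =>
      activeSet_update_congr w j (by simp [ha])
    set R := activeSet (Function.update w j (some (2 * i + 1))) i with hR
    have act' : activeSet (Function.update w j (some (2 * i + 2))) i = R :=
      activeSet_update_congr w j (by simp)
    -- The state before query `i` when `j` has been neither measured nor reprogrammed. It is common
    -- to all `a ≥ 2 * i`.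
    set φ := modeState A xo T G (Function.update w j (some (2 * i))) i with hφ
    have late : ∀ a, 2 * i ≤ a → modeState A xo T G (Function.update w j (some a)) i = φ :=
      fun a ha => modeState_congr i
        (fun l hl => activeSet_update_congr w j (by simp; omega))
        fun l hl ψ => by
          rw [projQuery_update_of_ne w j (show a / 2 ≠ l by omega),
            projQuery_update_of_ne w j (show 2 * i / 2 ≠ l by omega)]
    set D : (Mem X Z E m n → ℂ) → Mem X Z E m n → ℂ :=
      projQuery xo (Function.update w j none) i with hD
    have early : ∀ a, a < 2 * i → modeState A xo T G (Function.update w j (some a)) (i + 1) =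
        stepQ A (patch xo T G S) i
          (D (modeState A xo T G (Function.update w j (some a)) i)) := fun a ha => by
      rw [modeState, act a ha.le, projQuery_update_of_ne w j (show a / 2 ≠ i by omega)]
    -- The part of the state that queries `xo j`, and the rest.
    set φ₁ : Mem X Z E m n → ℂ := fun μ => if μ.1.2.1 = xo j then D φ μ else 0 with hφ₁
    set φ₂ : Mem X Z E m n → ℂ := fun μ => if μ.1.2.1 = xo j then 0 else D φ μ with hφ₂
    have split : D φ = φ₁ + φ₂ := by
      funext μ
      simp only [hφ₁, hφ₂, Pi.add_apply]
      split_ifs <;> simp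
    have meas : ∀ a, a / 2 = i → projQuery xo (Function.update w j (some a)) i φ = φ₁ := by
      intro a ha
      rw [projQuery_update w j (some a)]
      funext μ
      simp only [hφ₁]
      refine if_congr ?_ rfl rfl
      simp [ha]
    have e0 : modeState A xo T G (Function.update w j (some (2 * i))) (i + 1) =
        stepQ A (patch xo T G S) i φ₁ := by
      rw [modeState, act _ le_rfl, meas _ (by omega)]
    have e1 : modeState A xo T G (Function.update w j (some (2 * i + 1))) (i + 1) =
        stepQ A (patch xo T G R) i φ₁ := by
      rw [modeState, late _ (by omega), meas _ (by omega)]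
    have e2 : modeState A xo T G (Function.update w j (some (2 * i + 2))) (i + 1) =
        stepQ A (patch xo T G R) i (φ₁ + φ₂) := by
      rw [modeState, late _ (by omega), act',
        projQuery_update_of_ne w j (show (2 * i + 2) / 2 ≠ i by omega), ← split]
    -- The heart of the induction: away from `xo j` it makes no difference whether the oracle is
    -- reprogrammed there.
    have e3 : stepQ A (patch xo T G S) i φ₂ = stepQ A (patch xo T G R) i φ₂ := by
      refine stepQ_congr A i fun μ hμ => ?_
      have hx : μ.1.2.1 ≠ xo j := by
        intro h
        simp [hφ₂, h] at hμ
      have hSR : ∀ l, l ≠ j → (l ∈ S ↔ l ∈ R) := fun l hl => by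
        rw [hS, hR, mem_activeSet, mem_activeSet, Function.update_of_ne hl,
          Function.update_of_ne hl]
      have e : ∀ l, (l ∈ S ∧ xo l = μ.1.2.1) = (l ∈ R ∧ xo l = μ.1.2.1) := fun l => by
        by_cases hl : l = j
        · subst hl
          simp [hx.symm]
        · simp only [hSR l hl]
      unfold patch
      simp only [e]
    have e4 : modeState A xo T G (Function.update w j none) (i + 1) =
        (∑ a ∈ Finset.range (2 * i), (-1 : ℂ) ^ a •
          modeState A xo T G (Function.update w j (some a)) (i + 1)) +
          stepQ A (patch xo T G S) i (D φ) := by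
      rw [modeState, ← hS, ih]
      change stepQ A _ i (D _) = _
      rw [hD, projQuery_sum, stepQ_sum, Finset.sum_range_succ]
      congr 1
      · exact Finset.sum_congr rfl fun a ha => by rw [early a (Finset.mem_range.1 ha)]
      · rw [Even.neg_one_pow (even_two_mul i), one_smul]
    -- With `U_S`, `U_R` for the two reprogrammed steps, `U_S (φ₁ + φ₂) = U_S φ₁ - U_R φ₁ + U_R (φ₁
    -- + φ₂)` because `U_S φ₂ = U_R φ₂`. The three terms on the right are the runs `2i`, `2i + 1`
    -- and `2i + 2`; the runs with `a < 2i` advance unchanged.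
    rw [e4, show 2 * (i + 1) + 1 = 2 * i + 1 + 1 + 1 by ring, Finset.sum_range_succ,
      Finset.sum_range_succ, Finset.sum_range_succ, e0, e1, e2, split, stepQ_add, stepQ_add, e3,
      show 2 * i + 1 + 1 = 2 * (i + 1) by ring,
      Even.neg_one_pow (even_two_mul i), Even.neg_one_pow (even_two_mul (i + 1)), pow_succ,
      Even.neg_one_pow (even_two_mul i)]
    simp only [one_mul, neg_smul, one_smul]
    abel

/-- The probability to obtain `xo` from the output registers and to be accepted by `P`. -/
noncomputable def outWeight (xo : Fin n → X) (P : Matrix Z Z ℂ) (ψ : Mem X Z E m n → ℂ) : ℝ :=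
  ∑ c : Bool, ∑ x : X, ∑ y : BitStr m, ∑ e : E,
    predWeight P fun z => ψ ((c, x, y), (xo, z, e))

/-- Triangle inequality and Cauchy–Schwarz in each coordinate; the signs in the alternating sum have
absolute value 1 and drop out. -/
theorem predWeight_sum_le (P : Matrix Z Z ℂ) (s : Finset ℕ) (ε : ℕ → ℂ) (hε : ∀ a, ‖ε a‖ = 1)
    (v : ℕ → Z → ℂ) :
    predWeight P (∑ a ∈ s, ε a • v a) ≤ s.card * ∑ a ∈ s, predWeight P (v a) := by
  simp only [predWeight]
  rw [Finset.sum_comm, Finset.mul_sum]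
  refine Finset.sum_le_sum fun z _ => ?_
  have e : (P.mulVec (∑ a ∈ s, ε a • v a)) z = ∑ a ∈ s, ε a * (P.mulVec (v a)) z := by
    rw [Matrix.mulVec_sum, Finset.sum_apply]
    exact Finset.sum_congr rfl fun a _ => by rw [Matrix.mulVec_smul]; rfl
  rw [e]
  calc ‖∑ a ∈ s, ε a * (P.mulVec (v a)) z‖ ^ 2 ≤ (∑ a ∈ s, ‖(P.mulVec (v a)) z‖) ^ 2 := by
        gcongr
        refine (norm_sum_le _ _).trans (le_of_eq ?_)
        exact Finset.sum_congr rfl fun a _ => by rw [norm_mul, hε, one_mul]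
    _ ≤ _ := sq_sum_le_card_mul_sum_sq

theorem outWeight_sum_le (P : Matrix Z Z ℂ) (s : Finset ℕ) (ε : ℕ → ℂ) (hε : ∀ a, ‖ε a‖ = 1)
    (ψ : ℕ → Mem X Z E m n → ℂ) :
    outWeight xo P (∑ a ∈ s, ε a • ψ a) ≤ s.card * ∑ a ∈ s, outWeight xo P (ψ a) := by
  have e : (s.card : ℝ) * ∑ a ∈ s, outWeight xo P (ψ a) =
      ∑ c : Bool, ∑ x : X, ∑ y : BitStr m, ∑ e : E, (s.card : ℝ) *
        ∑ a ∈ s, predWeight P fun z => ψ a ((c, x, y), (xo, z, e)) := by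
    simp only [outWeight, Finset.mul_sum]
    rw [Finset.sum_comm]
    refine Finset.sum_congr rfl fun c _ => ?_
    rw [Finset.sum_comm]
    refine Finset.sum_congr rfl fun x _ => ?_
    rw [Finset.sum_comm]
    refine Finset.sum_congr rfl fun y _ => ?_
    rw [Finset.sum_comm]
  rw [e]
  refine Finset.sum_le_sum fun c _ => Finset.sum_le_sum fun x _ => Finset.sum_le_sum fun y _ =>
    Finset.sum_le_sum fun e _ => ?_
  refine le_trans (le_of_eq ?_) (predWeight_sum_le P s ε hε _)
  congr 1
  funext z
  simp

/-- A function of modes that grows at most by the factor `M` when a `none` is replaced by all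
elements of `{0, …, M - 1}`. -/
theorem le_sum_of_update (M n : ℕ) (F : (Fin n → Option ℕ) → ℝ)
    (hF : ∀ w j, F (Function.update w j none) ≤
      M * ∑ a : Fin M, F (Function.update w j (some a))) :
    F (fun _ => none) ≤ (M : ℝ) ^ n * ∑ v : Fin n → Fin M, F fun j => some (v j) := by
  induction n with
  | zero =>
    rw [pow_zero, one_mul, Fintype.sum_unique]
    exact le_of_eq (congrArg F (Subsingleton.elim _ _))
  | succ n ih =>
    have h0 : ∀ (o o' : Option ℕ) (w : Fin n → Option ℕ), Function.update
        (Fin.cons o w : Fin (n + 1) → Option ℕ) 0 o' = Fin.cons o' w := fun o o' w =>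
      Fin.update_cons_zero _ _ _
    have h1 := hF (Fin.cons none fun _ => none) 0
    simp only [h0] at h1
    have e : (Fin.cons none fun _ => none : Fin (n + 1) → Option ℕ) = fun _ => none := by
      funext j
      refine Fin.cases rfl (fun j => rfl) j
    rw [e] at h1
    refine h1.trans ?_
    rw [pow_succ', mul_assoc]
    refine mul_le_mul_of_nonneg_left ?_ (Nat.cast_nonneg _)
    rw [← (Fin.consEquiv fun _ => Fin M).sum_comp, Fintype.sum_prod_type, Finset.mul_sum]
    refine Finset.sum_le_sum fun a _ => ?_
    refine (ih (fun w => F (Fin.cons (some (a : ℕ)) w)) fun w j => ?_).trans (le_of_eq ?_)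
    · have := hF (Fin.cons (some (a : ℕ)) w) j.succ
      simpa only [Fin.cons_update] using this
    · congr 1
      refine Finset.sum_congr rfl fun v _ => congrArg F ?_
      funext j
      refine Fin.cases rfl (fun j => rfl) j

/-- Every input that is expanded by `modeState_eq_sum` costs one factor `2q + 1`. This is half of
the loss in the theorem; the other half is the probability of the schedule. -/
theorem outWeight_le_sum_modes (A : OracleAlg X Z E m n q) (xo : Fin n → X)
    (T : Fin n → BitStr m) (G : X → BitStr m) (P : Matrix Z Z ℂ) :
    outWeight xo P (A.state (patch xo T G Finset.univ) q) ≤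
      ((2 * q + 1 : ℕ) : ℝ) ^ n * ∑ v : Fin n → Fin (2 * q + 1),
        outWeight xo P (modeState A xo T G (fun j => some (v j : ℕ)) q) := by
  rw [← modeState_none q le_rfl]
  refine le_sum_of_update (2 * q + 1) n
    (fun w => outWeight xo P (modeState A xo T G w q)) fun w j => ?_
  have h := outWeight_sum_le (xo := xo) P (Finset.range (2 * q + 1)) (fun a => (-1 : ℂ) ^ a)
    (fun a => by simp) fun a => modeState A xo T G (Function.update w j (some a)) q
  rw [← modeState_eq_sum, Finset.card_range, Finset.sum_range] at h
  exact h

end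

/-! ### The simulated runs and the runs with reprogramming -/

section
variable {k m n q : ℕ} {X Z E : Type} {lam : ℕ → ZMod 2} {v : ℕ → ℕ}

/-- The hash function with seed `lam`. -/
noncomputable def hashOracle (enc : X ↪ BitStr k) (q m : ℕ) (lam : ℕ → ZMod 2) : X → BitStr m :=
  fun x j => decide (hashBit lam (2 * q) (2 * q * (k + 1)) j (enc x) = 1)

/-- The inputs that are output in the first `s` stages. -/
noncomputable def doneSet (n : ℕ) (v : ℕ → ℕ) (s : ℕ) : Finset (Fin n) :=
  Finset.univ.filter fun j => ((sortPerm n v).symm j : ℕ) < s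

theorem mem_doneSet {s : ℕ} {j : Fin n} :
    j ∈ doneSet n v s ↔ ((sortPerm n v).symm j : ℕ) < s := by
  simp [doneSet]

theorem doneSet_succ {s : ℕ} (hs : s < n) :
    doneSet n v (s + 1) = insert (sortPerm n v ⟨s, hs⟩) (doneSet n v s) := by
  ext j
  rw [Finset.mem_insert, mem_doneSet, mem_doneSet, ← Equiv.symm_apply_eq, Fin.ext_iff]
  simp only
  omega

theorem le_of_mem_doneSet {s : ℕ} (hs : s < n) {j : Fin n} (hj : j ∈ doneSet n v s) :
    v j ≤ v (sortPerm n v ⟨s, hs⟩) := by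
  have := sortPerm_mono v (s := (sortPerm n v).symm j) (t := ⟨s, hs⟩)
    (Fin.le_def.2 (mem_doneSet.1 hj).le)
  rwa [Equiv.apply_symm_apply] at this

theorem le_of_notMem_doneSet {s : ℕ} (hs : s < n) {j : Fin n} (hj : j ∉ doneSet n v s) :
    v (sortPerm n v ⟨s, hs⟩) ≤ v j := by
  have := sortPerm_mono v (s := ⟨s, hs⟩) (t := (sortPerm n v).symm j)
    (Fin.le_def.2 (not_lt.1 fun h => hj (mem_doneSet.2 h)))
  rwa [Equiv.apply_symm_apply] at this

/-- With the right outcomes the stored points are distinct, so the number of matches is 0 or 1, and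
the arithmetic over the two-element field really selects between hash value and stored value. -/
theorem tableOracle_goodPts [Fintype X] [DecidableEq X] (enc : X ↪ BitStr k) {xo : Fin n → X} (hxo : Function.Injective xo)
    (T : Fin n → BitStr m) {s : ℕ} (hs : s ≤ n) :
    tableOracle enc q m lam s (goodPts enc xo v) (received T v) =
      patch xo T (hashOracle enc q m lam) (doneSet n v s) := by
  funext x b
  have hpt : ∀ l < s, ∀ j, (enc (xo j) = goodPts enc xo v l ↔ l = (sortPerm n v).symm j) := by
    intro l hl j
    rw [goodPts, dif_pos (show l < n by omega), enc.injective.eq_iff, hxo.eq_iff,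
      ← Equiv.symm_apply_eq, Fin.ext_iff]
    exact eq_comm
  by_cases hx : ∃ j ∈ doneSet n v s, xo j = x
  · obtain ⟨j, hj, rfl⟩ := hx
    have hl := mem_doneSet.1 hj
    rw [patch_of_mem hxo T _ hj]
    have e1 : ∑ l ∈ Finset.range s, (if enc (xo j) = goodPts enc xo v l then (1 : ZMod 2) else 0) =
        1 := by
      rw [Finset.sum_congr rfl fun l hl => if_congr (hpt l (Finset.mem_range.1 hl) j) rfl rfl,
        Finset.sum_ite_eq', if_pos (Finset.mem_range.2 hl)]
    have e2 : ∑ l ∈ Finset.range s, (if enc (xo j) = goodPts enc xo v l then (1 : ZMod 2) else 0) *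
        bitAt (received T v l) b = bitAt (T j) b := by
      rw [Finset.sum_congr rfl fun l hl => by
        rw [if_congr (hpt l (Finset.mem_range.1 hl) j) rfl rfl, ite_mul, one_mul, zero_mul],
        Finset.sum_ite_eq', if_pos (Finset.mem_range.2 hl), received, dif_pos (Fin.is_lt _)]
      simp
    have h2 : (1 : ZMod 2) + 1 = 0 := by decide
    simp only [tableOracle, e1, e2, h2, zero_mul, zero_add]
    simp [bitAt]
  · push Not at hx
    rw [patch_of_forall_ne T _ hx]
    have e0 : ∀ l ∈ Finset.range s, ¬ enc x = goodPts enc xo v l := by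
      intro l hl h
      rw [goodPts, dif_pos (show l < n by have := Finset.mem_range.1 hl; omega)] at h
      refine hx _ (mem_doneSet.2 ?_) (enc.injective h).symm
      rw [Equiv.symm_apply_apply]
      exact Finset.mem_range.1 hl
    have e1 : ∑ l ∈ Finset.range s, (if enc x = goodPts enc xo v l then (1 : ZMod 2) else 0) =
        0 := Finset.sum_eq_zero fun l hl => if_neg (e0 l hl)
    have e2 : ∑ l ∈ Finset.range s, (if enc x = goodPts enc xo v l then (1 : ZMod 2) else 0) *
        bitAt (received T v l) b = 0 := Finset.sum_eq_zero fun l hl => by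
      rw [if_neg (e0 l hl), zero_mul]
    simp only [tableOracle, e1, e2, add_zero, one_mul, hashOracle]

variable [Fintype X] [DecidableEq X] [Fintype Z] [DecidableEq Z]
  [Fintype E] [DecidableEq E] {enc : X ↪ BitStr k} {A : OracleAlg X Z E m n q}
  {xo : Fin n → X} {T : Fin n → BitStr m} {G : X → BitStr m}

theorem stepQ_smul (A : OracleAlg X Z E m n q) (G : X → BitStr m) (i : ℕ) (a : ℂ)
    (ψ : Mem X Z E m n → ℂ) : stepQ A G i (a • ψ) = a • stepQ A G i ψ := by
  have := stepQ_sum A G i {0} (fun _ => a) fun _ => ψ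
  simpa using this

/-- Projection to the states in which the registers that are measured after `c` queries hold the
right points, for the inputs in `P`. -/
def projDone (q : ℕ) (xo : Fin n → X) (v : ℕ → ℕ) (P : Finset (Fin n)) (c : ℕ)
    (ψ : Mem X Z E m n → ℂ) : Mem X Z E m n → ℂ :=
  fun μ => if ∀ j ∈ P, v j / 2 = c → measuredReg q (v j) j μ = xo j then ψ μ else 0

theorem projDone_of_forall_ne (xo : Fin n → X) (v : ℕ → ℕ) {P : Finset (Fin n)} {c : ℕ}
    (h : ∀ j ∈ P, v j / 2 ≠ c) (ψ : Mem X Z E m n → ℂ) : projDone q xo v P c ψ = ψ :=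
  funext fun _ => if_pos fun j hj hc => absurd hc (h j hj)

/-- While the active set is constant, queries to one fixed oracle follow `modeState`. The simulator
projects before it makes the measured query, whereas `modeState` projects as part of that query;
`projDone` accounts for the projections that are due at the current query and is absorbed by
`projQuery` in the next step. -/
theorem advance_modeState (a : ℂ) {c d : ℕ} (hd : c + d ≤ q) (P R : Finset (Fin n))
    (hP : ∀ j ∈ P, v j / 2 ≤ c)
    (hR : ∀ i, c ≤ i → i < c + d → activeSet (fun j : Fin n => some (v j)) i = R)
    (hD : ∀ i, c ≤ i → i < c + d → ∀ j : Fin n, v j / 2 = i → j ∈ P) :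
    advance A (patch xo T G R) c d
        (a • projDone q xo v P c (modeState A xo T G (fun j => some (v j)) c)) =
      a • projDone q xo v P (c + d) (modeState A xo T G (fun j => some (v j)) (c + d)) := by
  induction d with
  | zero => rfl
  | succ d ih =>
    rw [advance, ih (by omega) (fun i h1 h2 => hR i h1 (by omega))
      fun i h1 h2 => hD i h1 (by omega), stepQ_smul]
    rw [projDone_of_forall_ne xo v (P := P) (c := c + (d + 1))
      fun j hj h => by have := hP j hj; omega]
    rw [← add_assoc, modeState, hR _ (by omega) (by omega)]
    congr 2
    funext μ
    simp only [projDone, projQuery]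
    refine if_congr ⟨fun H j b hb h => ?_, fun H j hj h => ?_⟩ rfl rfl
    · obtain rfl : v j = b := by simpa using hb
      have := H j (hD _ (by omega) (by omega) j h) h
      rwa [measuredReg, if_pos (by omega)] at this
    · rw [measuredReg, if_pos (by omega)]
      exact H j (v j) (by simp) h

theorem projReg_projDone {c : ℕ} {j : Fin n} (hj : v j / 2 = c) (P : Finset (Fin n)) (a : ℂ)
    (ψ : Mem X Z E m n → ℂ) :
    projReg enc q (v j) j (enc (xo j)) (a • projDone q xo v P c ψ) =
      a • projDone q xo v (insert j P) c ψ := by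
  funext μ
  simp only [projReg, projDone, Pi.smul_apply, Finset.forall_mem_insert, enc.injective.eq_iff,
    hj, true_imp_iff]
  by_cases h : measuredReg q (v j) j μ = xo j <;> simp [h]

/-- Invariant of the run with the right outcomes, when no two inputs share a measured query before
the end. By sortedness the inputs already handled are exactly those that are active from now on, and
the others are due at the current query or later; so each stage uses the oracle that `modeState`
prescribes. -/
theorem simRun_eq (hxo : Function.Injective xo) (hv : ∀ j : Fin n, v j ≤ 2 * q)
    (hnc : ∀ i j : Fin n, i ≠ j → v i / 2 = v j / 2 → q ≤ v i / 2) (s : ℕ) (hs : s ≤ n) :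
    (simRun enc A T lam v (goodPts enc xo v) s).2 ≤ q ∧
    (∀ j ∈ doneSet n v s, v j ≤ 2 * (simRun enc A T lam v (goodPts enc xo v) s).2) ∧
    (∀ j ∉ doneSet n v s, (simRun enc A T lam v (goodPts enc xo v) s).2 ≤ v j / 2) ∧
    (simRun enc A T lam v (goodPts enc xo v) s).1 = choiceAmp n q k m • projDone q xo v
      (doneSet n v s) (simRun enc A T lam v (goodPts enc xo v) s).2
      (modeState A xo T (hashOracle enc q m lam) (fun j => some (v j))
        (simRun enc A T lam v (goodPts enc xo v) s).2) := by
  induction s with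
  | zero =>
    have h0 : doneSet n v 0 = ∅ := by simp [doneSet]
    refine ⟨Nat.zero_le _, by simp [h0], fun j _ => Nat.zero_le _, ?_⟩
    rw [projDone_of_forall_ne xo v (by simp [h0])]
    rfl
  | succ s ih =>
    obtain ⟨hc, hdone, hrest, hψ⟩ := ih (by omega)
    have hsn : s < n := by omega
    set p := simRun enc A T lam v (goodPts enc xo v) s with hp
    set j := sortPerm n v ⟨s, hsn⟩ with hj
    have hj' : j ∉ doneSet n v s := by
      rw [mem_doneSet, hj, Equiv.symm_apply_apply]
      exact lt_irrefl _
    have hcj := hrest j hj'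
    have hvj := hv j
    have e : simRun enc A T lam v (goodPts enc xo v) (s + 1) = stageStep enc A
        (patch xo T (hashOracle enc q m lam) (doneSet n v s)) (v j) j (enc (xo j)) p := by
      rw [← tableOracle_goodPts enc hxo T hsn.le]
      unfold simRun
      rw [simPair, dif_pos hsn]
      congr 1
      rw [goodPts, dif_pos hsn]
    -- The queries up to the measurement of `j`: the inputs already handled are active, and all
    -- others come at `v j` or later.
    have a1 := advance_modeState (A := A) (xo := xo) (T := T) (G := hashOracle enc q m lam)
      (v := v) (choiceAmp n q k m) (c := p.2) (d := v j / 2 - p.2) (by omega) (doneSet n v s)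
      (doneSet n v s) (fun i hi => by have := hdone i hi; omega)
      (fun i h1 h2 => by
        ext l
        rw [mem_activeSet]
        refine ⟨fun H => by_contra fun hl => ?_, fun hl b hb => ?_⟩
        · have := H (v l) (by simp)
          have : v j ≤ v l := le_of_notMem_doneSet hsn hl
          omega
        · obtain rfl : v l = b := by simpa using hb
          have := hdone l hl
          omega)
      (fun i h1 h2 l hl => by_contra fun hl' => by
        have : v j ≤ v l := le_of_notMem_doneSet hsn hl'
        have : v j / 2 ≤ v l / 2 := Nat.div_le_div_right this
        omega)
    have hc' : p.2 + (v j / 2 - p.2) = v j / 2 := by omega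
    rw [hc', ← hψ] at a1
    -- The query after the measurement, made only if `v j` is odd. It carries out the projection for
    -- `j`, but `j` is not active yet.
    have a2 := advance_modeState (A := A) (xo := xo) (T := T) (G := hashOracle enc q m lam)
      (v := v) (choiceAmp n q k m) (c := v j / 2) (d := (v j + 1) / 2 - v j / 2) (by omega)
      (doneSet n v (s + 1)) (doneSet n v s)
      (fun i hi => by
        rw [doneSet_succ hsn, Finset.mem_insert] at hi
        rcases hi with rfl | hi
        · exact le_rfl
        · exact Nat.div_le_div_right (le_of_mem_doneSet hsn hi))
      (fun i h1 h2 => by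
        ext l
        rw [mem_activeSet]
        refine ⟨fun H => by_contra fun hl => ?_, fun hl b hb => ?_⟩
        · have := H (v l) (by simp)
          have : v j ≤ v l := le_of_notMem_doneSet hsn hl
          omega
        · obtain rfl : v l = b := by simpa using hb
          have h3 : v l ≤ v j := le_of_mem_doneSet hsn hl
          -- An input `l` handled before with `v l / 2 = v j / 2` would force `v j = 2q`, an even
          -- number, and then there is no such query.
          have h4 := hnc l j fun h => hj' (h ▸ hl)
          omega)
      (fun i h1 h2 l hl => by_contra fun hl' => by
        have h3 : v l / 2 = v j / 2 → q ≤ v l / 2 := hnc l j fun h => hl' (by rw [h, doneSet_succ hsn]; exact Finset.mem_insert_self _ _)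
        omega)
    have hc'' : v j / 2 + ((v j + 1) / 2 - v j / 2) = (v j + 1) / 2 := by omega
    rw [hc''] at a2
    have e1 : (simRun enc A T lam v (goodPts enc xo v) (s + 1)).2 = (v j + 1) / 2 := by
      rw [e, stageStep]
      simp only
      omega
    have e2 : (simRun enc A T lam v (goodPts enc xo v) (s + 1)).1 = choiceAmp n q k m •
        projDone q xo v (doneSet n v (s + 1)) ((v j + 1) / 2)
          (modeState A xo T (hashOracle enc q m lam) (fun j => some (v j)) ((v j + 1) / 2)) := by
      rw [e, stageStep]
      simp only
      rw [hc', a1, projReg_projDone rfl, ← doneSet_succ hsn, a2]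
    rw [e1]
    refine ⟨by omega, fun l hl => ?_, fun l hl => ?_, e2⟩
    · rw [doneSet_succ hsn, Finset.mem_insert] at hl
      rcases hl with hl | hl
      · have : v l = v j := by rw [hl]
        omega
      · have : v l ≤ v j := le_of_mem_doneSet hsn hl
        omega
    · rw [doneSet_succ hsn, Finset.mem_insert, not_or] at hl
      have h3 : v j ≤ v l := le_of_notMem_doneSet hsn hl.2
      have h4 := hnc l j hl.1
      omega

/-- The projections for `i` and `j` at the same query require the query input to be two different
points. -/
theorem modeState_eq_zero (hxo : Function.Injective xo) {i j : Fin n} (hij : i ≠ j)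
    (h : v i / 2 = v j / 2) (hq : v i / 2 < q) :
    modeState A xo T G (fun j => some (v j)) q = 0 := by
  have key : ∀ d, modeState A xo T G (fun j => some (v j)) (v i / 2 + 1 + d) = 0 := by
    intro d
    induction d with
    | zero =>
      rw [add_zero, modeState]
      have : ∀ ψ : Mem X Z E m n → ℂ, projQuery xo (fun j => some (v j)) (v i / 2) ψ = 0 := by
        intro ψ
        funext μ
        refine if_neg fun H => hij (hxo ?_)
        rw [← H i (v i) rfl rfl, ← H j (v j) rfl h.symm]
      rw [this, stepQ_zero]
    | succ d ih =>
      rw [← add_assoc, modeState, ih]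
      have : ∀ i, projQuery xo (fun j : Fin n => some (v j)) i (0 : Mem X Z E m n → ℂ) = 0 := by
        intro i
        funext μ
        exact ite_self _
      rw [this, stepQ_zero]
  have := key (q - (v i / 2 + 1))
  rwa [show v i / 2 + 1 + (q - (v i / 2 + 1)) = q by omega] at this

/-! ### Weights of accepted outputs, and the comparison of the runs. -/

theorem predWeight_nonneg (P : Matrix Z Z ℂ) (u : Z → ℂ) : 0 ≤ predWeight P u :=
  Finset.sum_nonneg fun _ _ => sq_nonneg _

theorem outWeight_nonneg (xo : Fin n → X) (P : Matrix Z Z ℂ) (ψ : Mem X Z E m n → ℂ) :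
    0 ≤ outWeight xo P ψ :=
  Finset.sum_nonneg fun _ _ => Finset.sum_nonneg fun _ _ => Finset.sum_nonneg fun _ _ =>
    Finset.sum_nonneg fun _ _ => predWeight_nonneg _ _

theorem outWeight_smul (xo : Fin n → X) (P : Matrix Z Z ℂ) (a : ℂ) (ψ : Mem X Z E m n → ℂ) :
    outWeight xo P (a • ψ) = ‖a‖ ^ 2 * outWeight xo P ψ := by
  have : ∀ u : Z → ℂ, predWeight P (a • u) = ‖a‖ ^ 2 * predWeight P u := fun u => by
    simp only [predWeight, Matrix.mulVec_smul, Pi.smul_apply, smul_eq_mul, norm_mul, mul_pow,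
      Finset.mul_sum]
  simp only [outWeight, Finset.mul_sum, ← this]
  rfl

theorem outWeight_zero (xo : Fin n → X) (P : Matrix Z Z ℂ) :
    outWeight xo P (0 : Mem X Z E m n → ℂ) = 0 := by
  have := outWeight_smul xo P 0 (0 : Mem X Z E m n → ℂ)
  simpa using this

theorem outWeight_congr {P : Matrix Z Z ℂ} {ψ φ : Mem X Z E m n → ℂ}
    (h : ∀ μ, μ.2.1 = xo → ψ μ = φ μ) : outWeight xo P ψ = outWeight xo P φ := by
  unfold outWeight
  have : ∀ c x y e, (fun z => ψ ((c, x, y), (xo, z, e))) = fun z => φ ((c, x, y), (xo, z, e)) :=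
    fun c x y e => funext fun z => h _ rfl
  simp only [this]

/-- A run of the simulator with the right outcomes has at least the weight of the corresponding
run with measurements and reprogramming. -/
theorem outWeight_simulated (hxo : Function.Injective xo) (hv : ∀ j : Fin n, v j ≤ 2 * q)
    (P : Matrix Z Z ℂ) :
    ‖choiceAmp n q k m‖ ^ 2 * outWeight xo P (modeState A xo T (hashOracle enc q m lam)
        (fun j => some (v j)) q) ≤
      outWeight xo P (advance A
          (tableOracle enc q m lam n (goodPts enc xo v) (received T v))
          (simRun enc A T lam v (goodPts enc xo v) n).2
          (q - (simRun enc A T lam v (goodPts enc xo v) n).2)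
          (simRun enc A T lam v (goodPts enc xo v) n).1) := by
  by_cases hnc : ∀ i j : Fin n, i ≠ j → v i / 2 = v j / 2 → q ≤ v i / 2
  · obtain ⟨hc, hdone, -, hψ⟩ := simRun_eq (enc := enc) (A := A) (T := T) (lam := lam) hxo hv hnc n
      le_rfl
    set p := simRun enc A T lam v (goodPts enc xo v) n
    have hall : ∀ j, j ∈ doneSet n v n := fun j => mem_doneSet.2 (Fin.is_lt _)
    rw [tableOracle_goodPts enc hxo T le_rfl, hψ, advance_modeState (choiceAmp n q k m) (c := p.2) (d := q - p.2) (by omega)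
      (doneSet n v n) (doneSet n v n) (fun j hj => by have := hdone j hj; omega)
      (fun i h1 h2 => by
        ext l
        rw [mem_activeSet]
        refine ⟨fun _ => hall l, fun hl b hb => ?_⟩
        obtain rfl : v l = b := by simpa using hb
        have := hdone l hl
        omega) fun _ _ _ j _ => hall j, outWeight_smul, show p.2 + (q - p.2) = q by omega]
    -- The projections still pending after `q` queries concern output registers, and `outWeight`
    -- only looks at states where these hold `xo`.
    refine le_of_eq (congrArg _ (outWeight_congr fun μ hμ => ?_))
    rw [projDone, if_pos]
    intro j _ hj
    rw [measuredReg, if_neg (by omega), hμ]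
  -- Two inputs share a measured query, so the left-hand side is 0 and nothing has to be known about
  -- the simulator.
  · push Not at hnc
    obtain ⟨i, j, hij, h, hq⟩ := hnc
    rw [modeState_eq_zero hxo hij h hq, outWeight_zero, mul_zero]
    exact outWeight_nonneg _ _ _

end

/-! ### The hash function is uniform on few points -/

section
open Polynomial

theorem bitPoly_injective {l : ℕ} : Function.Injective (bitPoly : BitStr l → (ZMod 2)[X]) := by
  intro b b' h
  funext a
  have hc : ∀ b : BitStr l, (bitPoly b).coeff a = if b a then 1 else 0 := fun b => by
    simp [bitPoly, bitAt, finsetSum_coeff, coeff_C_mul, coeff_X_pow]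
  have := congrArg (fun p => p.coeff (a : ℕ)) h
  simp only [hc] at this
  cases h1 : b a <;> cases h2 : b' a <;> simp_all

/-- A seed, extended by 0. -/
def seedOf {N : ℕ} (s : Fin N → ZMod 2) (i : ℕ) : ZMod 2 := if h : i < N then s ⟨i, h⟩ else 0

theorem seed_index_lt {m t D i j d : ℕ} (hj : j < m) (hi : i < t) (hd : d < D) :
    j * (t * D) + (i * D + d) < m * (t * D) := by
  have h1 : i * D + d < t * D := by nlinarith
  have h2 : (j + 1) * (t * D) ≤ m * (t * D) := Nat.mul_le_mul_right _ hj
  rw [add_mul, one_mul] at h2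
  omega

/-- The seed index is a mixed-radix encoding of `(j, i, d)`, so division and remainder recover the
three digits and the entries can be prescribed independently. -/
theorem exists_seed (m t D : ℕ) (a : ℕ → ℕ → ℕ → ZMod 2) :
    ∃ s : Fin (m * (t * D)) → ZMod 2, ∀ j < m, ∀ i < t, ∀ d < D,
      seedOf s (j * (t * D) + (i * D + d)) = a j i d := by
  refine ⟨fun l => a (l / (t * D)) (l % (t * D) / D) (l % (t * D) % D), fun j hj i hi d hd => ?_⟩
  have h1 : i * D + d < t * D := by nlinarith
  rw [seedOf, dif_pos (seed_index_lt hj hi hd)]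
  simp only
  rw [mul_comm j, Nat.mul_add_div (by omega), Nat.mul_add_mod, Nat.mod_eq_of_lt h1, Nat.div_eq_of_lt h1,
    add_zero, mul_comm i, Nat.mul_add_div (by omega), Nat.mul_add_mod, Nat.mod_eq_of_lt hd,
    Nat.div_eq_of_lt hd, add_zero]

/-- The values of the hash function as a linear function of the seed. -/
noncomputable def hashLin {k : ℕ} {ι : Type} (m t D : ℕ) (b : ι → BitStr k) :
    (Fin (m * (t * D)) → ZMod 2) →ₗ[ZMod 2] (ι × Fin m → ZMod 2) where
  toFun s p := hashBit (seedOf s) t D p.2 (b p.1)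
  map_add' s s' := by
    funext p
    have : ∀ i, seedOf (s + s') i = seedOf s i + seedOf s' i := fun i => by
      unfold seedOf
      split_ifs <;> simp
    simp only [hashBit, this, add_mul, Finset.sum_add_distrib, Pi.add_apply]
  map_smul' c s := by
    funext p
    have : ∀ i, seedOf (c • s) i = c * seedOf s i := fun i => by
      unfold seedOf
      split_ifs <;> simp
    simp only [hashBit, this, mul_assoc, Finset.mul_sum, Pi.smul_apply, smul_eq_mul,
      RingHom.id_apply]

/-- By duality it suffices that a functional vanishing on the range is 0. With coefficients `c (x,
j)`, vanishing says that the sum over `x` of `c (x, j)` times the power `i` of the polynomial of `x`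
is 0 for all `i < t`. These polynomials are distinct elements of an integral domain and there are at
most `t` of them, so the Vandermonde matrix gives `c = 0`. -/
theorem hashLin_surjective {k : ℕ} {ι : Type} [Fintype ι] {m t D : ℕ} {b : ι → BitStr k}
    (hb : Function.Injective b) (hι : Fintype.card ι ≤ t) (hD : ∀ i < t, i * k < D) :
    Function.Surjective (hashLin m t D b) := by
  classical
  rw [← LinearMap.dualMap_injective_iff, injective_iff_map_eq_zero]
  intro ℓ hℓ
  set c : ι × Fin m → ZMod 2 := fun p => ℓ fun p' => if p = p' then 1 else 0 with hc
  have hsum : ∀ u, ℓ u = ∑ p, u p * c p := fun u => by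
    rw [LinearMap.pi_apply_eq_sum_univ ℓ u]
    rfl
  have h0 : ∀ s, ∑ p, hashLin m t D b s p * c p = 0 := fun s => by
    rw [← hsum]
    exact LinearMap.congr_fun hℓ s
  have hcoeff : ∀ (j : Fin m), ∀ i < t, ∀ d < D,
      ∑ x, (bitPoly (b x) ^ i).coeff d * c (x, j) = 0 := by
    intro j i hi d hd
    -- The seed with a single entry 1, at `(j, i, d)`, extracts one coefficient.
    obtain ⟨s, hs⟩ := exists_seed m t D fun j' i' d' =>
      if j' = j then if i' = i then if d' = d then 1 else 0 else 0 else 0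
    rw [← h0 s, Fintype.sum_prod_type]
    refine Finset.sum_congr rfl fun x _ => ?_
    have e : ∀ j' : Fin m, hashLin m t D b s (x, j') =
        if j' = j then (bitPoly (b x) ^ i).coeff d else 0 := by
      intro j'
      change hashBit (seedOf s) t D j' (b x) = _
      have e1 : hashBit (seedOf s) t D j' (b x) = ∑ i' ∈ Finset.range t, ∑ d' ∈ Finset.range D,
          if d' = d then (if i' = i then if j' = j then (bitPoly (b x) ^ i).coeff d else 0
            else 0) else 0 := by
        refine Finset.sum_congr rfl fun i' hi' => Finset.sum_congr rfl fun d' hd' => ?_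
        rw [hs j' j'.2 i' (Finset.mem_range.1 hi') d' (Finset.mem_range.1 hd')]
        by_cases h1 : j' = j <;> by_cases h2 : i' = i <;> by_cases h3 : d' = d <;>
          simp [h1, h2, h3, Fin.val_inj]
      rw [e1]
      simp only [Finset.sum_ite_eq', Finset.mem_range, hd, hi, if_true]
    simp [e]
  have hpoly : ∀ (j : Fin m), ∀ i < t, ∑ x, C (c (x, j)) * bitPoly (b x) ^ i = 0 := by
    intro j i hi
    ext d
    rw [finsetSum_coeff, coeff_zero]
    simp only [coeff_C_mul]
    -- Coefficients from `D` on vanish by the degree bound, so the equations for `d < D` give an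
    -- identity of polynomials.
    rcases lt_or_ge d D with hd | hd
    · rw [← hcoeff j i hi d hd]
      exact Finset.sum_congr rfl fun x _ => mul_comm _ _
    · refine Finset.sum_eq_zero fun x _ => ?_
      rw [coeff_eq_zero_of_natDegree_lt, mul_zero]
      have := (natDegree_pow_le (p := bitPoly (b x)) (n := i)).trans
        (Nat.mul_le_mul_left i (natDegree_bitPoly_le (b x)))
      have := hD i hi
      omega
  have hc0 : ∀ p, c p = 0 := by
    rintro ⟨x, j⟩
    set e := Fintype.equivFin ι
    have hv := Matrix.eq_zero_of_forall_pow_sum_mul_pow_eq_zero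
      (f := fun l => bitPoly (b (e.symm l))) (v := fun l => C (c (e.symm l, j)))
      (bitPoly_injective.comp (hb.comp e.symm.injective)) fun i => by
        rw [← hpoly j i (i.2.trans_le hι), ← e.symm.sum_comp]
    have := congrFun hv (e x)
    simpa using this
  refine LinearMap.ext fun u => ?_
  rw [hsum]
  simp [hc0]

end

/-- The fibres of a surjective homomorphism have equal size, so it maps the uniform distribution to
the uniform one. -/
theorem sum_comp_surjective {V U : Type} [AddGroup V] [AddGroup U] [Fintype V] [Fintype U]
    (f : V →+ U) (hf : Function.Surjective f) (φ : U → ℂ) :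
    (Fintype.card U : ℂ) * ∑ v, φ (f v) = Fintype.card V * ∑ u, φ u := by
  classical
  set c := (Finset.univ.filter fun v => f v = 0).card with hc
  have hfib : ∀ u, (Finset.univ.filter fun v => f v = u).card = c := fun u =>
    AddMonoidHom.card_fiber_eq_of_mem_range f (hf u) (hf 0)
  have h1 : ∑ v, φ (f v) = c * ∑ u, φ u := by
    rw [← Finset.sum_fiberwise' Finset.univ f φ, Finset.mul_sum]
    refine Finset.sum_congr rfl fun u _ => ?_
    rw [Finset.sum_const, hfib, nsmul_eq_mul]
  have h2 : Fintype.card V = Fintype.card U * c := by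
    rw [← Finset.card_univ, Finset.card_eq_sum_card_fiberwise (f := f) (t := Finset.univ)
      (fun _ _ => Finset.mem_coe.2 (Finset.mem_univ _)), Finset.sum_congr rfl fun u _ => hfib u]
    simp
  rw [h1, h2]
  push_cast
  ring

/-! ### Functions that depend on few points of the oracle -/

section
variable {k m n q : ℕ} {X Z E : Type} [Fintype X] [DecidableEq X]

/-- The span of the functions that depend on at most `t` values of the oracle. -/
def localFuns (X : Type) (m t : ℕ) : Submodule ℂ ((X → BitStr m) → ℂ) :=
  Submodule.span ℂ {g | ∃ S : Finset X, S.card ≤ t ∧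
    ∀ H H' : X → BitStr m, (∀ x ∈ S, H x = H' x) → g H = g H'}

theorem localFuns_mono {s t : ℕ} (h : s ≤ t) : localFuns X m s ≤ localFuns X m t :=
  Submodule.span_mono fun _ ⟨S, hS, hg⟩ => ⟨S, hS.trans h, hg⟩

theorem const_mem_localFuns (t : ℕ) (c : ℂ) : (fun _ => c) ∈ localFuns X m t :=
  Submodule.subset_span ⟨∅, Nat.zero_le _, fun _ _ _ => rfl⟩

theorem mul_mem_localFuns {s t : ℕ} {f g : (X → BitStr m) → ℂ} (hf : f ∈ localFuns X m s)
    (hg : g ∈ localFuns X m t) : (fun H => f H * g H) ∈ localFuns X m (s + t) := by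
  have := Submodule.mul_mem_mul hf hg
  rw [localFuns, localFuns, Submodule.span_mul_span] at this
  refine Submodule.span_mono ?_ this
  rintro _ ⟨f, ⟨S, hS, hf⟩, g, ⟨T, hT, hg⟩, rfl⟩
  refine ⟨S ∪ T, (Finset.card_union_le _ _).trans (add_le_add hS hT), fun H H' h => ?_⟩
  simp only [Pi.mul_apply]
  rw [hf H H' fun x hx => h x (Finset.mem_union_left _ hx),
    hg H H' fun x hx => h x (Finset.mem_union_right _ hx)]

theorem star_mem_localFuns {t : ℕ} {f : (X → BitStr m) → ℂ} (hf : f ∈ localFuns X m t) :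
    (fun H => star (f H)) ∈ localFuns X m t := by
  unfold localFuns at hf ⊢
  induction hf using Submodule.span_induction with
  | mem f hf =>
    obtain ⟨S, hS, hf⟩ := hf
    exact Submodule.subset_span ⟨S, hS, fun H H' h => congrArg star (hf H H' h)⟩
  | zero =>
    have e : (fun H : X → BitStr m => star ((0 : (X → BitStr m) → ℂ) H)) = 0 :=
      funext fun _ => star_zero _
    rw [e]
    exact Submodule.zero_mem _
  | add f g _ _ hf hg =>
    have e : (fun H => star ((f + g) H)) = (fun H => star (f H)) + fun H => star (g H) :=
      funext fun _ => star_add _ _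
    rw [e]
    exact Submodule.add_mem _ hf hg
  | smul a f _ hf =>
    have e : (fun H => star ((a • f) H)) = star a • fun H => star (f H) :=
      funext fun H => star_smul a (f H)
    rw [e]
    exact Submodule.smul_mem _ _ hf

theorem sum_mem_localFuns {ι : Type} [Fintype ι] {t : ℕ} {f : ι → (X → BitStr m) → ℂ}
    (hf : ∀ i, f i ∈ localFuns X m t) : (fun H => ∑ i, f i H) ∈ localFuns X m t := by
  have := Submodule.sum_mem (localFuns X m t) (t := Finset.univ) (f := f) fun i _ => hf i
  convert this using 1
  funext H
  simp

theorem smul_mem_localFuns {t : ℕ} (a : ℂ) {f : (X → BitStr m) → ℂ} (hf : f ∈ localFuns X m t) :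
    (fun H => a * f H) ∈ localFuns X m t :=
  Submodule.smul_mem (localFuns X m t) a hf

/-- Averages of such functions over the hash function and over all functions agree. -/
theorem sum_hash_eq (enc : X ↪ BitStr k) {g : (X → BitStr m) → ℂ} (hg : g ∈ localFuns X m (2 * q))
    {Φ : (X → BitStr m) → X → BitStr m} (hΦ : ∀ H H' x, H x = H' x → Φ H x = Φ H' x) :
    (Fintype.card (X → BitStr m) : ℂ) *
        ∑ s : Fin (m * (2 * q * (2 * q * (k + 1)))) → ZMod 2,
          g (Φ (hashOracle enc q m (seedOf s))) =
      Fintype.card (Fin (m * (2 * q * (2 * q * (k + 1)))) → ZMod 2) * ∑ H, g (Φ H) := by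
  unfold localFuns at hg
  induction hg using Submodule.span_induction with
  | zero => simp
  | add f g _ _ hf hg =>
    simp only [Pi.add_apply, Finset.sum_add_distrib, mul_add, hf, hg]
  | smul a f _ hf =>
    simp only [Pi.smul_apply, smul_eq_mul, ← Finset.mul_sum]
    rw [mul_left_comm, hf, mul_left_comm]
  | mem g hg =>
    obtain ⟨S, hS, hg⟩ := hg
    -- `g ∘ Φ` only sees the oracle on `S`, since `Φ` acts point by point; `φ` is this function of
    -- the values on `S`.
    set φ : (S × Fin m → ZMod 2) → ℂ := fun u => g (Φ fun x j =>
      if h : x ∈ S then decide (u (⟨x, h⟩, j) = 1) else false) with hφ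
    set L := hashLin (k := k) m (2 * q) (2 * q * (k + 1)) fun x : S => enc x with hL
    have hLs : Function.Surjective L := hashLin_surjective
      (enc.injective.comp Subtype.val_injective) (by simpa using hS) fun i hi => by
        have : i * k ≤ (2 * q) * k := Nat.mul_le_mul_right _ hi.le
        rw [mul_add, mul_one]
        omega
    have e1 : ∀ s, g (Φ (hashOracle enc q m (seedOf s))) = φ (L.toAddMonoidHom s) := fun s => by
      refine hg _ _ fun x hx => hΦ _ _ x ?_
      funext j
      rw [dif_pos hx]
      rfl
    -- A uniformly random function, restricted to `S`, is another surjective linear image of a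
    -- uniform vector. Both averages are therefore the average of `φ`.
    set R := LinearMap.funLeft (ZMod 2) (ZMod 2) fun p : S × Fin m => ((p.1 : X), p.2) with hR
    have hRs : Function.Surjective R := LinearMap.funLeft_surjective_of_injective _ _ _ fun p p' h => by
      have h' := Prod.ext_iff.1 h
      exact Prod.ext (Subtype.ext h'.1) h'.2
    set dec : (X × Fin m → ZMod 2) → X → BitStr m := fun u x j => decide (u (x, j) = 1) with hdec
    have hdecb : Function.Bijective dec := by
      refine ⟨fun u u' h => funext fun p => ?_, fun H => ⟨fun p => if H p.1 p.2 then 1 else 0, ?_⟩⟩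
      · have := congrFun (congrFun h p.1) p.2
        simp only [hdec, decide_eq_decide] at this
        revert this
        generalize u p = a
        generalize u' p = b
        revert a b
        decide
      · funext x j
        simp [hdec]
    have e2 : ∑ H, g (Φ H) = ∑ u, φ (R.toAddMonoidHom u) := by
      refine (Fintype.sum_bijective dec hdecb _ _ fun u => ?_).symm
      refine hg _ _ fun x hx => hΦ _ _ x ?_
      funext j
      rw [dif_pos hx]
      rfl
    have c1 := sum_comp_surjective L.toAddMonoidHom hLs φ
    have c2 := sum_comp_surjective R.toAddMonoidHom hRs φ
    have hc : Fintype.card (X → BitStr m) = Fintype.card (X × Fin m → ZMod 2) :=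
      (Fintype.card_of_bijective hdecb).symm
    have h0 : (Fintype.card (S × Fin m → ZMod 2) : ℂ) ≠ 0 :=
      Nat.cast_ne_zero.2 Fintype.card_ne_zero
    rw [hc, e2, Finset.sum_congr rfl fun s _ => e1 s]
    refine mul_left_cancel₀ h0 ?_
    rw [mul_left_comm, c1, mul_left_comm, mul_left_comm (Fintype.card (S × Fin m → ZMod 2) : ℂ), c2]

variable [Fintype Z] [DecidableEq Z] [Fintype E] [DecidableEq E]

/-- The polynomial method: a query multiplies an amplitude by indicators of a single oracle value,
and the operations of `A` are linear and do not depend on the oracle. -/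
theorem state_mem_localFuns (A : OracleAlg X Z E m n q) (i : ℕ) :
    ∀ μ, (fun H => A.state H i μ) ∈ localFuns X m i := by
  induction i with
  | zero => exact fun μ => const_mem_localFuns 0 (A.init μ)
  | succ i ih =>
    intro μ
    by_cases hi : i < q
    · have e : (fun H => A.state H (i + 1) μ) = fun H => ∑ ν, A.step ⟨i, hi⟩ μ ν *
          ∑ t : BitStr m, (if H ν.1.2.1 = t then (1 : ℂ) else 0) *
            A.state H i (queryMap (fun _ => t) ν) := by
        funext H
        rw [OracleAlg.state, dif_pos hi]
        refine Finset.sum_congr rfl fun ν _ => ?_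
        -- Only the term with `t` equal to the value of the oracle at the queried point survives.
        simp only [ite_mul, one_mul, zero_mul, Finset.sum_ite_eq, Finset.mem_univ, if_true]
        rfl
      rw [e]
      refine sum_mem_localFuns fun ν => smul_mem_localFuns _ (sum_mem_localFuns fun t => ?_)
      rw [add_comm]
      refine mul_mem_localFuns (Submodule.subset_span ⟨{ν.1.2.1}, by simp, fun H H' h => ?_⟩)
        (ih _)
      simp only [h _ (Finset.mem_singleton_self _)]
    · have e : (fun H => A.state H (i + 1) μ) = fun H => A.state H i μ := by
        funext H
        rw [OracleAlg.state, dif_neg hi]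
      rw [e]
      exact localFuns_mono (Nat.le_succ i) (ih μ)

/-- A probability is a sum of amplitudes times conjugate amplitudes, which doubles the number of
oracle values involved. This determines the `2q` powers in the hash function. -/
theorem outWeight_mem_localFuns (A : OracleAlg X Z E m n q) (xo : Fin n → X)
    (P : Matrix Z Z ℂ) :
    (fun H => ((outWeight xo P (A.state H q) : ℝ) : ℂ)) ∈ localFuns X m (2 * q) := by
  simp only [outWeight, predWeight, Complex.ofReal_sum, ← Complex.normSq_eq_norm_sq,
    ← Complex.mul_conj]
  rw [two_mul]
  have key : ∀ c x y e z, (fun H => (P.mulVec fun z => A.state H q ((c, x, y), (xo, z, e))) z) ∈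
      localFuns X m q := fun c x y e z =>
    sum_mem_localFuns fun z' => smul_mem_localFuns _ (state_mem_localFuns A q _)
  exact sum_mem_localFuns fun c => sum_mem_localFuns fun x => sum_mem_localFuns fun y =>
    sum_mem_localFuns fun e => sum_mem_localFuns fun z =>
      mul_mem_localFuns (key c x y e z) (star_mem_localFuns (key c x y e z))

theorem patch_univ_apply {xo : Fin n → X} (hxo : Function.Injective xo) (T : Fin n → BitStr m)
    (G : X → BitStr m) (j : Fin n) : patch xo T G Finset.univ (xo j) = T j :=
  patch_of_mem hxo T G (Finset.mem_univ j)

/-- The success probability with the reprogrammed hash function. -/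
theorem sum_hash_outWeight (enc : X ↪ BitStr k) (A : OracleAlg X Z E m n q) (xo : Fin n → X)
    (P : Matrix Z Z ℂ) (T : Fin n → BitStr m) :
    (Fintype.card (X → BitStr m) : ℝ) *
        ∑ s : Fin (m * (2 * q * (2 * q * (k + 1)))) → ZMod 2, outWeight xo P
          (A.state (patch xo T (hashOracle enc q m (seedOf s)) Finset.univ) q) =
      Fintype.card (Fin (m * (2 * q * (2 * q * (k + 1)))) → ZMod 2) *
        ∑ H, outWeight xo P (A.state (patch xo T H Finset.univ) q) := by
  have := sum_hash_eq enc (outWeight_mem_localFuns A xo P)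
    (Φ := fun H => patch xo T H Finset.univ) fun H H' x h => by
      simp only [patch, h]
  exact_mod_cast this

/-- Reprogramming a random function at fixed points with random values. -/
theorem sum_patch {xo : Fin n → X} (hxo : Function.Injective xo)
    (f : (Fin n → BitStr m) → (X → BitStr m) → ℝ) :
    ∑ T : Fin n → BitStr m, ∑ H, f T (patch xo T H Finset.univ) =
      Fintype.card (Fin n → BitStr m) * ∑ H, f (fun j => H (xo j)) H := by
  -- Exchanging `T` with the values of `H` on `xo` is an involution of the pairs; this uses that the
  -- points are distinct.
  have hinv : Function.Involutive fun p : (Fin n → BitStr m) × (X → BitStr m) =>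
      ((fun j => p.2 (xo j)), patch xo p.1 p.2 Finset.univ) := by
    rintro ⟨T, H⟩
    refine Prod.ext (funext fun j => patch_univ_apply hxo T H j) (funext fun x => ?_)
    by_cases hx : ∃ j, xo j = x
    · obtain ⟨j, rfl⟩ := hx
      exact patch_univ_apply hxo _ _ j
    · have hx' : ∀ j ∈ Finset.univ, xo j ≠ x := fun j _ h => hx ⟨j, h⟩
      simp only
      rw [patch_of_forall_ne _ _ hx', patch_of_forall_ne _ _ hx']
  rw [← Fintype.sum_prod_type']
  have := Fintype.sum_bijective _ hinv.bijective
    (fun p : (Fin n → BitStr m) × (X → BitStr m) => f p.1 (patch xo p.1 p.2 Finset.univ))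
    (fun p => f (fun j => p.2 (xo j)) p.2) fun p => by
      simp only
      rw [show (fun j => patch xo p.1 p.2 Finset.univ (xo j)) = p.1 from
        funext fun j => patch_univ_apply hxo _ _ j]
  rw [this, Fintype.sum_prod_type]
  simp

end

/-! ### The success probability of the simulator -/

section
variable {W k m n q : ℕ} {X Z E : Type} [Fintype X] [DecidableEq X] [Fintype Z] [DecidableEq Z]
  [Fintype E] [DecidableEq E]

theorem hashOracle_congr (enc : X ↪ BitStr k) {lam lam' : ℕ → ZMod 2}
    (h : ∀ i < m * (2 * q * (2 * q * (k + 1))), lam i = lam' i) :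
    hashOracle enc q m lam = hashOracle enc q m lam' := by
  funext x j
  have : hashBit lam (2 * q) (2 * q * (k + 1)) j (enc x) =
      hashBit lam' (2 * q) (2 * q * (k + 1)) j (enc x) :=
    Finset.sum_congr rfl fun i hi => Finset.sum_congr rfl fun d hd => by
      rw [h _ (seed_index_lt j.2 (Finset.mem_range.1 hi) (Finset.mem_range.1 hd))]
  simp only [hashOracle, this]

theorem seedOf_apply {N i : ℕ} (s : Fin N → ZMod 2) (hi : i < N) : seedOf s i = s ⟨i, hi⟩ :=
  dif_pos hi

theorem Holds.hashOracle_eq (enc : X ↪ BitStr k) {f : Choice n q k m} {lam : ℕ → ZMod 2}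
    {v : ℕ → ℕ} (h : Holds f lam v) :
    hashOracle enc q m lam = hashOracle enc q m
      (seedOf (N := m * (2 * q * (2 * q * (k + 1)))) (f.2 : Fin _ → ZMod 2)) := by
  refine hashOracle_congr enc fun i hi => ?_
  have h2 : ∀ x : Fin (1 + 1), (if (x : ℕ) = 1 then (1 : ZMod 2) else 0) = (x : Fin 2) := by
    intro x
    fin_cases x <;> rfl
  rw [h.2 ⟨i, hi⟩]
  exact (h2 _).trans (seedOf_apply (N := m * (2 * q * (2 * q * (k + 1)))) f.2 hi).symm

/-- The probability of a branch in which `xo` is output and accepted by `P`. -/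
noncomputable def branchWeight (P : Matrix Z Z ℂ) (φ : Vec W X Z E m n) : ℝ :=
  ∑ w : Fin W × Fin W → Bool, ∑ c : Bool, ∑ x : X, ∑ y : BitStr m, ∑ x' : Fin n → X, ∑ e : E,
    predWeight P fun z => φ (w, ((c, x, y), (x', z, e)))

theorem branchWeight_nonneg (P : Matrix Z Z ℂ) (φ : Vec W X Z E m n) : 0 ≤ branchWeight P φ :=
  Finset.sum_nonneg fun _ _ => Finset.sum_nonneg fun _ _ => Finset.sum_nonneg fun _ _ =>
    Finset.sum_nonneg fun _ _ => Finset.sum_nonneg fun _ _ => Finset.sum_nonneg fun _ _ =>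
      predWeight_nonneg _ _

theorem outWeight_le_branchWeight (xo : Fin n → X) (P : Matrix Z Z ℂ) (ψ : Mem X Z E m n → ℂ) :
    outWeight xo P ψ ≤ branchWeight P (embed W ψ) := by
  have h : outWeight xo P ψ ≤ ∑ c : Bool, ∑ x : X, ∑ y : BitStr m, ∑ x' : Fin n → X, ∑ e : E,
      predWeight P fun z => embed W ψ ((fun _ => false), ((c, x, y), (x', z, e))) := by
    refine Finset.sum_le_sum fun c _ => Finset.sum_le_sum fun x _ => Finset.sum_le_sum fun y _ => ?_
    refine le_trans (le_of_eq ?_) (Finset.single_le_sum (f := fun x' : Fin n → X => ∑ e : E,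
      predWeight P fun z => embed W ψ ((fun _ => false), ((c, x, y), (x', z, e))))
      (fun x' _ => Finset.sum_nonneg fun _ _ => predWeight_nonneg _ _) (Finset.mem_univ xo))
    refine Finset.sum_congr rfl fun e _ => congrArg _ (funext fun z => ?_)
    simp [embed]
  refine h.trans (Finset.single_le_sum (f := fun w : Fin W × Fin W → Bool => ∑ c : Bool, ∑ x : X,
    ∑ y : BitStr m, ∑ x' : Fin n → X, ∑ e : E,
      predWeight P fun z => embed W ψ (w, ((c, x, y), (x', z, e)))) (fun w _ => ?_)
    (Finset.mem_univ _))
  exact Finset.sum_nonneg fun _ _ => Finset.sum_nonneg fun _ _ => Finset.sum_nonneg fun _ _ =>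
    Finset.sum_nonneg fun _ _ => Finset.sum_nonneg fun _ _ => predWeight_nonneg _ _

theorem norm_choiceAmp_sq (n q k m : ℕ) :
    ‖choiceAmp n q k m‖ ^ 2 = ((2 * q + 1 : ℕ) : ℝ)⁻¹ ^ n *
      (2 : ℝ)⁻¹ ^ (m * (2 * q * (2 * q * (k + 1)))) := by
  have h : ∀ a : ℝ, 0 ≤ a → ∀ l : ℕ, (‖((Real.sqrt a : ℝ) : ℂ)⁻¹ ^ l‖) ^ 2 = a⁻¹ ^ l := by
    intro a ha l
    rw [norm_pow, norm_inv, Complex.norm_real, Real.norm_of_nonneg (Real.sqrt_nonneg a), ← pow_mul,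
      mul_comm l, pow_mul, inv_pow, Real.sq_sqrt ha]
  rw [choiceAmp, norm_mul, mul_pow, h _ (by positivity), h _ (by positivity)]
  congr 3 <;> push_cast <;> norm_num

-- Only the branches with the right outcomes are kept. Their common factor `‖choiceAmp‖ ^ 2`
-- contains the probability of the schedule; the second power of `2q + 1` comes from
-- `outWeight_le_sum_modes`.
open scoped Classical in
theorem le_sum_branches (hn : 0 < n) (hW : 2 * q + n + 3 ≤ W)
    (hW' : 2 * q * (k + 1) + k + 1 ≤ W) (enc : X ↪ BitStr k) (A : OracleAlg X Z E m n q)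
    (T : Fin n → BitStr m) {xo : Fin n → X} (hxo : Function.Injective xo) (P : Matrix Z Z ℂ) :
    ‖choiceAmp n q k m‖ ^ 2 * (((2 * q + 1 : ℕ) : ℝ)⁻¹ ^ n *
        ∑ s : Fin (m * (2 * q * (2 * q * (k + 1)))) → ZMod 2, outWeight xo P
          (A.state (patch xo T (hashOracle enc q m (seedOf s)) Finset.univ) q)) ≤
      ((runStages W simulator enc A T (n + 1)).map fun r =>
        if r.Extracts enc xo then branchWeight P r.cfg.vec else 0).sum := by
  obtain ⟨g, h1, h2⟩ := exists_good hn hW hW' enc A T xo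
  refine le_trans ?_ (h1 _ fun r => ?_)
  · have step : ∀ f : Choice n q k m, ‖choiceAmp n q k m‖ ^ 2 * outWeight xo P (modeState A xo T
        (hashOracle enc q m (seedOf (N := m * (2 * q * (2 * q * (k + 1)))) (f.2 : Fin _ → ZMod 2)))
          (fun j => some (f.1 j : ℕ)) q) ≤
        if (g f).Extracts enc xo then branchWeight P (g f).cfg.vec else 0 := by
      intro f
      obtain ⟨hE, lam, v, hf, hv⟩ := h2 f
      rw [if_pos hE, hv, ← hf.hashOracle_eq enc]
      have := outWeight_simulated (enc := enc) (A := A) (T := T) (lam := lam) (v := v) hxo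
        (fun j => hf.le j j.2) P
      simp only [hf.1] at this
      exact this.trans (outWeight_le_branchWeight xo P _)
    refine le_trans ?_ (Finset.sum_le_sum fun f _ => step f)
    rw [← Finset.mul_sum, Fintype.sum_prod_type, Finset.sum_comm]
    refine mul_le_mul_of_nonneg_left ?_ (sq_nonneg _)
    rw [Finset.mul_sum]
    refine Finset.sum_le_sum fun s _ => ?_
    have hpos : (0 : ℝ) < ((2 * q + 1 : ℕ) : ℝ) ^ n := by positivity
    rw [inv_pow, inv_mul_le_iff₀ hpos]
    exact outWeight_le_sum_modes A xo T _ P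
  · split_ifs
    · exact branchWeight_nonneg _ _
    · exact le_rfl

theorem simProb_ge (hn : 0 < n) (hW : 2 * q + n + 3 ≤ W)
    (hW' : 2 * q * (k + 1) + k + 1 ≤ W) (enc : X ↪ BitStr k) (A : OracleAlg X Z E m n q)
    {xo : Fin n → X} (hxo : Function.Injective xo) (V : QPredicate X Z m n) :
    (1 / (2 * (q : ℝ) + 1) ^ (2 * n)) * A.successProb V xo ≤ simProb W simulator enc A V xo := by
  classical
  have hT : (0 : ℝ) < Fintype.card (Fin n → BitStr m) := Nat.cast_pos.2 Fintype.card_pos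
  have hH : (0 : ℝ) < Fintype.card (X → BitStr m) := Nat.cast_pos.2 Fintype.card_pos
  have hS : (Fintype.card (Fin (m * (2 * q * (2 * q * (k + 1)))) → ZMod 2) : ℝ) =
      2 ^ (m * (2 * q * (2 * q * (k + 1)))) := by
    simp [ZMod.card]
  have h1 : A.successProb V xo = (∑ H : X → BitStr m,
      outWeight xo (V.proj xo fun i => H (xo i)) (A.state H q)) / Fintype.card (X → BitStr m) := rfl
  have h2 : simProb W simulator enc A V xo = (∑ T : Fin n → BitStr m,
      ((runStages W simulator enc A T (n + 1)).map fun r =>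
        if r.Extracts enc xo then branchWeight (V.proj xo T) r.cfg.vec else 0).sum) /
      Fintype.card (Fin n → BitStr m) := rfl
  rw [h1, h2, le_div_iff₀ hT]
  refine le_trans (le_of_eq ?_) (Finset.sum_le_sum fun T _ =>
    le_sum_branches hn hW hW' enc A T hxo (V.proj xo T))
  rw [← Finset.mul_sum, ← Finset.mul_sum]
  -- For fixed values `T` the average over the seed becomes an average over all functions.
  have h3 : ∀ T : Fin n → BitStr m, ∑ s : Fin (m * (2 * q * (2 * q * (k + 1)))) → ZMod 2,
      outWeight xo (V.proj xo T)
        (A.state (patch xo T (hashOracle enc q m (seedOf s)) Finset.univ) q) =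
      (Fintype.card (X → BitStr m) : ℝ)⁻¹ * (2 ^ (m * (2 * q * (2 * q * (k + 1)))) *
        ∑ H, outWeight xo (V.proj xo T) (A.state (patch xo T H Finset.univ) q)) := by
    intro T
    rw [eq_inv_mul_iff_mul_eq₀ hH.ne', sum_hash_outWeight, hS]
  simp only [h3, ← Finset.mul_sum]
  -- Averaging over `T` as well, the reprogrammed oracle becomes a uniformly random `H` with `T =
  -- H(xo)`; the predicate then refers to `H(xo)`, as in `successProb`.
  rw [sum_patch hxo fun T H => outWeight xo (V.proj xo T) (A.state H q), norm_choiceAmp_sq]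
  have h2N : (2 : ℝ) ^ (m * (2 * q * (2 * q * (k + 1)))) ≠ 0 := by positivity
  have hM : ((2 * q + 1 : ℕ) : ℝ) = 2 * (q : ℝ) + 1 := by push_cast; ring
  rw [hM, inv_pow, inv_pow, mul_comm 2 n, pow_mul]
  have hMn : (2 * (q : ℝ) + 1) ^ n ≠ 0 := by positivity
  field_simp

end

/-! ### The running time -/

/-- The expression avoids the values in `prot`, as the name of an array. -/
def NExpr.avoids (prot : List ℕ) : NExpr → Bool
  | .lit v => !prot.contains v
  | .add (.lit v) _ => prot.all fun p => decide (p < v)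
  | _ => false

theorem NExpr.eval_notMem_of_avoids {prot : List ℕ} {e : NExpr} (h : e.avoids prot = true)
    (σ : Store) : e.eval σ ∉ prot := by
  unfold avoids at h
  split at h
  · simpa [eval] using h
  · rw [List.all_eq_true] at h
    intro hm
    have := of_decide_eq_true (h _ hm)
    simp only [eval] at this
    omega
  · exact absurd h (by simp)

/-- The program does not write to the arrays in `prot`, and its loops have bounds in `b`. -/
def Prog.safe (prot : List ℕ) (b : NExpr → Bool) : Prog → Bool
  | .assign a _ _ => a.avoids prot
  | .rand a _ _ => a.avoids prot
  | .meas _ a _ => a.avoids prot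
  | .seq P Q => P.safe prot b && Q.safe prot b
  | .ite _ _ P Q => P.safe prot b && Q.safe prot b
  | .loop e P => b e && P.safe prot b
  | _ => true

/-- The size of a program. -/
def Prog.size : Prog → ℕ
  | .seq P Q => P.size + Q.size
  | .ite _ _ P Q => P.size + Q.size + 1
  | .loop _ P => P.size + 1
  | _ => 1

theorem Prog.size_pos (P : Prog) : 0 < P.size := by
  induction P <;> simp only [size] <;> omega

section
variable {W k m n q : ℕ} {X Z E : Type} [Fintype X] [DecidableEq X] [Fintype Z] [DecidableEq Z]
  [Fintype E] [DecidableEq E] {enc : X ↪ BitStr k} {A : OracleAlg X Z E m n q}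

/-- Powers with base at least 2 are superadditive in the exponent, so a time bound of the form `B ^
size` is compatible with sequential composition. -/
theorem add_pow_le_pow_add {B a b : ℕ} (hB : 2 ≤ B) (ha : 0 < a) (hb : 0 < b) :
    B ^ a + B ^ b ≤ B ^ (a + b) := by
  have h1 : 2 ≤ B ^ a := hB.trans (Nat.le_self_pow ha.ne' B)
  have h2 : 2 ≤ B ^ b := hB.trans (Nat.le_self_pow hb.ne' B)
  rw [pow_add]
  nlinarith

/-- If the loop bounds are at most `K` as long as `I` holds, and writing to unprotected arrays
does not affect `I`, then the running time is polynomial in `K`. -/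
theorem Prog.time_le {prot : List ℕ} {b : NExpr → Bool} {K : ℕ} {I : Store → Prop}
    (hI : ∀ σ τ : Store, (∀ a ∈ prot, ∀ i, τ a i = σ a i) → I σ → I τ)
    (hb : ∀ e, b e = true → ∀ σ, I σ → e.eval σ ≤ K) (P : Prog) (hP : P.safe prot b = true) :
    ∀ c : Config W X Z E m n, I c.mem → ∀ d ∈ P.exec enc A c,
      I d.mem ∧ d.time ≤ c.time + (K + 2) ^ P.size := by
  have hw : ∀ {a : NExpr}, a.avoids prot = true → ∀ (σ : Store) (i v : ℕ), I σ →
      I (σ.write (a.eval σ) i v) := fun ha σ i v h => hI _ _ (fun a' ha' i' => by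
    rw [Store.write_apply, if_neg]
    rintro ⟨rfl, -⟩
    exact NExpr.eval_notMem_of_avoids ha σ ha') h
  have one : ∀ c : Config W X Z E m n, c.time + 1 ≤ c.time + (K + 2) ^ 1 := fun c => by
    rw [pow_one]; omega
  induction P with
  | assign a i e =>
    intro c hc d hd
    rw [exec, List.mem_singleton] at hd
    subst hd
    exact ⟨hw hP _ _ _ hc, one c⟩
  | rand a i e =>
    intro c hc d hd
    rw [exec] at hd
    obtain ⟨v, -, rfl⟩ := List.mem_map.1 hd
    exact ⟨hw hP _ _ _ hc, one c⟩
  | meas r a i =>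
    intro c hc d hd
    rw [exec] at hd
    split at hd
    · simp only [List.mem_cons, List.not_mem_nil, or_false] at hd
      rcases hd with rfl | rfl
      · exact ⟨hw hP _ _ _ hc, one c⟩
      · exact ⟨hw hP _ _ _ hc, one c⟩
    · rw [List.mem_singleton] at hd
      subst hd
      exact ⟨hc, one c⟩
  | not t =>
    intro c hc d hd
    rw [exec] at hd
    split at hd <;> (rw [List.mem_singleton] at hd; subst hd; exact ⟨hc, one c⟩)
  | cnot s t =>
    intro c hc d hd
    rw [exec] at hd
    split at hd <;> (rw [List.mem_singleton] at hd; subst hd; exact ⟨hc, one c⟩)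
  | ccnot s r t =>
    intro c hc d hd
    rw [exec] at hd
    split at hd <;> (rw [List.mem_singleton] at hd; subst hd; exact ⟨hc, one c⟩)
  | had t =>
    intro c hc d hd
    rw [exec] at hd
    split at hd <;> (rw [List.mem_singleton] at hd; subst hd; exact ⟨hc, one c⟩)
  | phase t =>
    intro c hc d hd
    rw [exec] at hd
    split at hd <;> (rw [List.mem_singleton] at hd; subst hd; exact ⟨hc, one c⟩)
  | call e =>
    intro c hc d hd
    rw [exec, List.mem_singleton] at hd
    subst hd
    exact ⟨hc, one c⟩
  | seq P Q ihP ihQ =>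
    intro c hc d hd
    rw [safe, Bool.and_eq_true] at hP
    rw [exec, List.mem_flatMap] at hd
    obtain ⟨c₁, h1, h2⟩ := hd
    obtain ⟨i₁, t₁⟩ := ihP hP.1 c hc c₁ h1
    obtain ⟨i₂, t₂⟩ := ihQ hP.2 c₁ i₁ d h2
    refine ⟨i₂, ?_⟩
    have := add_pow_le_pow_add (B := K + 2) (by omega) P.size_pos Q.size_pos
    rw [size]
    omega
  | ite e f P Q ihP ihQ =>
    intro c hc d hd
    rw [safe, Bool.and_eq_true] at hP
    have h3 := add_pow_le_pow_add (B := K + 2) (by omega) P.size_pos Q.size_pos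
    have h4 := add_pow_le_pow_add (B := K + 2) (a := P.size + Q.size) (b := 1) (by omega)
      (by have := P.size_pos; omega) one_pos
    rw [pow_one] at h4
    rw [exec] at hd
    rw [size]
    split at hd
    · obtain ⟨i₁, t₁⟩ := ihP hP.1 c.tick hc d hd
      simp only [Config.tick] at t₁
      exact ⟨i₁, by omega⟩
    · obtain ⟨i₁, t₁⟩ := ihQ hP.2 c.tick hc d hd
      simp only [Config.tick] at t₁
      exact ⟨i₁, by omega⟩
  | loop e P ih =>
    intro c hc d hd
    rw [safe, Bool.and_eq_true] at hP
    rw [exec] at hd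
    have key : ∀ j, ∀ d ∈ (fun L : List (Config W X Z E m n) =>
        L.flatMap fun d => Prog.exec enc A P d.tick)^[j] [c.tick],
        I d.mem ∧ d.time ≤ c.time + 1 + j * (1 + (K + 2) ^ P.size) := by
      intro j
      induction j with
      | zero =>
        intro d hd
        rw [Function.iterate_zero, id, List.mem_singleton] at hd
        subst hd
        exact ⟨hc, by simp [Config.tick]⟩
      | succ j ihj =>
        intro d hd
        rw [Function.iterate_succ_apply', List.mem_flatMap] at hd
        obtain ⟨c₁, h1, h2⟩ := hd
        obtain ⟨i₁, t₁⟩ := ihj c₁ h1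
        obtain ⟨i₂, t₂⟩ := ih hP.2 c₁.tick i₁ d h2
        simp only [Config.tick] at t₂
        refine ⟨i₂, ?_⟩
        rw [add_mul, one_mul]
        omega
    obtain ⟨i₁, t₁⟩ := key _ d hd
    refine ⟨i₁, t₁.trans ?_⟩
    -- At most `K` rounds, each with one step for the iteration. The additional 2 in the base
    -- absorbs this overhead.
    have h1 : e.eval c.mem * (1 + (K + 2) ^ P.size) ≤ K * (1 + (K + 2) ^ P.size) :=
      Nat.mul_le_mul_right _ (hb e hP.1 _ hc)
    have h2 : K + 2 ≤ (K + 2) ^ P.size := Nat.le_self_pow P.size_pos.ne' _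
    rw [size, pow_succ]
    nlinarith

/-- The bounds of the loops of the simulator that do not refer to the tables. -/
def paramBound : NExpr → Bool
  | .read (.lit 0) (.lit i) => decide (i < 5)
  | .add (.read (.lit 0) (.lit 1)) (.read (.lit 0) (.lit 1)) => true
  | _ => false

/-- The bounds of the loops of the simulator. -/
def stageBound : NExpr → Bool
  | .read (.lit 4) (.add (.read (.lit 0) (.lit 1)) (.read (.lit 0) (.lit 1))) => true
  | .read (.lit 6) (.read (.lit 0) (.lit 3)) => true
  | e => paramBound e

theorem paramBound_le {e : NExpr} (he : paramBound e = true) {σ : Store} {s : ℕ} (hn : σ 0 0 = n)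
    (hq : σ 0 1 = q) (hk : σ 0 2 = k) (hm : σ 0 3 = m) (hs : σ 0 4 = s) (hsn : s ≤ n) :
    e.eval σ ≤ 2 * (n + q + k + m + 2) := by
  unfold paramBound at he
  split at he
  · rename_i i
    have := of_decide_eq_true he
    simp only [NExpr.eval]
    interval_cases i <;> omega
  · simp only [NExpr.eval, hq]
    omega
  · exact absurd he (by simp)

theorem two_mul_le_pow {B : ℕ} (hB : 2 ≤ B) (r : ℕ) : 2 * B ^ r ≤ B ^ (r + 1) := by
  rw [pow_succ']
  exact Nat.mul_le_mul_right _ hB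

/-- The largest loop bound is the length `m (2q)² (k + 1)` of the seed; the others are table entries
and parameters. -/
theorem stageBound_le {e : NExpr} (he : stageBound e = true) {σ : Store} {s : ℕ}
    (h : Params n q k m s σ) (hsn : s ≤ n) : e.eval σ ≤ (n + q + k + m + 2) ^ 6 := by
  set B := n + q + k + m + 2 with hB
  have h2 : 2 ≤ B := by omega
  have hq : 2 * q ≤ B ^ 2 := by
    have := two_mul_le_pow h2 1
    rw [pow_one] at this
    exact le_trans (by omega) this
  have hD : 2 * q * (k + 1) ≤ B ^ 3 := by
    rw [pow_succ]
    exact Nat.mul_le_mul hq (by omega)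
  have hN : m * (2 * q * (2 * q * (k + 1))) ≤ B ^ 6 := by
    rw [show B ^ 6 = B * (B ^ 2 * B ^ 3) by ring]
    exact Nat.mul_le_mul (by omega) (Nat.mul_le_mul hq hD)
  unfold stageBound at he
  split at he
  · simp only [NExpr.eval, h.hq]
    rw [← two_mul, h.tab₁ _ le_rfl]
    exact hD.trans (Nat.pow_le_pow_right (by omega) (by omega))
  · simp only [NExpr.eval, h.hm]
    rw [h.tab₃ _ le_rfl]
    exact hN
  · refine (paramBound_le he h.hn h.hq h.hk h.hm h.hs hsn).trans ?_
    have := two_mul_le_pow h2 1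
    rw [pow_one] at this
    exact this.trans (Nat.pow_le_pow_right (by omega) (by omega))

theorem tablesProg_safe :
    (Prog.ite (param 4) (.lit 0) tablesProg idle).safe [0] paramBound = true := by decide

theorem stageProg_safe : stageProg.safe [0, 4, 5, 6] stageBound = true := by decide

/-- The bound is proved in two phases. While the tables are written, all loop bounds are parameters
and only array 0 has to be protected. Afterwards loop bounds may be table entries, and the tables
are protected as well. -/
theorem simulator_time_le {s : ℕ} (hsn : s ≤ n) (c : Config W X Z E m n) (hn : c.mem 0 0 = n)
    (hq : c.mem 0 1 = q) (hk : c.mem 0 2 = k) (hm : c.mem 0 3 = m) (hs : c.mem 0 4 = s)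
    (h : ∀ d ∈ (Prog.ite (param 4) (.lit 0) tablesProg idle).exec enc A c,
      Params n q k m s d.mem) :
    ∀ d ∈ simulator.exec enc A c,
      d.time ≤ c.time + (n + q + k + m + 2) ^ (7 * simulator.size) := by
  intro d hd
  set B := n + q + k + m + 2 with hB
  have h2 : 2 ≤ B := by omega
  rw [simulator, Prog.exec, List.mem_flatMap] at hd
  obtain ⟨c₁, h1, hd⟩ := hd
  have t₁ := (Prog.time_le (K := B ^ 6) (I := fun σ => σ 0 0 = n ∧ σ 0 1 = q ∧ σ 0 2 = k ∧
      σ 0 3 = m ∧ σ 0 4 = s)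
    (fun σ τ h hσ => by
      have := h 0 (by simp)
      simpa only [this] using hσ)
    (fun e he σ ⟨g1, g2, g3, g4, g5⟩ => by
      refine (paramBound_le he g1 g2 g3 g4 g5 hsn).trans ?_
      have := two_mul_le_pow h2 1
      rw [pow_one] at this
      exact this.trans (Nat.pow_le_pow_right (by omega) (by omega)))
    _ tablesProg_safe c ⟨hn, hq, hk, hm, hs⟩ c₁ h1).2
  have t₂ := (Prog.time_le (K := B ^ 6) (I := Params n q k m s)
    (fun σ τ h hσ => hσ.congr fun a i ha => h a (by simpa using ha) i)
    (fun e he σ g => stageBound_le he g hsn) _ stageProg_safe c₁ (h c₁ h1) d hd).2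
  have t₃ := add_pow_le_pow_add (B := B ^ 6 + 2) (by omega)
    (Prog.ite (param 4) (.lit 0) tablesProg idle).size_pos stageProg.size_pos
  -- Loop bounds are at most `B ^ 6`, and `B ^ 6 + 2 ≤ B ^ 7`; hence the 7 in the exponent.
  have t₄ : (B ^ 6 + 2) ^ simulator.size ≤ B ^ (7 * simulator.size) := by
    rw [pow_mul]
    refine Nat.pow_le_pow_left ?_ _
    have : 2 * B ^ 6 ≤ B ^ 7 := two_mul_le_pow h2 6
    have h6 : 2 ≤ B ^ 6 := h2.trans (Nat.le_self_pow (by norm_num) B)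
    omega
  have e : simulator.size = (Prog.ite (param 4) (.lit 0) tablesProg idle).size + stageProg.size :=
    rfl
  rw [← e] at t₃
  omega

end

section
variable {W k m n q : ℕ} {X Z E : Type} [Fintype X] [DecidableEq X] [Fintype Z] [DecidableEq Z]
  [Fintype E] [DecidableEq E]

theorem params_of_stage_zero (enc : X ↪ BitStr k) (A : OracleAlg X Z E m n q)
    (T : Fin n → BitStr m) :
    ∀ d ∈ (Prog.ite (param 4) (.lit 0) tablesProg idle).exec enc A
      { (startInteraction W k A).cfg with
        mem := stageInput T (startInteraction W k A).perm 0 (startInteraction W k A).cfg.mem },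
      Params n q k m 0 d.mem := by
  set c : Config W X Z E m n := { (startInteraction W k A).cfg with
    mem := stageInput T (startInteraction W k A).perm 0 (startInteraction W k A).cfg.mem } with hc
  have h4 : c.mem 0 4 = 0 := by simp [hc, stageInput]
  have main : Det enc A (Prog.ite (param 4) (.lit 0) tablesProg idle) c fun σ _ =>
      Params n q k m 0 σ := by
    refine det_ite (fun _ => (det_tablesProg (n := n) (q := q) (k := k) (m := m)
      (S := 0) c.tick ?_ ?_ ?_ ?_ h4 ?_ ?_ ?_).mono fun σ φ H => H.2.1) fun h => ?_
    · simp [Config.tick, hc, stageInput, startInteraction]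
    · simp [Config.tick, hc, stageInput, startInteraction]
    · simp [Config.tick, hc, stageInput, startInteraction]
    · simp [Config.tick, hc, stageInput, startInteraction]
    · simp [Config.tick, hc, stageInput, startInteraction]
    · simp [Config.tick, hc, stageInput, startInteraction]
    · simp [Config.tick, hc, stageInput, startInteraction]
    · exact absurd (show c.mem 0 4 ≤ 0 by rw [h4]) h
  obtain ⟨c', h1, h2⟩ := main
  intro d hd
  rw [h1, List.mem_singleton] at hd
  rwa [hd]

theorem params_of_stage_succ {enc : X ↪ BitStr k} {A : OracleAlg X Z E m n q} {s : ℕ}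
    {c : Config W X Z E m n} (h : Params n q k m (s + 1) c.mem) :
    ∀ d ∈ (Prog.ite (param 4) (.lit 0) tablesProg idle).exec enc A c,
      Params n q k m (s + 1) d.mem := by
  have main : Det enc A (Prog.ite (param 4) (.lit 0) tablesProg idle) c fun σ _ =>
      Params n q k m (s + 1) σ := by
    refine det_ite (fun hle => ?_) fun _ => det_assign (h.congr fun a i ha => ?_)
    · simp only [NExpr.eval, param, h.hs] at hle
      omega
    · simp only [NExpr.eval]
      rw [Store.write_apply, if_neg (by omega)]
      rfl
  obtain ⟨c', h1, h2⟩ := main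
  intro d hd
  rw [h1, List.mem_singleton] at hd
  rwa [hd]

theorem simulator_runsInTime (hn : 0 < n) (hW : 2 * q + n + 3 ≤ W)
    (hW' : 2 * q * (k + 1) + k + 1 ≤ W) (enc : X ↪ BitStr k) (A : OracleAlg X Z E m n q) :
    RunsInTime W simulator enc A ((n + 1) * (n + q + k + m + 2) ^ (7 * simulator.size)) := by
  intro T
  have key : ∀ s ≤ n, ∀ r ∈ runStages W simulator enc A T (s + 1),
      r.cfg.time ≤ (s + 1) * (n + q + k + m + 2) ^ (7 * simulator.size) := by
    intro s
    induction s with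
    | zero =>
      intro _ r hr
      simp only [runStages, List.flatMap_cons, List.flatMap_nil, List.append_nil] at hr
      obtain ⟨d, hd, rfl⟩ := List.mem_map.1 hr
      have := simulator_time_le (s := 0) (Nat.zero_le _) _ ?_ ?_ ?_ ?_ ?_
        (params_of_stage_zero enc A T) d hd
      · simpa [startInteraction] using this
      all_goals simp [stageInput, startInteraction]
    | succ s ih =>
      intro hs r hr
      rw [runStages, List.mem_flatMap] at hr
      obtain ⟨r₁, hr₁, hr⟩ := hr
      obtain ⟨d, hd, rfl⟩ := List.mem_map.1 hr
      -- The invariant holds in all branches, also in those with zero vector, and it supplies the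
      -- parameters and tables at the start of the next stage.
      obtain ⟨f, lam, v, pts, hf, h⟩ := exists_stageInv hn hW hW' enc A T s (by omega) r₁ hr₁
      have p := h.inv.params.stageInput T r₁.perm (s + 1)
      have t₁ := ih (by omega) r₁ hr₁
      have t₂ := simulator_time_le hs
        { r₁.cfg with mem := stageInput T r₁.perm (s + 1) r₁.cfg.mem }
        p.hn p.hq p.hk p.hm p.hs (params_of_stage_succ p) d hd
      simp only at t₂ ⊢
      rw [add_mul _ 1, one_mul]
      omega
  exact key n le_rfl

end
end MeasureReprogram

open MeasureReprogram in
theorem theorem2 :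
    ∃ (S : Prog) (d : ℕ),
      ∀ (n m k q : ℕ), 0 < n →
      ∀ (X : Type) [Fintype X] [DecidableEq X] (enc : X ↪ BitStr k)
        (Z E : Type) [Fintype Z] [DecidableEq Z] [Fintype E] [DecidableEq E]
        (A : OracleAlg X Z E m n q),
        RunsInTime ((n + q + k + m + 2) ^ d) S enc A ((n + q + k + m + 2) ^ d) ∧
        WellFormed ((n + q + k + m + 2) ^ d) S enc A ∧
        ∀ (xo : Fin n → X), Function.Injective xo → ∀ V : QPredicate X Z m n,
          (1 / (2 * (q : ℝ) + 1) ^ (2 * n)) * A.successProb V xo ≤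
            simProb ((n + q + k + m + 2) ^ d) S enc A V xo := by
  -- A stage takes at most `B ^ (7 * simulator.size)` steps, and one more factor `B` covers the `n +
  -- 1` stages. The same exponent leaves enough rows and columns of work qubits, for which 4 would
  -- do.
  refine ⟨simulator, 7 * simulator.size + 1, fun n m k q hn X _ _ enc Z E _ _ _ _ A => ?_⟩
  have hd : 4 ≤ 7 * simulator.size + 1 := by
    have := simulator.size_pos
    omega
  set B := n + q + k + m + 2 with hB
  have h2 : 2 ≤ B := by omega
  have h4 : B ^ 4 ≤ B ^ (7 * simulator.size + 1) := Nat.pow_le_pow_right (by omega) hd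
  have hW : 2 * q + n + 3 ≤ B ^ (7 * simulator.size + 1) := by
    have h1 : 2 * B ^ 1 ≤ B ^ 2 := two_mul_le_pow h2 1
    have h3 : B ^ 2 ≤ B ^ 4 := Nat.pow_le_pow_right (by omega) (by norm_num)
    rw [pow_one] at h1
    omega
  have hW' : 2 * q * (k + 1) + k + 1 ≤ B ^ (7 * simulator.size + 1) := by
    have h1 : (2 * q + 1) * (k + 1) ≤ 2 * B * B := Nat.mul_le_mul (by omega) (by omega)
    have h3 : 2 * B ^ 2 ≤ B ^ 3 := two_mul_le_pow h2 2
    have h5 : B ^ 3 ≤ B ^ 4 := Nat.pow_le_pow_right (by omega) (by norm_num)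
    have h6 : 2 * B * B = 2 * B ^ 2 := by ring
    have h7 : (2 * q + 1) * (k + 1) = 2 * q * (k + 1) + (k + 1) := by ring
    omega
  refine ⟨fun T r hr => (simulator_runsInTime hn hW hW' enc A T r hr).trans ?_,
    simulator_wellFormed hn hW hW' enc A, fun xo hxo V => simProb_ge hn hW hW' enc A hxo V⟩
  rw [pow_succ']
  exact Nat.mul_le_mul_right _ (by omega)
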